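/- Let $\mathfrak{sl}_2=\mathfrak{sl}_2(\mathbb C)$ with standard basis $e,h,f$, and let $\widehat{\mathfrak{sl}}_2=\mathfrak{sl}_2((t))\oplus\mathbb C K$ be the affine Lie algebra, with $K$ central and $$[A\otimes a,\,B\otimes b]=[A,B]\otimes ab+\operatorname{tr}(AB)\,\operatorname{Res}_{t=0}(a'b\,dt)\,K .$$ Write $A(n)=A\otimes t^n$. For $\chi,k\in\mathbb C$ let $M_{\chi,k}$ be the Verma module, i.e. the $\widehat{\mathfrak{sl}}_2$-module generated by a vector $v_{\chi,k}$ subject only to the relations that $e\otimes 1$ and $\mathfrak{sl}_2\otimes t\mathbb C[[t]]$ annihilate $v_{\chi,k}$, $h(0)v_{\chi,k}=\chi v_{\chi,k}$, and $Kv_{\chi,k}=kv_{\chi,k}$. The critical level is $k=-2$. For an integer $m\ge 0$ let $V_{m,-2}$ be the quotient of $M_{m,-2}$ by the submodule generated by $f(0)^{m+1}v_{m,-2}$, and let $v$ be the image of $v_{m,-2}$ in it. The Sugawara operators are $$S_n=\tfrac12\sum_{j\in\mathbb Z}\Big(:\!e(j)f(n-j)\!:+:\!f(j)e(n-j)\!:+\tfrac12:\!h(j)h(n-j)\!:\Big),\qquad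 n\in\mathbb Z,$$ where $:\!A(j)B(l)\!:$ is $A(j)B(l)$ for $j<0$ and $B(l)A(j)$ for $j\ge0$. Let $q(t)=\sum_{n\le 0}q_nt^{-n-2}\in\mathbb C((t))$ with $q_0=\frac{m(m+2)}4$, that is, $q(t)=\frac{m(m+2)}{4t^2}+\dots$, where the dots stand for terms of order $\ge -1$ in $t$; put $q_n=0$ for $n>0$. Let $V_m^{q(t)}$ be the quotient of $V_{m,-2}$ by the central character of the projective connection $\partial_t^2-q(t)$, i.e. by the submodule generated by the vectors $(S_n-q_n)v$, $n\in\mathbb Z$. The projective connection $\partial_t^2-q(t)$ is said to have monodromy $\pm1$ around $0$ if the space of solutions $\phi\in\mathbb C((t^{1/2}))[\log t]$ of $(\partial_t^2-q(t))\phi=0$ is two-dimensional and the monodromy operator, $t^{1/2}\mapsto -t^{1/2}$, $\log t\mapsto\log t+2\pi i$, acts on it as the scalar $1$ or as the scalar $-1$. Then the following are equivalent: (a) $V_m^{q(t)}\neq0$; (b) $\partial_t^2-q(t)$ has monodromy $\pm1$ around $0$; (c) the Riccati (Miura) equation $q(t)=\frac14\chi(t)^2-\frac12\partial_t\chi(t)$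 has a solution $\chi(t)\in\mathbb C((t))$ of the form $\chi(t)=\frac mt+\dots$, where the dots stand for terms of order $\ge0$ in $t$. -/

import Mathlib

noncomputable section

namespace CriticalSl2

/-- The field `ℂ((t))` of formal Laurent series. -/
abbrev Laurent : Type := LaurentSeries ℂ

theorem smul_eq_C_mul (r : ℂ) (f : Laurent) : r • f = HahnSeries.C r * f :=
  HahnSeries.C_mul_eq_smul.symm

/-- The coefficientwise `ℂ`-algebra structure of `ℂ((t))`. -/
instance : Algebra ℂ Laurent where
  algebraMap := HahnSeries.C
  smul r f := r • f
  commutes' _ _ := mul_comm _ _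
  smul_def' := smul_eq_C_mul

instance : IsScalarTower ℂ Laurent Laurent where
  smul_assoc r f g := by simp only [smul_eq_C_mul, smul_eq_mul, mul_assoc]

instance : SMulCommClass ℂ Laurent Laurent where
  smul_comm r f g := by simp only [smul_eq_C_mul, smul_eq_mul, mul_left_comm]

/-- The derivation `∂_t` of `ℂ((t))`. -/
abbrev ddt : Laurent →ₗ[ℂ] Laurent := LaurentSeries.derivative ℂ

/-- The residue `Res f dt`, i.e. the coefficient of `t⁻¹`. -/
def res (f : Laurent) : ℂ := f.coeff (-1)

/-- The monomial `t ^ n`. -/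
def tpow (n : ℤ) : Laurent := HahnSeries.single n 1

theorem ddt_coeff (f : Laurent) (n : ℤ) :
    (ddt f).coeff n = ((n : ℂ) + 1) * f.coeff (n + 1) := by
  simp [ddt]

/-- The Leibniz rule in `ℂ((t))`. -/
theorem ddt_mul (f g : Laurent) : ddt (f * g) = ddt f * g + f * ddt g := by
  -- work with the Euler operator `t ∂_t`, which only rescales coefficients
  have key : ∀ u : Laurent, ∃ θ : Laurent,
      (∀ n, θ.coeff n = (n : ℂ) * u.coeff n) ∧ θ.support ⊆ u.support ∧
      ddt u = HahnSeries.single (-1) 1 * θ := by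
    intro u
    have hc : ∀ n, (HahnSeries.single (1 : ℤ) (1 : ℂ) * ddt u).coeff n = (n : ℂ) * u.coeff n := by
      intro n
      rw [HahnSeries.coeff_single_mul, ddt_coeff]
      simp
    refine ⟨HahnSeries.single 1 1 * ddt u, hc, ?_, ?_⟩
    · intro n hn
      rw [HahnSeries.mem_support, hc] at hn
      exact right_ne_zero_of_mul hn
    · rw [← mul_assoc, HahnSeries.single_mul_single]
      simp
  obtain ⟨θf, hf, sf, ef⟩ := key f
  obtain ⟨θg, hg, sg, eg⟩ := key g
  obtain ⟨θp, hp, -, ep⟩ := key (f * g)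
  have hθ : θp = θf * g + f * θg := by
    ext n
    rw [hp, HahnSeries.coeff_add, HahnSeries.coeff_mul,
      HahnSeries.coeff_mul_left' f.isPWO_support sf,
      HahnSeries.coeff_mul_right' g.isPWO_support sg, Finset.mul_sum, ← Finset.sum_add_distrib]
    refine Finset.sum_congr rfl fun ij hij => ?_
    have : ij.1 + ij.2 = n := by simpa using (Finset.mem_antidiagonal.mp hij).2.2
    rw [hf, hg, ← this]
    push_cast
    ring
  rw [ep, ef, eg, hθ]
  ring

theorem res_ddt (f : Laurent) : res (ddt f) = 0 := by
  rw [res, ddt_coeff]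
  simp

/-! ### The affine Lie algebra -/

/-- The affine Lie algebra `sl₂((t)) ⊕ ℂ K`. The element with components `(e, h, f, c)` is
`E ⊗ e + H ⊗ h + F ⊗ f + c K`, where `E, H, F` is the standard basis of `sl₂`. -/
@[ext]
structure AffineSl2 where
  e : Laurent
  h : Laurent
  f : Laurent
  c : ℂ

namespace AffineSl2

/-- The underlying space as a direct product. -/
def equivProd : AffineSl2 ≃ Laurent × Laurent × Laurent × ℂ where
  toFun x := (x.e, x.h, x.f, x.c)
  invFun p := ⟨p.1, p.2.1, p.2.2.1, p.2.2.2⟩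
  left_inv _ := rfl
  right_inv _ := rfl

instance : AddCommGroup AffineSl2 := equivProd.addCommGroup
instance : Module ℂ AffineSl2 := equivProd.module ℂ

@[simp] theorem add_e (x y : AffineSl2) : (x + y).e = x.e + y.e := rfl
@[simp] theorem add_h (x y : AffineSl2) : (x + y).h = x.h + y.h := rfl
@[simp] theorem add_f (x y : AffineSl2) : (x + y).f = x.f + y.f := rfl
@[simp] theorem add_c (x y : AffineSl2) : (x + y).c = x.c + y.c := rfl
@[simp] theorem smul_e (r : ℂ) (x : AffineSl2) : (r • x).e = r • x.e := rfl
@[simp] theorem smul_h (r : ℂ) (x : AffineSl2) : (r • x).h = r • x.h := rfl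
@[simp] theorem smul_f (r : ℂ) (x : AffineSl2) : (r • x).f = r • x.f := rfl
@[simp] theorem smul_c (r : ℂ) (x : AffineSl2) : (r • x).c = r * x.c := rfl
@[simp] theorem zero_e : (0 : AffineSl2).e = 0 := rfl
@[simp] theorem zero_h : (0 : AffineSl2).h = 0 := rfl
@[simp] theorem zero_f : (0 : AffineSl2).f = 0 := rfl
@[simp] theorem zero_c : (0 : AffineSl2).c = 0 := rfl

/-- The cocycle `Res tr(∂_t x · y) dt`; on `A ⊗ tⁿ`, `B ⊗ tˡ` it is `n tr(AB) δ_{n,-l}`. The trace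
form is the invariant form for which the maximal root has square `2`. -/
def cocycle (x y : AffineSl2) : ℂ :=
  res (ddt x.e * y.f + ddt x.f * y.e + 2 * (ddt x.h * y.h))

/-- `[A ⊗ a, B ⊗ b] = [A, B] ⊗ ab + tr(AB) Res(a' b) K`, with `K` central. -/
instance : Bracket AffineSl2 AffineSl2 where
  bracket x y :=
    { e := 2 * (x.h * y.e - x.e * y.h)
      h := x.e * y.f - x.f * y.e
      f := 2 * (x.f * y.h - x.h * y.f)
      c := cocycle x y }

@[simp] theorem lie_e (x y : AffineSl2) : ⁅x, y⁆.e = 2 * (x.h * y.e - x.e * y.h) := rfl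
@[simp] theorem lie_h (x y : AffineSl2) : ⁅x, y⁆.h = x.e * y.f - x.f * y.e := rfl
@[simp] theorem lie_f (x y : AffineSl2) : ⁅x, y⁆.f = 2 * (x.f * y.h - x.h * y.f) := rfl
@[simp] theorem lie_c (x y : AffineSl2) : ⁅x, y⁆.c = cocycle x y := rfl

theorem ddt_two_mul (a : Laurent) : ddt (2 * a) = 2 * ddt a := by
  rw [two_mul, map_add, two_mul]

theorem res_add (a b : Laurent) : res (a + b) = res a + res b := rfl

theorem res_smul (r : ℂ) (a : Laurent) : res (r • a) = r * res a := rfl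

instance : LieRing AffineSl2 where
  add_lie x y z := by
    ext1
    · simp; ring
    · simp; ring
    · simp; ring
    · simp only [lie_c, add_c, cocycle, add_e, add_h, add_f, map_add, ← res_add]
      congr 1; ring
  lie_add x y z := by
    ext1
    · simp; ring
    · simp; ring
    · simp; ring
    · simp only [lie_c, add_c, cocycle, add_e, add_h, add_f, ← res_add]
      congr 1; ring
  lie_self x := by
    ext1
    · rw [lie_e, zero_e]; ring
    · rw [lie_h, zero_h]; ring
    · rw [lie_f, zero_f]; ring
    · rw [lie_c, zero_c, cocycle, ← res_ddt (x.e * x.f + x.h * x.h)]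
      simp only [map_add, ddt_mul]
      congr 1; ring
  leibniz_lie x y z := by
    ext1
    · simp; ring
    · simp; ring
    · simp; ring
    · simp only [lie_c, add_c, cocycle, lie_e, lie_h, lie_f, ← res_add, ddt_two_mul]
      simp only [map_sub, ddt_mul]
      congr 1; ring

instance : LieAlgebra ℂ AffineSl2 where
  lie_smul r x y := by
    ext1
    · simp only [lie_e, smul_e, smul_h, smul_eq_C_mul]; ring
    · simp only [lie_h, smul_h, smul_e, smul_f, smul_eq_C_mul]; ring
    · simp only [lie_f, smul_f, smul_h, smul_eq_C_mul]; ring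
    · simp only [lie_c, smul_c, cocycle, smul_e, smul_h, smul_f, ← res_smul, smul_eq_C_mul]
      congr 1; ring

/-- The image in `sl₂((t))`, as a matrix over `ℂ((t))`. -/
def toMatrix (x : AffineSl2) : Matrix (Fin 2) (Fin 2) Laurent := !![x.h, x.e; x.f, -x.h]

theorem toMatrix_lie (x y : AffineSl2) :
    toMatrix ⁅x, y⁆ = toMatrix x * toMatrix y - toMatrix y * toMatrix x := by
  rw [toMatrix, toMatrix, toMatrix, Matrix.mul_fin_two, Matrix.mul_fin_two, lie_e, lie_h, lie_f]
  refine Matrix.ext fun i j => ?_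
  fin_cases i <;> fin_cases j <;>
    simp only [Matrix.sub_apply, Matrix.of_apply, Matrix.cons_val', Matrix.cons_val_zero,
      Matrix.cons_val_one, Matrix.cons_val_fin_one, Fin.zero_eta, Fin.mk_one, Fin.isValue] <;>
    ring

theorem cocycle_eq_trace (x y : AffineSl2) :
    cocycle x y = res (((toMatrix x).map ddt * toMatrix y).trace) := by
  rw [cocycle]
  congr 1
  simp [toMatrix, Matrix.trace, Matrix.mul_apply, Fin.sum_univ_two]
  ring

end AffineSl2

/-- The universal enveloping algebra of the affine algebra. -/
abbrev U : Type := UniversalEnvelopingAlgebra ℂ AffineSl2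

/-- The element `E(n) = E ⊗ tⁿ` of the enveloping algebra. -/
def eMode (n : ℤ) : U := UniversalEnvelopingAlgebra.ι ℂ (⟨tpow n, 0, 0, 0⟩ : AffineSl2)

/-- The element `H(n) = H ⊗ tⁿ` of the enveloping algebra. -/
def hMode (n : ℤ) : U := UniversalEnvelopingAlgebra.ι ℂ (⟨0, tpow n, 0, 0⟩ : AffineSl2)

/-- The element `F(n) = F ⊗ tⁿ` of the enveloping algebra. -/
def fMode (n : ℤ) : U := UniversalEnvelopingAlgebra.ι ℂ (⟨0, 0, tpow n, 0⟩ : AffineSl2)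

/-! ### Modules -/

/-- The subspace `(𝔟₊ ⊗ 1) ⊕ (sl₂ ⊗ t ℂ[[t]]) ⊕ ℂ K`: the components along `E` and `H` lie in
`ℂ[[t]]`, and the component along `F` lies in `t ℂ[[t]]`. -/
def borel : Set AffineSl2 :=
  {x | (∀ n < 0, x.e.coeff n = 0) ∧ (∀ n < 0, x.h.coeff n = 0) ∧ (∀ n ≤ 0, x.f.coeff n = 0)}

/-- The left ideal generated by `x - λ(x)`, `x` in the Borel subalgebra, where `λ` is the character
with `λ(H ⊗ 1) = χ`, `λ(K) = k`, and `λ = 0` on `E ⊗ 1` and `sl₂ ⊗ t ℂ[[t]]`. -/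
def vermaIdeal (χ k : ℂ) : Submodule U U :=
  Submodule.span U
    {u | ∃ x ∈ borel,
      u = UniversalEnvelopingAlgebra.ι ℂ x - algebraMap ℂ U (χ * x.h.coeff 0 + k * x.c)}

/-- The Verma module `M_{χ,k}` induced from the character `λ` of the Borel subalgebra. -/
abbrev Verma (χ k : ℂ) : Type := U ⧸ vermaIdeal χ k

/-- The highest weight vector of the Verma module. -/
def vermaVec (χ k : ℂ) : Verma χ k := Submodule.Quotient.mk 1

/-- `V_{m,-2}`: the quotient of `M_{m,-2}` by the submodule generated by `F(0)^{m+1} v`. -/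
abbrev Weyl (m : ℕ) : Type :=
  Verma (m : ℂ) (-2) ⧸
    (Submodule.span U {fMode 0 ^ (m + 1) • vermaVec (m : ℂ) (-2)} :
      Submodule U (Verma (m : ℂ) (-2)))

/-- The image in `V_{m,-2}` of the highest weight vector. -/
def weylVec (m : ℕ) : Weyl m := Submodule.Quotient.mk (vermaVec (m : ℂ) (-2))

/-- The `j`-th summand `∑_a :J_a(j) J_a(n-j):` of the Sugawara operator, where `J_a` is an
orthonormal basis of `sl₂`, so that `∑_a J_a ⊗ J_a = E ⊗ F + F ⊗ E + ½ H ⊗ H`. In a normally ordered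
product `:A(j) B(l):` the factor `A(j)` stands to the left if `j < 0`, to the right if `j ≥ 0`. -/
def sugawaraTerm (n j : ℤ) : U :=
  if j < 0 then
    eMode j * fMode (n - j) + fMode j * eMode (n - j) + (1 / 2 : ℂ) • (hMode j * hMode (n - j))
  else
    fMode (n - j) * eMode j + eMode (n - j) * fMode j + (1 / 2 : ℂ) • (hMode (n - j) * hMode j)

/-- The Sugawara operator `S_n = ½ ∑_j ∑_a :J_a(j) J_a(n-j):`, applied to a vector that is
annihilated by all but finitely many summands. -/
def sugawara {M : Type*} [AddCommGroup M] [Module U M] (n : ℤ) (w : M) : M :=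
  algebraMap ℂ U (1 / 2) • ∑ᶠ j : ℤ, sugawaraTerm n j • w

/-- `q_n`, the coefficient of `t^{-n-2}` in `q(t)`. -/
def qCoeff (q : Laurent) (n : ℤ) : ℂ := q.coeff (-n - 2)

/-- The submodule of `V_{m,-2}` generated by the vectors `(S_n - q_n) v`, `n ∈ ℤ`. -/
def centralSubmodule (m : ℕ) (q : Laurent) : Submodule U (Weyl m) :=
  Submodule.span U
    {w | ∃ n : ℤ, w = sugawara n (weylVec m) - algebraMap ℂ U (qCoeff q n) • weylVec m}

/-- `V_m^{q(t)}`: the quotient of `V_{m,-2}` by the central character of `∂_t² - q(t)`. -/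
abbrev WeylQuotient (m : ℕ) (q : Laurent) : Type := Weyl m ⧸ centralSubmodule m q

/-! ### Monodromy

The solutions of `(∂_t² - q) φ = 0` are sought in `ℂ((s))[ℓ]`, where `s = t^{1/2}` and `ℓ = log t`.
For `q = m(m+2)/(4t²) + …` the exponents at `0` are `-m/2` and `m/2 + 1`, so that the solution space
in this ring is the full (two-dimensional) one. -/

/-- The ring `ℂ((t^{1/2}))[log t]`: polynomials in `ℓ = log t` over Laurent series in
`s = t^{1/2}`. -/
abbrev LogLaurent : Type := Polynomial Laurent

/-- The substitution `t = s²`, embedding `ℂ((t))` into `ℂ((s))`. -/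
def substSq : Laurent →+* Laurent :=
  HahnSeries.embDomainRingHom (AddMonoidHom.mulLeft (2 : ℤ))
    (fun a b hab => by simpa using hab) (fun a b => by simp)

/-- `∂_t = (2s)⁻¹ ∂_s` on `ℂ((s))`. -/
def halfDeriv : Laurent →ₗ[ℂ] Laurent :=
  LinearMap.mulLeft ℂ (HahnSeries.single (-1) (1 / 2 : ℂ)) ∘ₗ ddt

/-- `∂_t` on `ℂ((t^{1/2}))[log t]`: it acts on the coefficients by `halfDeriv`, and
`∂_t ℓ = t⁻¹ = s⁻²`. -/
def logDeriv : LogLaurent →ₗ[ℂ] LogLaurent :=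
  Polynomial.lsum (fun k => (Polynomial.monomial k).restrictScalars ℂ ∘ₗ halfDeriv) +
    (LinearMap.mulLeft Laurent (Polynomial.C (tpow (-2)))).restrictScalars ℂ ∘ₗ
      Polynomial.derivative.restrictScalars ℂ

/-- The substitution `s ↦ -s` in `ℂ((s))`. -/
def negSubst : Laurent →ₗ[ℂ] Laurent where
  toFun f :=
    { coeff := fun n => (-1 : ℂ) ^ n * f.coeff n
      isPWO_support' := f.isPWO_support.mono fun _ hn => right_ne_zero_of_mul hn }
  map_add' f g := by ext n; simp [mul_add]
  map_smul' r f := by ext n; simp [mul_left_comm]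

/-- The monodromy around `0`, i.e. analytic continuation along a positive loop:
`t^{1/2} ↦ -t^{1/2}` and `log t ↦ log t + 2πi`. -/
def monodromy : LogLaurent →ₗ[ℂ] LogLaurent :=
  (Polynomial.taylor (HahnSeries.C (2 * Real.pi * Complex.I))).restrictScalars ℂ ∘ₗ
    Polynomial.lsum (fun k => (Polynomial.monomial k).restrictScalars ℂ ∘ₗ negSubst)

/-- The solutions of `(∂_t² - q(t)) φ = 0` in `ℂ((t^{1/2}))[log t]`. -/
def solutions (q : Laurent) : Submodule ℂ LogLaurent where
  carrier := {φ | logDeriv (logDeriv φ) = Polynomial.C (substSq q) * φ}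
  zero_mem' := by simp
  add_mem' {a b} ha hb := by
    simp only [Set.mem_ofPred_eq] at ha hb ⊢
    rw [map_add, map_add, ha, hb, mul_add]
  smul_mem' r a ha := by
    simp only [Set.mem_ofPred_eq] at ha ⊢
    rw [map_smul, map_smul, ha, mul_smul_comm]

/-- `∂_t² - q(t)` has monodromy `±1` around `0`: its solution space is two-dimensional, and the
monodromy acts on it as the scalar `1` or as the scalar `-1`. -/
def HasMonodromyPlusMinusOne (q : Laurent) : Prop :=
  Module.finrank ℂ (solutions q) = 2 ∧
    ((∀ φ ∈ solutions q, monodromy φ = φ) ∨ (∀ φ ∈ solutions q, monodromy φ = -φ))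

end CriticalSl2

end

noncomputable section

namespace CriticalSl2

/-! ### Finitely supported sums over `ℤ` -/

/-! At `t = 0` the equation has exponents `-m/2` and `m/2 + 1`, which differ by `m + 1`. The larger
one always carries a series solution. For the smaller one the recursion for `t^{-m/2}(1 + a₁t + …)`
has diagonal factor `(n + 1)(n - m)` and gets stuck at `n = m`; the right-hand side that has to
vanish there is `obstruction m (qSeq q)`. All three conditions turn out to be equivalent to its
vanishing.

Miura: the substitution `χ = -2φ'/φ` linearises the Riccati equation, and `χ = m/t + …` corresponds
to `φ = t^{-m/2}(1 + …)` (`exists_miura_iff`). Monodromy: if this `φ` exists, it and the solution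
with exponent `m/2 + 1` span the solution space and have the same monodromy `(-1)^m`. Conversely,
scalar monodromy forbids logarithms, and a two-dimensional space contains a nonzero solution without
the term `t^{m/2+1}`, which must then start with `t^{-m/2}`.

Nonvanishing of the module forces the obstruction to vanish (`IsWeylVector.obstruction_eq_zero`). At
level `-2` the Sugawara operators are central, so `S_n` acts on the whole quotient by `q_n`. Modulo
the images of `e(-l)`, `l ≥ 2`, and `h(-k)`, `k ≥ 1`, the operators `S_{-p-1}` applied to `f(0)ʲ v`
reproduce the Frobenius recursion, and `f(0)^{m+1} v = 0` becomes `obstruction • v ≡ 0`. If the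
obstruction is nonzero, `v` itself lies in the span of these images. The relations for `S_n` also
allow one to solve for `e(-1) f(n)`, so that up to powers of `e(-1)` the module is spanned by words
in negative modes of `h` and `e`. Hence some `e(-1)^N v` is a combination of words containing a
factor `h(-k)` or `e(-l)`, `l ≥ 2`. The operators `∑ h(-n-1) e(n)` and `∑ e(-n-2) h(n+1)` annihilate
`e(-1)^N v`, but act on words with `r` factors `h`, respectively `s` factors `e(-l)`, as `-2r e(-1)`
and `2s e(-1)` up to later layers. They therefore strip these words off layer by layer, until
`e(-1)^{N'} v = 0`. Finally `f(1)` undoes `e(-1)` up to nonzero factors, and `v = 0`.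

Conversely, a Miura solution `χ` gives the Wakimoto representation `e = β`, `h = -2:βγ: + χ`, `f =
-:βγ²: + 2nγ + χγ` (in modes) on a Fock space. Its vacuum is a highest weight vector of weight `m`,
is annihilated by `f(0)^{m+1}`, and has the central character of `q` (`BetaGamma.sug_vac`). So the
quotient maps to the Fock space with nonzero image. -/

/-- The family `f` is finitely supported and its sum is `s`. -/
def HasFinsum {V : Type*} [AddCommMonoid V] (f : ℤ → V) (s : V) : Prop :=
  f.HasFiniteSupport ∧ ∑ᶠ j, f j = s

namespace HasFinsum

variable {V W : Type*} [AddCommGroup V]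

theorem of_finite {f : ℤ → V} (hf : f.HasFiniteSupport) : HasFinsum f (∑ᶠ j, f j) := ⟨hf, rfl⟩

theorem of_bound {f : ℤ → V} (A B : ℤ) (hA : ∀ j < A, f j = 0) (hB : ∀ j ≥ B, f j = 0) :
    HasFinsum f (∑ᶠ j, f j) := by
  refine of_finite ((Set.finite_Icc A B).subset fun j hj => ?_)
  rw [Function.mem_support] at hj
  constructor
  · by_contra h
    exact hj (hA j (by lia))
  · by_contra h
    exact hj (hB j (by lia))

theorem unique {f : ℤ → V} {s t : V} (hs : HasFinsum f s) (ht : HasFinsum f t) : s = t :=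
  hs.2.symm.trans ht.2

theorem congr {f g : ℤ → V} {s : V} (hf : HasFinsum f s) (h : ∀ j, g j = f j) : HasFinsum g s := by
  rwa [show g = f from funext h]

theorem add {f g : ℤ → V} {s t : V} (hf : HasFinsum f s) (hg : HasFinsum g t) :
    HasFinsum (fun j => f j + g j) (s + t) :=
  ⟨(hf.1.union hg.1).subset (Function.support_add f g),
    by rw [finsum_add_distrib hf.1 hg.1, hf.2, hg.2]⟩

theorem comp_equiv {f : ℤ → V} {s : V} (hf : HasFinsum f s) (σ : ℤ ≃ ℤ) :
    HasFinsum (fun j => f (σ j)) s :=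
  ⟨hf.1.preimage σ.injective.injOn, by rw [finsum_comp_equiv σ, hf.2]⟩

theorem shift {f : ℤ → V} {s : V} (hf : HasFinsum f s) (k : ℤ) :
    HasFinsum (fun j => f (j + k)) s := hf.comp_equiv (Equiv.addRight k)

theorem reflect {f : ℤ → V} {s : V} (hf : HasFinsum f s) (n : ℤ) :
    HasFinsum (fun j => f (n - j)) s := hf.comp_equiv (Equiv.subLeft n)

theorem zero : HasFinsum (fun _ : ℤ => (0 : V)) 0 :=
  ⟨Set.finite_empty.subset fun _ h => h rfl, finsum_zero⟩

theorem single (a : ℤ) {f : ℤ → V} (h : ∀ j ≠ a, f j = 0) : HasFinsum f (f a) :=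
  ⟨(Set.finite_singleton a).subset fun j hj => by
    by_contra hja; exact hj (h j hja), finsum_eq_single f a h⟩

theorem single_ite (a : ℤ) (x : V) : HasFinsum (fun j => if j = a then x else 0) x := by
  simpa using single a (f := fun j => if j = a then x else 0) (fun j hj => if_neg hj)

variable [Module ℂ V] [AddCommGroup W] [Module ℂ W]

theorem map {f : ℤ → V} {s : V} (hf : HasFinsum f s) (T : V →ₗ[ℂ] W) :
    HasFinsum (fun j => T (f j)) (T s) := by
  refine ⟨hf.1.subset fun j hj h => hj ?_, ?_⟩
  · simp only [h, map_zero]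
  · rw [← hf.2]
    exact (map_finsum T.toAddMonoidHom hf.1).symm

theorem smul {f : ℤ → V} {s : V} (hf : HasFinsum f s) (c : ℂ) :
    HasFinsum (fun j => c • f j) (c • s) := hf.map (c • LinearMap.id)

theorem neg {f : ℤ → V} {s : V} (hf : HasFinsum f s) : HasFinsum (fun j => -f j) (-s) :=
  hf.map (-LinearMap.id)

theorem sub {f g : ℤ → V} {s t : V} (hf : HasFinsum f s) (hg : HasFinsum g t) :
    HasFinsum (fun j => f j - g j) (s - t) := by
  simpa only [sub_eq_add_neg] using hf.add hg.neg

theorem mem {f : ℤ → V} {s : V} (hf : HasFinsum f s) {p : Submodule ℂ V} (h : ∀ j, f j ∈ p) :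
    s ∈ p := by
  rw [← hf.2]
  exact finsum_induction (· ∈ p) p.zero_mem (fun _ _ => p.add_mem) h

end HasFinsum

/-- The signed indicator of the integers between `0` and `n`, with total mass `n + 1`. -/
def between (n j : ℤ) : ℂ := if 0 ≤ j ∧ j ≤ n then 1 else if n < j ∧ j < 0 then -1 else 0

/-- `between n` counts, with sign, the commutators picked up when the normal ordering point is moved
from `0` to `n + 1`; the sign makes the count polynomial in `n`. -/
theorem hasFinsum_between (n : ℤ) : HasFinsum (between n) ((n : ℂ) + 1) := by
  rcases le_or_gt 0 n with hn | hn
  · have hs : Function.support (between n) ⊆ (Finset.Icc 0 n : Finset ℤ) := by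
      intro j hj
      rw [Function.mem_support, between] at hj
      simp only [Finset.coe_Icc, Set.mem_Icc]
      by_contra h
      rw [if_neg h, if_neg (by lia)] at hj
      exact hj rfl
    refine ⟨(Finset.finite_toSet _).subset hs, ?_⟩
    rw [finsum_eq_sum_of_support_subset _ hs,
      Finset.sum_congr rfl (g := fun _ => (1 : ℂ)) fun j hj => by
        rw [between, if_pos (Finset.mem_Icc.mp hj)]]
    obtain ⟨k, rfl⟩ := Int.eq_ofNat_of_zero_le hn
    simp only [Finset.sum_const, Int.card_Icc, nsmul_eq_mul, mul_one, sub_zero]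
    norm_cast
  · have hs : Function.support (between n) ⊆ (Finset.Ioo n 0 : Finset ℤ) := by
      intro j hj
      rw [Function.mem_support, between] at hj
      simp only [Finset.coe_Ioo, Set.mem_Ioo]
      by_contra h
      rw [if_neg (by lia), if_neg h] at hj
      exact hj rfl
    refine ⟨(Finset.finite_toSet _).subset hs, ?_⟩
    rw [finsum_eq_sum_of_support_subset _ hs,
      Finset.sum_congr rfl (g := fun _ => (-1 : ℂ)) fun j hj => by
        rw [between, if_neg (by have := Finset.mem_Ioo.mp hj; lia), if_pos (Finset.mem_Ioo.mp hj)]]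
    obtain ⟨k, hk⟩ := Int.eq_ofNat_of_zero_le (show 0 ≤ 0 - n - 1 by lia)
    have hnk : n = -(k : ℤ) - 1 := by lia
    simp only [Finset.sum_const, Int.card_Ioo, nsmul_eq_mul, hk]
    rw [hnk]
    simp

theorem HasFinsum.between_smul {V : Type*} [AddCommGroup V] [Module ℂ V] (n : ℤ) (x : V) :
    HasFinsum (fun j => between n j • x) (((n : ℂ) + 1) • x) :=
  (hasFinsum_between n).map (LinearMap.toSpanSingleton ℂ V x)

/-! ### Normally ordered products -/

section NormalOrder

variable {V : Type*} [AddCommGroup V] [Module ℂ V]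

/-- Every vector is annihilated by all the operators `A n` with `n` large. -/
def IsSmooth (A : ℤ → V →ₗ[ℂ] V) : Prop := ∀ w, ∃ N : ℤ, ∀ n ≥ N, A n w = 0

/-- The vector `:A(j) B(l): w`, with `A(j)` on the left if `j < 0` and on the right if `j ≥ 0`. -/
def nord (A B : ℤ → V →ₗ[ℂ] V) (j l : ℤ) : V →ₗ[ℂ] V :=
  if j < 0 then A j ∘ₗ B l else B l ∘ₗ A j

theorem nord_of_neg (A B : ℤ → V →ₗ[ℂ] V) {j : ℤ} (hj : j < 0) (l : ℤ) (w : V) :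
    nord A B j l w = A j (B l w) := by rw [nord, if_pos hj]; rfl

theorem nord_of_nonneg (A B : ℤ → V →ₗ[ℂ] V) {j : ℤ} (hj : 0 ≤ j) (l : ℤ) (w : V) :
    nord A B j l w = B l (A j w) := by rw [nord, if_neg hj.not_gt]; rfl

theorem IsSmooth.nord_hasFinsum {A B : ℤ → V →ₗ[ℂ] V} (hA : IsSmooth A) (hB : IsSmooth B) (n : ℤ)
    (w : V) : HasFinsum (fun j => nord A B j (n - j) w) (∑ᶠ j, nord A B j (n - j) w) := by
  obtain ⟨N, hN⟩ := hA w
  obtain ⟨M, hM⟩ := hB w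
  refine .of_bound (min 0 (n - M)) (max 0 N) (fun j hj => ?_) (fun j hj => ?_)
  · rw [nord_of_neg _ _ (by lia), hM _ (by lia), map_zero]
  · rw [nord_of_nonneg _ _ (by lia), hN _ (by lia), map_zero]

/-- The `n`-th mode `∑_j :A(j) B(n - j):` of a normally ordered product. -/
def normalProd {A B : ℤ → V →ₗ[ℂ] V} (hA : IsSmooth A) (hB : IsSmooth B) (n : ℤ) : V →ₗ[ℂ] V where
  toFun w := ∑ᶠ j, nord A B j (n - j) w
  map_add' x y := by
    refine HasFinsum.unique (hA.nord_hasFinsum hB n (x + y)) ?_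
    exact ((hA.nord_hasFinsum hB n x).add (hA.nord_hasFinsum hB n y)).congr fun j => map_add _ _ _
  map_smul' c x := by
    refine HasFinsum.unique (hA.nord_hasFinsum hB n (c • x)) ?_
    exact ((hA.nord_hasFinsum hB n x).smul c).congr fun j => map_smul _ _ _

theorem hasFinsum_normalProd {A B : ℤ → V →ₗ[ℂ] V} (hA : IsSmooth A) (hB : IsSmooth B) (n : ℤ)
    (w : V) : HasFinsum (fun j => nord A B j (n - j) w) (normalProd hA hB n w) :=
  hA.nord_hasFinsum hB n w

theorem IsSmooth.exists_of_bounded {A : ℤ → V →ₗ[ℂ] V} (hA : IsSmooth A) (x : ℤ → V) (a b : ℤ) :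
    ∃ N : ℤ, ∀ j, a ≤ j → j < b → ∀ n ≥ N, A n (x j) = 0 := by
  choose N hN using fun j => hA (x j)
  obtain ⟨M, hM⟩ := ((Set.finite_Ico a b).image N).bddAbove
  exact ⟨M, fun j h₁ h₂ n hn => hN j n ((hM ⟨j, ⟨h₁, h₂⟩, rfl⟩).trans hn)⟩

theorem normalProd_isSmooth {A B : ℤ → V →ₗ[ℂ] V} (hA : IsSmooth A) (hB : IsSmooth B) :
    IsSmooth (normalProd hA hB) := by
  intro w
  obtain ⟨N, hN⟩ := hA w
  obtain ⟨M, hM⟩ := hB w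
  obtain ⟨L, hL⟩ := hB.exists_of_bounded (fun j => A j w) 0 N
  -- Terms with `j < 0` die because `n - j ≥ M`, those with `j ≥ N` because `A j w = 0`; for the
  -- finitely many `j` in between, `L` is a common bound and `n - j ≥ L`.
  refine ⟨max M (L + max N 0), fun n hn => ?_⟩
  refine HasFinsum.unique (hasFinsum_normalProd hA hB n w) (HasFinsum.zero.congr fun j => ?_)
  rcases lt_or_ge j 0 with hj | hj
  · rw [nord_of_neg _ _ hj, hM _ (by lia), map_zero]
  · rw [nord_of_nonneg _ _ hj]
    rcases lt_or_ge j N with hjN | hjN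
    · exact hL j hj hjN _ (by lia)
    · rw [hN j hjN, map_zero]

end NormalOrder

/-! ### Smooth representations of level `-2` in terms of modes -/

/-- A smooth representation of the affine algebra at the critical level, given by the action of the
modes `e(n)`, `h(n)`, `f(n)`. -/
structure ModeRep (V : Type*) [AddCommGroup V] [Module ℂ V] where
  e : ℤ → V →ₗ[ℂ] V
  h : ℤ → V →ₗ[ℂ] V
  f : ℤ → V →ₗ[ℂ] V
  e_smooth : IsSmooth e
  h_smooth : IsSmooth h
  f_smooth : IsSmooth f
  ee : ∀ a b w, e a (e b w) = e b (e a w)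
  ff : ∀ a b w, f a (f b w) = f b (f a w)
  he : ∀ a b w, h a (e b w) = e b (h a w) + (2 : ℂ) • e (a + b) w
  hf : ∀ a b w, h a (f b w) = f b (h a w) - (2 : ℂ) • f (a + b) w
  -- The scalars `-2a` here and `-4a` below are `k a tr(AB)` with `k = -2`, `tr(EF) = 1` and `tr(HH)
  -- = 2`.
  ef : ∀ a b w, e a (f b w) = f b (e a w) + h (a + b) w + (if a + b = 0 then -2 * (a : ℂ) else 0) • w
  hh : ∀ a b w, h a (h b w) = h b (h a w) + (if a + b = 0 then -4 * (a : ℂ) else 0) • w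

namespace ModeRep

variable {V : Type*} [AddCommGroup V] [Module ℂ V] (R : ModeRep V)

/-- The representation twisted by the Chevalley involution. -/
def swap : ModeRep V where
  e := R.f
  h n := -R.h n
  f := R.e
  e_smooth := R.f_smooth
  h_smooth w := (R.h_smooth w).imp fun N hN n hn => by simp [hN n hn]
  f_smooth := R.e_smooth
  ee := R.ff
  ff := R.ee
  he a b w := by simp only [LinearMap.neg_apply, R.hf, map_neg]; module
  hf a b w := by simp only [LinearMap.neg_apply, R.he, map_neg]; module
  ef a b w := by
    have := R.ef b a w
    rw [add_comm b a] at this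
    rw [this, LinearMap.neg_apply]
    split_ifs with hab
    · rw [show b = -a by lia]
      push_cast
      module
    · module
  hh a b w := by simp only [LinearMap.neg_apply, map_neg, neg_neg, R.hh a b]

/-! ### The Sugawara operators and their centrality at the critical level. -/

/-- The `j`-th summand of twice the Sugawara operator. -/
def sugTerm (n j : ℤ) : V →ₗ[ℂ] V :=
  nord R.e R.f j (n - j) + nord R.f R.e j (n - j) + (1 / 2 : ℂ) • nord R.h R.h j (n - j)

/-- The Sugawara operator `S_n`. -/
def sug (n : ℤ) : V →ₗ[ℂ] V :=
  (1 / 2 : ℂ) • (normalProd R.e_smooth R.f_smooth n + normalProd R.f_smooth R.e_smooth n +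
    (1 / 2 : ℂ) • normalProd R.h_smooth R.h_smooth n)

theorem hasFinsum_sugTerm (n : ℤ) (w : V) :
    HasFinsum (fun j => R.sugTerm n j w) ((2 : ℂ) • R.sug n w) := by
  have := ((hasFinsum_normalProd R.e_smooth R.f_smooth n w).add
    (hasFinsum_normalProd R.f_smooth R.e_smooth n w)).add
    ((hasFinsum_normalProd R.h_smooth R.h_smooth n w).smul (1 / 2))
  rw [sug, LinearMap.smul_apply, smul_smul, show (2 : ℂ) * (1 / 2) = 1 by norm_num, one_smul]
  exact this

/-- The Casimir tensor is symmetric in `e`, `f` and even in `h`. This reduces commutation with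
`f(k)` to commutation with `e(k)`. -/
theorem swap_sug (n : ℤ) : R.swap.sug n = R.sug n := by
  ext w
  have h₁ := (R.hasFinsum_sugTerm n w).congr (g := fun j => R.swap.sugTerm n j w) fun j => by
    rcases lt_or_ge j 0 with hj | hj
    · simp only [sugTerm, LinearMap.add_apply, LinearMap.smul_apply, nord_of_neg _ _ hj, swap,
        LinearMap.neg_apply, map_neg, neg_neg]
      module
    · simp only [sugTerm, LinearMap.add_apply, LinearMap.smul_apply, nord_of_nonneg _ _ hj, swap,
        LinearMap.neg_apply, map_neg, neg_neg]
      module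
  exact smul_right_injective V (two_ne_zero (α := ℂ)) ((R.swap.hasFinsum_sugTerm n w).unique h₁)

/-- After the reflection `j ↦ n - j` the two normal orderings disagree only when `j` and `n - j`
have the same sign type, and each disagreement costs `± h(n)`. -/
theorem nord_fe (n j : ℤ) (w : V) : nord R.f R.e j (n - j) w =
    nord R.e R.f (n - j) (n - (n - j)) w + between n j • R.h n w := by
  rw [sub_sub_cancel]
  have key := R.ef (n - j) j w
  rw [sub_add_cancel] at key
  rcases lt_or_ge j 0 with hj | hj <;> rcases lt_or_ge (n - j) 0 with hl | hl
  · rw [nord_of_neg _ _ hj, nord_of_neg _ _ hl, between, if_neg (by lia), if_pos (by lia),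
      key, if_neg (by lia)]
    module
  · rw [nord_of_neg _ _ hj, nord_of_nonneg _ _ hl, between, if_neg (by lia), if_neg (by lia)]
    module
  · rw [nord_of_nonneg _ _ hj, nord_of_neg _ _ hl, between, if_neg (by lia), if_neg (by lia)]
    module
  · rw [nord_of_nonneg _ _ hj, nord_of_nonneg _ _ hl, between, if_pos (by lia), key]
    split_ifs with hn
    -- For `n = 0` only `j = 0` occurs, and there the central term has coefficient `0`.
    · rw [show n - j = 0 by lia]
      module
    · module

/-- The Sugawara operator in Riccati form. -/
theorem sug_apply (n : ℤ) (w : V) : R.sug n w = normalProd R.e_smooth R.f_smooth n w +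
    (1 / 4 : ℂ) • normalProd R.h_smooth R.h_smooth n w + (((n : ℂ) + 1) / 2) • R.h n w := by
  have h₁ := hasFinsum_normalProd R.f_smooth R.e_smooth n w
  have h₂ := (((hasFinsum_normalProd R.e_smooth R.f_smooth n w).reflect n).add
    (.between_smul n (R.h n w))).congr (R.nord_fe n · w)
  simp only [sug, LinearMap.smul_apply, LinearMap.add_apply, h₁.unique h₂]
  module

theorem hasFinsum_nord_eh (N : ℤ) (w : V) : HasFinsum (fun j => nord R.e R.h j (N - j) w)
    (normalProd R.e_smooth R.h_smooth N w) := hasFinsum_normalProd _ _ N w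

theorem e_h_eq (N j : ℤ) (w : V) : R.e j (R.h (N - j) w) =
    nord R.e R.h j (N - j) w - (if 0 ≤ j then (2 : ℂ) else 0) • R.e N w := by
  rcases lt_or_ge j 0 with hj | hj
  · rw [nord_of_neg _ _ hj, if_neg (by lia)]
    module
  · rw [nord_of_nonneg _ _ hj, if_pos hj, R.he, sub_add_cancel]
    module

theorem h_e_eq (N j : ℤ) (w : V) : R.h (N - j) (R.e j w) =
    nord R.e R.h j (N - j) w + (if j < 0 then (2 : ℂ) else 0) • R.e N w := by
  rcases lt_or_ge j 0 with hj | hj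
  · rw [nord_of_neg _ _ hj, if_pos hj, R.he, sub_add_cancel]
  · rw [nord_of_nonneg _ _ hj, if_neg (by lia)]
    module

theorem nord_ef_comm (n k j : ℤ) (w : V) :
    nord R.e R.f j (n - j) (R.e k w) = R.e k (nord R.e R.f j (n - j) w) -
      nord R.e R.h j (n + k - j) w + (if j = n + k then 2 * (k : ℂ) else 0) • R.e (n + k) w := by
  have key := fun x => R.ef k (n - j) x
  simp only [show k + (n - j) = n + k - j by lia] at key
  rcases lt_or_ge j 0 with hj | hj
  · rw [nord_of_neg _ _ hj, nord_of_neg _ _ hj, nord_of_neg _ _ hj, R.ee k j, key]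
    by_cases hjk : j = n + k
    · rw [if_pos hjk, if_pos (by lia), ← hjk]
      simp only [map_add, map_smul]
      module
    · rw [if_neg hjk, if_neg (by lia)]
      simp only [map_add, map_smul]
      module
  · rw [nord_of_nonneg _ _ hj, nord_of_nonneg _ _ hj, nord_of_nonneg _ _ hj, R.ee j k, key]
    by_cases hjk : j = n + k
    · rw [if_pos hjk, if_pos (by lia), ← hjk]
      module
    · rw [if_neg hjk, if_neg (by lia)]
      module

/-- Moving `e(k)` out to the left through both factors `h` leaves two products of `e` and `h` and
one `e(n+k)`. The two `between` terms record where these products are not yet in the order chosen by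
`nord R.e R.h`; over all `j` they add up to `k + (n + k + 1)`. -/
theorem nord_hh_comm (n k j : ℤ) (w : V) :
    nord R.h R.h j (n - j) (R.e k w) = R.e k (nord R.h R.h j (n - j) w) +
      (2 : ℂ) • (nord R.e R.h (j + k) (n + k - (j + k)) w +
        nord R.e R.h (n + k - j) (n + k - (n + k - j)) w) -
      (4 : ℂ) • ((between (k - 1) (-1 - j) + between (n + k) j) • R.e (n + k) w) := by
  have a₁ := R.e_h_eq (n + k) (j + k) w
  have a₂ := R.h_e_eq (n + k) (j + k) w
  have a₃ := R.e_h_eq (n + k) (n + k - j) w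
  have a₄ := R.h_e_eq (n + k) (n + k - j) w
  simp only [show n + k - (j + k) = n - j by lia, show n + k - (n + k - j) = j by lia] at a₁ a₂ a₃ a₄ ⊢
  rcases lt_or_ge j 0 with hj | hj
  · rw [nord_of_neg _ _ hj, nord_of_neg _ _ hj]
    rw [R.he (n - j) k, map_add, map_smul, R.he j k,
      show n - j + k = n + k - j by lia, a₁, a₄, between, between]
    split_ifs <;> first | lia | module
  · rw [nord_of_nonneg _ _ hj, nord_of_nonneg _ _ hj]
    rw [R.he j k, map_add, map_smul, R.he (n - j) k,
      show n - j + k = n + k - j by lia, a₂, a₃, between, between]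
    split_ifs <;> first | lia | module

/-- The sums `:eh:` coming from `:ef:` and from `¼:hh:` cancel. The remaining coefficient of
`e(n+k)` is `2k` from the central term of `[e, f]`, `-(n + 2k + 1)` from reordering, and `n + 1`
from the linear term `½(n+1)h(n)`; these cancel exactly because the level is `-2`. -/
theorem sug_e (n k : ℤ) (w : V) : R.sug n (R.e k w) = R.e k (R.sug n w) := by
  have hP := R.hasFinsum_nord_eh (n + k) w
  have h₁ := (hasFinsum_normalProd R.e_smooth R.f_smooth n (R.e k w)).unique
    (((((hasFinsum_normalProd R.e_smooth R.f_smooth n w).map (R.e k)).sub hP).add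
      (.single_ite (n + k) ((2 * (k : ℂ)) • R.e (n + k) w))).congr fun j => by
        rw [R.nord_ef_comm, ite_smul, zero_smul])
  have h₂ := (hasFinsum_normalProd R.h_smooth R.h_smooth n (R.e k w)).unique
    (((((hasFinsum_normalProd R.h_smooth R.h_smooth n w).map (R.e k)).add
      (((hP.shift k).add (hP.reflect (n + k))).smul 2)).sub
      ((((HasFinsum.between_smul (k - 1) (R.e (n + k) w)).reflect (-1)).add
        (.between_smul (n + k) (R.e (n + k) w))).smul 4)).congr fun j => by
        rw [R.nord_hh_comm, add_smul])
  rw [R.sug_apply, R.sug_apply, h₁, h₂, R.he]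
  simp only [map_add, map_smul]
  push_cast
  module

theorem sug_f (n k : ℤ) (w : V) : R.sug n (R.f k w) = R.f k (R.sug n w) := by
  have := R.swap.sug_e n k w
  rwa [swap_sug] at this

theorem h_eq (k : ℤ) (w : V) : R.h k w = R.e k (R.f 0 w) - R.f 0 (R.e k w) := by
  rw [R.ef, add_zero]
  split_ifs with hk
  · rw [hk]
    simp
  · simp

theorem sug_h (n k : ℤ) (w : V) : R.sug n (R.h k w) = R.h k (R.sug n w) := by
  simp only [h_eq, map_sub, sug_e, sug_f]

end ModeRep

/-! ### The Frobenius recursion -/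

/-- The coefficients of the solution `t^{-μ/2} ∑ aₙ tⁿ` of the equation with
`q = μ(μ+2)/(4t²) + ∑_{i ≥ 1} cᵢ t^{i-2}`, as far as the recursion determines them. -/
def frob (μ : ℂ) (c : ℕ → ℂ) : ℕ → ℂ
  | 0 => 1
  -- For `μ = m` the denominator vanishes at `n = m` and the quotient is `0` by convention. This is
  -- a legitimate choice of the coefficient `a_{m+1}`, which the equation leaves free.
  | n + 1 => (∑ i : Fin (n + 1), c (n + 1 - i) * frob μ c i) / (((n : ℂ) + 1) * ((n : ℂ) - μ))

/-- The obstruction to the existence of a solution with exponent `-m/2`. -/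
def obstruction (m : ℕ) (c : ℕ → ℂ) : ℂ := ∑ i ∈ Finset.range (m + 1), c (m + 1 - i) * frob m c i

theorem frob_zero (μ : ℂ) (c : ℕ → ℂ) : frob μ c 0 = 1 := by rw [frob]

theorem frob_succ (μ : ℂ) (c : ℕ → ℂ) {n : ℕ} (hn : (n : ℂ) ≠ μ) :
    ((n : ℂ) + 1) * ((n : ℂ) - μ) * frob μ c (n + 1) =
      ∑ i ∈ Finset.range (n + 1), c (n + 1 - i) * frob μ c i := by
  have h₁ : ((n : ℂ) + 1) ≠ 0 := by exact_mod_cast n.succ_ne_zero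
  rw [frob, mul_div_cancel₀ _ (mul_ne_zero h₁ (sub_ne_zero.mpr hn)),
    Finset.sum_range (fun i => c (n + 1 - i) * frob μ c i)]

/-! ### Weyl vectors with a prescribed central character. -/

namespace ModeRep

variable {V : Type*} [AddCommGroup V] [Module ℂ V]

/-- `v` generates the representation, is a highest weight vector of weight `m` with
`f(0)^{m+1} v = 0`, and the Sugawara operators act on it by the scalars `q_n`. -/
structure IsWeylVector (R : ModeRep V) (m : ℕ) (qn : ℤ → ℂ) (v : V) : Prop where
  e_v : ∀ n ≥ 0, R.e n v = 0
  h_v : ∀ n > 0, R.h n v = 0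
  f_v : ∀ n > 0, R.f n v = 0
  h_zero : R.h 0 v = (m : ℂ) • v
  f_pow : (R.f 0 ^ (m + 1)) v = 0
  sug_v : ∀ n, R.sug n v = qn n • v
  gen : ∀ p : Submodule ℂ V, v ∈ p → (∀ n, ∀ w ∈ p, R.e n w ∈ p) → (∀ n, ∀ w ∈ p, R.h n w ∈ p) →
    (∀ n, ∀ w ∈ p, R.f n w ∈ p) → p = ⊤

variable (R : ModeRep V) {m : ℕ} {qn : ℤ → ℂ} {v : V}

/-- The eigenspace of a central operator is stable under all modes, so the scalar on the generator
propagates to the whole representation. -/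
theorem IsWeylVector.sug_eq (hv : R.IsWeylVector m qn v) (n : ℤ) (w : V) :
    R.sug n w = qn n • w := by
  have := hv.gen (LinearMap.ker (R.sug n - qn n • LinearMap.id))
    (by simp [hv.sug_v])
    (fun k w hw => by
      simp only [LinearMap.mem_ker, LinearMap.sub_apply, LinearMap.smul_apply, LinearMap.id_apply,
        sub_eq_zero] at hw ⊢
      rw [R.sug_e, hw, map_smul])
    (fun k w hw => by
      simp only [LinearMap.mem_ker, LinearMap.sub_apply, LinearMap.smul_apply, LinearMap.id_apply,
        sub_eq_zero] at hw ⊢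
      rw [R.sug_h, hw, map_smul])
    (fun k w hw => by
      simp only [LinearMap.mem_ker, LinearMap.sub_apply, LinearMap.smul_apply, LinearMap.id_apply,
        sub_eq_zero] at hw ⊢
      rw [R.sug_f, hw, map_smul])
  have hw : w ∈ LinearMap.ker (R.sug n - qn n • LinearMap.id) := this ▸ Submodule.mem_top
  simpa [sub_eq_zero] using hw

/-! ### Coinvariants of the subalgebra spanned by `e(-l)`, `l ≥ 2`, and `h(-k)`, `k ≥ 1` -/

/-- The span of the images of the operators `e(-l)`, `l ≥ 2`, and `h(-k)`, `k ≥ 1`. -/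
def coinvKer : Submodule ℂ V :=
  Submodule.span ℂ {w | (∃ l < (-1 : ℤ), ∃ y, w = R.e l y) ∨ ∃ k < (0 : ℤ), ∃ y, w = R.h k y}

theorem e_mem_coinvKer {l : ℤ} (hl : l < -1) (y : V) : R.e l y ∈ R.coinvKer :=
  Submodule.subset_span (Or.inl ⟨l, hl, y, rfl⟩)

theorem h_mem_coinvKer {k : ℤ} (hk : k < 0) (y : V) : R.h k y ∈ R.coinvKer :=
  Submodule.subset_span (Or.inr ⟨k, hk, y, rfl⟩)

/-- `e(-1)` normalises the subalgebra: `[h(k), e(-1)] = 2e(k-1)` with `k - 1 < -1`. Hence `e(-1)`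
acts on the coinvariants. -/
theorem eps_mem_coinvKer {w : V} (hw : w ∈ R.coinvKer) : R.e (-1) w ∈ R.coinvKer := by
  induction hw using Submodule.span_induction with
  | mem w hw =>
    rcases hw with ⟨l, hl, y, rfl⟩ | ⟨k, hk, y, rfl⟩
    · rw [R.ee]
      exact R.e_mem_coinvKer hl _
    · rw [eq_sub_of_add_eq (R.he k (-1) y).symm]
      exact sub_mem (R.h_mem_coinvKer hk _) (Submodule.smul_mem _ _ (R.e_mem_coinvKer (by lia) _))
  | zero => rw [map_zero]; exact zero_mem _
  | add x y _ _ hx hy => rw [map_add]; exact add_mem hx hy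
  | smul a x _ hx => rw [map_smul]; exact Submodule.smul_mem _ _ hx

theorem eps_pow_mem_coinvKer (N : ℕ) {w : V} (hw : w ∈ R.coinvKer) :
    (R.e (-1) ^ N) w ∈ R.coinvKer := by
  induction N with
  | zero => simpa using hw
  | succ N ih => rw [pow_succ', Module.End.mul_apply]; exact R.eps_mem_coinvKer ih

/-- In the Riccati form of `S_n` the summands starting with `e(j)`, `j ≤ -2`, or with a negative
mode of `h` are in the span, and those ending with a positive mode annihilate `u`. What survives is
`j = -1` and `j = 0` of `:ef:`. -/
theorem sug_sub_mem_coinvKer {u : V} (he : ∀ n > 0, R.e n u = 0) (hh : ∀ n > 0, R.h n u = 0)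
    {n : ℤ} (hn : n < 0) :
    R.sug n u - R.e (-1) (R.f (n + 1) u) - R.f n (R.e 0 u) ∈ R.coinvKer := by
  have h₁ := (((hasFinsum_normalProd R.e_smooth R.f_smooth n u).sub
    (.single_ite (-1) (R.e (-1) (R.f (n + 1) u)))).sub
    (.single_ite 0 (R.f n (R.e 0 u)))).mem (p := R.coinvKer) fun j => by
      rcases lt_trichotomy j (-1) with hj | rfl | hj
      · rw [nord_of_neg _ _ (by lia), if_neg (by lia), if_neg (by lia), sub_zero, sub_zero]
        exact R.e_mem_coinvKer hj _
      · rw [nord_of_neg _ _ (by lia), if_pos rfl, if_neg (by lia), sub_neg_eq_add]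
        simp
      · rcases eq_or_lt_of_le (show 0 ≤ j by lia) with rfl | hj'
        · rw [nord_of_nonneg _ _ le_rfl]
          simp
        · rw [nord_of_nonneg _ _ hj'.le, if_neg (by lia), if_neg (by lia), he j hj']
          simp
  have h₂ := (hasFinsum_normalProd R.h_smooth R.h_smooth n u).mem (p := R.coinvKer) fun j => by
    rcases lt_or_ge j 0 with hj | hj
    · rw [nord_of_neg _ _ hj]
      exact R.h_mem_coinvKer hj _
    · rw [nord_of_nonneg _ _ hj]
      rcases eq_or_lt_of_le hj with rfl | hj'
      · rw [sub_zero]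
        exact R.h_mem_coinvKer hn _
      · rw [hh j hj', map_zero]
        exact zero_mem _
  have h₃ := add_mem (add_mem h₁ (Submodule.smul_mem _ (1 / 4 : ℂ) h₂))
    (Submodule.smul_mem _ (((n : ℂ) + 1) / 2) (R.h_mem_coinvKer hn u))
  rw [R.sug_apply]
  convert h₃ using 1
  module

namespace IsWeylVector

variable {R}

theorem modes_f_pow (hv : R.IsWeylVector m qn v) (j : ℕ) :
    (∀ n > 0, R.e n ((R.f 0 ^ j) v) = 0) ∧ (∀ n > 0, R.h n ((R.f 0 ^ j) v) = 0) ∧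
      ∀ n > 0, R.f n ((R.f 0 ^ j) v) = 0 := by
  induction j with
  | zero => exact ⟨fun n hn => hv.e_v n hn.le, hv.h_v, hv.f_v⟩
  | succ j ih =>
    simp only [pow_succ', Module.End.mul_apply]
    refine ⟨fun n hn => ?_, fun n hn => ?_, fun n hn => ?_⟩
    · rw [R.ef, ih.1 n hn, add_zero, ih.2.1 n hn, if_neg (by lia)]
      simp
    · rw [R.hf, ih.2.1 n hn, add_zero, ih.2.2 n hn]
      simp
    · rw [R.ff, ih.2.2 n hn, map_zero]

theorem h_zero_f_pow (hv : R.IsWeylVector m qn v) (j : ℕ) :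
    R.h 0 ((R.f 0 ^ j) v) = ((m : ℂ) - 2 * j) • (R.f 0 ^ j) v := by
  induction j with
  | zero => simpa using hv.h_zero
  | succ j ih =>
    simp only [pow_succ', Module.End.mul_apply]
    rw [R.hf, ih, map_smul, add_zero]
    push_cast
    module

theorem e_zero_f_pow_succ (hv : R.IsWeylVector m qn v) (j : ℕ) :
    R.e 0 ((R.f 0 ^ (j + 1)) v) = (((j : ℂ) + 1) * ((m : ℂ) - j)) • (R.f 0 ^ j) v := by
  induction j with
  | zero =>
    simp only [zero_add, pow_one, pow_zero, Module.End.one_apply]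
    rw [R.ef, hv.e_v 0 le_rfl, add_zero, hv.h_zero]
    simp
  | succ j ih =>
    rw [pow_succ', Module.End.mul_apply, R.ef, ih, add_zero, hv.h_zero_f_pow, map_smul,
      ← Module.End.mul_apply, ← pow_succ']
    simp only [Int.cast_zero, mul_zero, if_true, zero_smul, add_zero]
    push_cast
    module

/-- The factor relating the vectors `e(-1)ʲ f(0)ʲ v` to the Frobenius recursion. -/
def scale (m : ℕ) : ℕ → ℂ
  | 0 => 1
  | j + 1 => -(((j : ℂ) + 1) * ((m : ℂ) - j)) * scale m j

theorem scale_ne_zero (m j : ℕ) (hj : j ≤ m) : scale m j ≠ 0 := by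
  induction j with
  | zero => simp [scale]
  | succ j ih =>
    rw [scale]
    refine mul_ne_zero (neg_ne_zero.mpr (mul_ne_zero (by exact_mod_cast j.succ_ne_zero) ?_))
      (ih (by lia))
    exact sub_ne_zero.mpr (by exact_mod_cast (show m ≠ j by lia))

/-- Write `X(j,p)` for the class of `e(-1)^{j+1} f(-p) f(0)ʲ v`. The relation from `S_{-p-1}` reads
`X(j,p) = c_{p+1} X(j-1,0) - j(m-j+1) X(j-1,p+1)`. The Frobenius recursion evaluates `X(j-1,0)` as
`scale m j` times the coefficient `a_j`, which supplies the new last summand, while `X(j-1,p+1)`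
supplies the other ones. -/
theorem eps_pow_f_sub_mem (hv : R.IsWeylVector m qn v) (j : ℕ) (hj : j ≤ m) (p : ℕ) :
    (R.e (-1) ^ (j + 1)) (R.f (-(p : ℤ)) ((R.f 0 ^ j) v)) -
      (scale m j * ∑ i ∈ Finset.range (j + 1),
        qn (-((p + 1 + j - i : ℕ) : ℤ)) * frob m (fun i => qn (-(i : ℤ))) i) • v
      ∈ R.coinvKer := by
  set c : ℕ → ℂ := fun i => qn (-(i : ℤ)) with hc
  -- the relation given by `S_{-(p+1)}` on `f(0)ʲ v`
  have rel : ∀ j p : ℕ, c (p + 1) • (R.e (-1) ^ j) ((R.f 0 ^ j) v) -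
      (R.e (-1) ^ (j + 1)) (R.f (-(p : ℤ)) ((R.f 0 ^ j) v)) -
      (R.e (-1) ^ j) (R.f (-((p + 1 : ℕ) : ℤ)) (R.e 0 ((R.f 0 ^ j) v))) ∈ R.coinvKer := by
    intro j p
    have := R.eps_pow_mem_coinvKer j (R.sug_sub_mem_coinvKer (hv.modes_f_pow j).1
      (hv.modes_f_pow j).2.1 (show -((p + 1 : ℕ) : ℤ) < 0 by lia))
    rw [hv.sug_eq, map_sub, map_sub, map_smul, show -((p + 1 : ℕ) : ℤ) + 1 = -(p : ℤ) by
      push_cast; lia, ← Module.End.mul_apply (R.e (-1) ^ j) (R.e (-1)), ← pow_succ] at this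
    exact this
  induction j generalizing p with
  | zero =>
    have := rel 0 p
    rw [pow_zero (R.f 0), Module.End.one_apply, hv.e_v 0 le_rfl, map_zero, map_zero, sub_zero,
      pow_zero, Module.End.one_apply] at this
    rw [pow_zero (R.f 0), Module.End.one_apply]
    convert neg_mem this using 1
    simp [scale, frob_zero, hc]
  | succ j ih =>
    have h₁ := ih (by lia) 0
    have h₂ := ih (by lia) (p + 1)
    have h₃ := rel (j + 1) p
    have hsum : ∑ i ∈ Finset.range (j + 1), c (0 + 1 + j - i) * frob m c i =
        ((j : ℂ) + 1) * ((j : ℂ) - m) * frob m c (j + 1) := by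
      rw [frob_succ m c (by exact_mod_cast (show j ≠ m by lia))]
      exact Finset.sum_congr rfl fun i _ => by rw [zero_add, add_comm 1 j]
    rw [hsum, Nat.cast_zero, neg_zero, ← Module.End.mul_apply (R.f 0), ← pow_succ'] at h₁
    rw [hv.e_zero_f_pow_succ, map_smul, map_smul] at h₃
    rw [Finset.sum_range_succ, show p + 1 + (j + 1) - (j + 1) = p + 1 by lia]
    have hsum' : ∑ i ∈ Finset.range (j + 1), c (p + 1 + (j + 1) - i) * frob m c i =
        ∑ i ∈ Finset.range (j + 1), c (p + 1 + 1 + j - i) * frob m c i :=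
      Finset.sum_congr rfl fun i _ => by rw [show p + 1 + (j + 1) = p + 1 + 1 + j by lia]
    have goal := sub_mem (sub_mem (Submodule.smul_mem _ (c (p + 1)) h₁) h₃)
      (Submodule.smul_mem _ (((j : ℂ) + 1) * ((m : ℂ) - j)) h₂)
    convert goal using 1
    change _ - (scale m (j + 1) * (∑ i ∈ Finset.range (j + 1), c (p + 1 + (j + 1) - i) * frob m c i +
      c (p + 1) * frob m c (j + 1))) • v = _
    rw [hsum', scale]
    module

/-- Take `j = m`, `p = 0`: the vector is `e(-1)^{m+1} f(0)^{m+1} v = 0`, and the scalar is the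
obstruction times `scale m m ≠ 0`. -/
theorem obstruction_smul_mem (hv : R.IsWeylVector m qn v) :
    obstruction m (fun i => qn (-(i : ℤ))) • v ∈ R.coinvKer := by
  have h := hv.eps_pow_f_sub_mem m le_rfl 0
  rw [Nat.cast_zero, neg_zero, ← Module.End.mul_apply (R.f 0), ← pow_succ', hv.f_pow, map_zero,
    zero_sub] at h
  have h' := Submodule.smul_mem _ (-(scale m m)⁻¹) h
  convert h' using 1
  rw [smul_neg, neg_smul, neg_neg, smul_smul, ← mul_assoc, inv_mul_cancel₀ (scale_ne_zero m m le_rfl),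
    one_mul, obstruction]
  congr 1
  exact Finset.sum_congr rfl fun i _ => by rw [zero_add, add_comm 1 m]

end IsWeylVector

end ModeRep

namespace ModeRep

variable {V : Type*} [AddCommGroup V] [Module ℂ V] (R : ModeRep V) (v : V)

/-! ### Words in the negative modes of `e` and `h` -/

/-- Products of modes `e(-l)`, `l ≥ 1`, applied to `v`: `s` counts the factors with `l ≥ 2`, and `d`
is the sum of `l - 1` over all factors. -/
inductive EWord : ℕ → ℕ → V → Prop
  | base : EWord 0 0 v
  | eps {s d : ℕ} {w : V} : EWord s d w → EWord s d (R.e (-1) w)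
  | cons {s d : ℕ} {w : V} (a : ℕ) : EWord s d w → EWord (s + 1) (d + a + 1) (R.e (-(a : ℤ) - 2) w)

/-- Products of `r` modes `h(-k)`, `k ≥ 1`, applied to an `EWord`; `d` is the sum of the `k`. -/
inductive HWord : ℕ → ℕ → V → Prop
  | base {s d : ℕ} {w : V} : EWord R v s d w → HWord 0 0 w
  | cons {r d : ℕ} {w : V} (k : ℕ) : HWord r d w → HWord (r + 1) (d + k + 1) (R.h (-(k : ℤ) - 1) w)

/-- Words with some factor `e(-l)`, `l ≥ 2`, and no factor `h(-k)`. -/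
def IsProperEWord (w : V) : Prop := ∃ s d, EWord R v s d w ∧ 0 < s

/-- The span of the words whose parameters satisfy `P`. -/
def hSpan (P : ℕ → ℕ → Prop) : Submodule ℂ V :=
  Submodule.span ℂ {w | ∃ r d, HWord R v r d w ∧ P r d}

/-- The span of the proper `EWord`s and of the words with at least one factor `h(-k)` whose
parameters satisfy `P`. -/
def properSpan (P : ℕ → ℕ → Prop) : Submodule ℂ V :=
  Submodule.span ℂ {w | IsProperEWord R v w ∨ ∃ r d, HWord R v r d w ∧ 0 < r ∧ P r d}

variable {R v}

theorem map_mem_of_span {S : Set V} {p : Submodule ℂ V} (T : V →ₗ[ℂ] V) (h : ∀ w ∈ S, T w ∈ p) {w : V}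
    (hw : w ∈ Submodule.span ℂ S) : T w ∈ p :=
  (Submodule.span_le.mpr h : Submodule.span ℂ S ≤ p.comap T) hw

theorem HWord.mem_hSpan {P : ℕ → ℕ → Prop} {r d : ℕ} {w : V} (hw : HWord R v r d w) (h : P r d) :
    w ∈ hSpan R v P := Submodule.subset_span ⟨r, d, hw, h⟩

theorem hSpan_mono {P Q : ℕ → ℕ → Prop} (h : ∀ r d, P r d → Q r d) : hSpan R v P ≤ hSpan R v Q :=
  Submodule.span_mono fun _ ⟨r, d, hw, hP⟩ => ⟨r, d, hw, h r d hP⟩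

theorem properSpan_mono {P Q : ℕ → ℕ → Prop} (h : ∀ r d, 0 < r → P r d → Q r d) :
    properSpan R v P ≤ properSpan R v Q :=
  Submodule.span_mono fun _ hw => hw.imp_right fun ⟨r, d, hw, hr, hP⟩ => ⟨r, d, hw, hr, h r d hr hP⟩

theorem IsProperEWord.mem {P : ℕ → ℕ → Prop} {w : V} (hw : IsProperEWord R v w) :
    w ∈ properSpan R v P := Submodule.subset_span (Or.inl hw)

theorem HWord.mem_properSpan {P : ℕ → ℕ → Prop} {r d : ℕ} {w : V} (hw : HWord R v r d w) (hr : 0 < r)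
    (h : P r d) : w ∈ properSpan R v P := Submodule.subset_span (Or.inr ⟨r, d, hw, hr, h⟩)

theorem EWord.e_neg {s d : ℕ} {w : V} (hw : EWord R v s d w) (l : ℕ) :
    ∃ s' d', EWord R v s' d' (R.e (-(l : ℤ) - 1) w) ∧ s ≤ s' ∧ (0 < l → 0 < s') := by
  rcases l with _ | l
  · exact ⟨s, d, by simpa using hw.eps, le_rfl, fun h => absurd h (lt_irrefl _)⟩
  · refine ⟨s + 1, d + l + 1, ?_, by lia, by lia⟩
    rw [show -((l + 1 : ℕ) : ℤ) - 1 = -(l : ℤ) - 2 by push_cast; lia]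
    exact hw.cons l

theorem EWord.le {s d : ℕ} {w : V} (hw : EWord R v s d w) : s ≤ d := by
  induction hw with
  | base => exact le_rfl
  | eps _ ih => exact ih
  | cons a _ ih => lia

theorem h_mem_hSpan {P Q : ℕ → ℕ → Prop} (k : ℕ) (h : ∀ r d, P r d → Q (r + 1) (d + k + 1)) {w : V}
    (hw : w ∈ hSpan R v P) : R.h (-(k : ℤ) - 1) w ∈ hSpan R v Q :=
  map_mem_of_span _ (by rintro _ ⟨r, d, hw, hP⟩; exact (hw.cons k).mem_hSpan (h r d hP)) hw

theorem h_mem_properSpan {P Q : ℕ → ℕ → Prop} (k : ℕ) (h : ∀ r d, P r d → Q (r + 1) (d + k + 1))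
    {w : V} (hw : w ∈ hSpan R v P) : R.h (-(k : ℤ) - 1) w ∈ properSpan R v Q :=
  map_mem_of_span _
    (by rintro _ ⟨r, d, hw, hP⟩; exact (hw.cons k).mem_properSpan (by lia) (h r d hP)) hw

theorem e_h_neg (l k : ℕ) (w : V) : R.e (-(l : ℤ) - 1) (R.h (-(k : ℤ) - 1) w) =
    R.h (-(k : ℤ) - 1) (R.e (-(l : ℤ) - 1) w) -
      (2 : ℂ) • R.e (-((l + k + 1 : ℕ) : ℤ) - 1) w := by
  rw [R.he, show -(k : ℤ) - 1 + (-(l : ℤ) - 1) = -((l + k + 1 : ℕ) : ℤ) - 1 by push_cast; lia]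
  module

/-- Moving a negative mode of `e` to the right through the modes of `h` only replaces some `h(-k)`
by a shift of the index of `e`, so neither parameter grows. -/
theorem HWord.e_neg {r d : ℕ} {w : V} (hw : HWord R v r d w) (l : ℕ) :
    R.e (-(l : ℤ) - 1) w ∈ hSpan R v (fun r' d' => r' ≤ r ∧ d' ≤ d) := by
  induction hw generalizing l with
  | base hw =>
    obtain ⟨s, d, hw', -⟩ := hw.e_neg l
    exact (HWord.base hw').mem_hSpan ⟨le_rfl, le_rfl⟩
  | cons k hw ih =>
    rw [e_h_neg]
    exact sub_mem (h_mem_hSpan k (fun r d h => by lia) (ih l))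
      (Submodule.smul_mem _ _ (hSpan_mono (fun r d h => by lia) (ih _)))

theorem HWord.e_neg_proper {r d : ℕ} {w : V} (hw : HWord R v r d w) (l : ℕ) :
    R.e (-((l + 1 : ℕ) : ℤ) - 1) w ∈ properSpan R v (fun r' d' => r' ≤ r ∧ d' ≤ d) := by
  induction hw generalizing l with
  | base hw =>
    obtain ⟨s, d, hw', -, hs⟩ := hw.e_neg (l + 1)
    exact IsProperEWord.mem ⟨s, d, hw', hs (by lia)⟩
  | cons k hw ih =>
    rw [e_h_neg]
    exact sub_mem (h_mem_properSpan k (fun r d h => by lia) (hw.e_neg _))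
      (Submodule.smul_mem _ _ (properSpan_mono (fun r d _ h => by lia) (ih (l + 1 + k))))

theorem IsProperEWord.eps {w : V} (hw : IsProperEWord R v w) : IsProperEWord R v (R.e (-1) w) := by
  obtain ⟨s, d, hw, hs⟩ := hw
  exact ⟨s, d, hw.eps, hs⟩

theorem HWord.eps_proper {r d : ℕ} {w : V} (hw : HWord R v r d w) (hr : 0 < r) :
    R.e (-1) w ∈ properSpan R v (fun r' d' => r' ≤ r ∧ d' ≤ d) := by
  cases hw with
  | base hw => exact absurd hr (lt_irrefl _)
  | cons k hw =>
    have := e_h_neg (R := R) 0 k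
    simp only [Nat.cast_zero, neg_zero, zero_sub] at this
    rw [this, zero_add]
    have h₀ := hw.e_neg 0
    simp only [Nat.cast_zero, neg_zero, zero_sub] at h₀
    exact sub_mem (h_mem_properSpan k (fun r d h => by lia) h₀)
      (Submodule.smul_mem _ _ (properSpan_mono (fun r d _ h => by lia) (hw.e_neg_proper k)))

theorem eps_mem_properSpan {P : ℕ → ℕ → Prop} (hP : ∀ r d r' d', P r d → r' ≤ r → d' ≤ d → P r' d')
    {w : V} (hw : w ∈ properSpan R v P) : R.e (-1) w ∈ properSpan R v P := by
  refine map_mem_of_span _ (fun w hw => ?_) hw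
  rcases hw with hw | ⟨r, d, hw, hr, h⟩
  · exact hw.eps.mem
  · exact properSpan_mono (fun r' d' _ h' => hP r d r' d' h h'.1 h'.2) (hw.eps_proper hr)

/-! ### Positive modes -/

theorem EWord.e_nonneg (hv : ∀ n ≥ 0, R.e n v = 0) {s d : ℕ} {w : V} (hw : EWord R v s d w) (n : ℤ)
    (hn : 0 ≤ n) : R.e n w = 0 := by
  induction hw with
  | base => exact hv n hn
  | eps _ ih => rw [R.ee, ih, map_zero]
  | cons a _ ih => rw [R.ee, ih, map_zero]

/-- A nonnegative mode `e(j)` annihilates every `EWord`, so it survives only by commuting with modes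
of `h` until its index is negative. This consumes at least one factor `h`, and total degree greater
than `j`. -/
theorem HWord.e_nonneg (hv : ∀ n ≥ 0, R.e n v = 0) {r d : ℕ} {w : V} (hw : HWord R v r d w) (j : ℕ) :
    R.e j w ∈ hSpan R v (fun r' d' => r' < r ∧ d' + j < d) := by
  induction hw generalizing j with
  | base hw => rw [hw.e_nonneg hv j (by lia)]; exact zero_mem _
  | @cons r d w k hw ih =>
    rw [eq_sub_of_add_eq (R.he (-(k : ℤ) - 1) j w).symm]
    refine sub_mem (h_mem_hSpan k (fun r d h => by lia) (ih j)) (Submodule.smul_mem _ _ ?_)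
    rcases le_or_gt (k + 1) j with hj | hj
    · obtain ⟨i, rfl⟩ := Nat.exists_eq_add_of_le hj
      rw [show -(k : ℤ) - 1 + ((k + 1 + i : ℕ) : ℤ) = i by push_cast; lia]
      exact hSpan_mono (fun r d h => by lia) (ih i)
    · obtain ⟨i, hi⟩ := Nat.exists_eq_add_of_lt hj
      rw [show -(k : ℤ) - 1 + (j : ℤ) = -(i : ℤ) - 1 by lia]
      exact hSpan_mono (fun r d h => by lia) (hw.e_neg i)

/-! ### Eliminating the modes of `h` -/

variable (R)

/-- The operator `∑_{n < D} h(-n-1) e(n)`. -/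
def heSum (D : ℕ) : V →ₗ[ℂ] V := ∑ n ∈ Finset.range D, R.h (-(n : ℤ) - 1) ∘ₗ R.e n

theorem heSum_apply (D : ℕ) (w : V) :
    R.heSum D w = ∑ n ∈ Finset.range D, R.h (-(n : ℤ) - 1) (R.e n w) := by
  simp [heSum]

variable {R}

theorem heSum_eq_zero (D : ℕ) {w : V} (hw : ∀ n ≥ 0, R.e n w = 0) : R.heSum D w = 0 := by
  rw [heSum_apply]
  exact Finset.sum_eq_zero fun n _ => by rw [hw n (by lia), map_zero]

/-- A factor `h(-k-1)` meets the summand `n = k` in `-2e(-1)`, after which `h(-k-1)` is put back: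
this gives `-2e(-1)` for each of the `r` factors. The summands with `n ≠ k` produce words of smaller
degree, and so do the commutators needed to move `e(-1)` to the front. The bound `d ≤ D` ensures
that every `n = k` occurs in the sum. -/
theorem HWord.heSum_add_mem (hv : ∀ n ≥ 0, R.e n v = 0) {D r d : ℕ} {w : V} (hw : HWord R v r d w)
    (hd : d ≤ D) : R.heSum D w + (2 * (r : ℂ)) • R.e (-1) w ∈
      properSpan R v (fun r' d' => r' ≤ r ∧ d' ≤ d ∧ (r' < r ∨ d' < d)) := by
  induction hw with
  | base hw =>
    rw [heSum_eq_zero D (hw.e_nonneg hv)]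
    simp
  | @cons r d w k hw ih =>
    set p := properSpan R v (fun r' d' => r' ≤ r + 1 ∧ d' ≤ d + k + 1 ∧ (r' < r + 1 ∨ d' < d + k + 1))
      with hp
    have hcomm : R.heSum D (R.h (-(k : ℤ) - 1) w) = R.h (-(k : ℤ) - 1) (R.heSum D w) -
        (2 : ℂ) • ∑ n ∈ Finset.range D, R.h (-(n : ℤ) - 1) (R.e (-(k : ℤ) - 1 + n) w) := by
      rw [heSum_apply, heSum_apply, map_sum, Finset.smul_sum, ← Finset.sum_sub_distrib]
      refine Finset.sum_congr rfl fun n _ => ?_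
      rw [eq_sub_of_add_eq (R.he (-(k : ℤ) - 1) n w).symm, map_sub, map_smul, R.hh (-(k : ℤ) - 1),
        if_neg (by lia), zero_smul, add_zero]
    have hsum : ∑ n ∈ Finset.range D, R.h (-(n : ℤ) - 1) (R.e (-(k : ℤ) - 1 + n) w) -
        R.h (-(k : ℤ) - 1) (R.e (-1) w) ∈ p := by
      rw [← Finset.add_sum_erase _ _ (Finset.mem_range.mpr (show k < D by lia)),
        show -(k : ℤ) - 1 + k = -1 by lia, add_sub_cancel_left]
      refine sum_mem fun n hn => ?_
      obtain ⟨hnk, -⟩ := Finset.mem_erase.mp hn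
      rcases lt_or_gt_of_ne hnk with h | h
      · obtain ⟨i, hi⟩ := Nat.exists_eq_add_of_lt h
        rw [show -(k : ℤ) - 1 + n = -((i + 1 : ℕ) : ℤ) - 1 by push_cast; lia]
        exact h_mem_properSpan n (fun r d h => by lia) (hw.e_neg _)
      · obtain ⟨i, hi⟩ := Nat.exists_eq_add_of_lt h
        rw [show -(k : ℤ) - 1 + n = i by lia]
        exact h_mem_properSpan n (fun r d h => by lia) (hw.e_nonneg hv i)
    have heps : R.h (-(k : ℤ) - 1) (R.e (-1) w) - R.e (-1) (R.h (-(k : ℤ) - 1) w) ∈ p := by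
      rw [R.he, add_sub_cancel_left, show -(k : ℤ) - 1 + -1 = -((k + 1 : ℕ) : ℤ) - 1 by push_cast; lia]
      exact Submodule.smul_mem _ _ (properSpan_mono (fun r d _ h => by lia) (hw.e_neg_proper k))
    have hih : R.h (-(k : ℤ) - 1) (R.heSum D w) +
        (2 * (r : ℂ)) • R.h (-(k : ℤ) - 1) (R.e (-1) w) ∈ p := by
      rcases Nat.eq_zero_or_pos r with rfl | hr
      · cases hw with
        | base hw =>
          rw [heSum_eq_zero D (hw.e_nonneg hv)]
          simp
      · rw [← map_smul, ← map_add]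
        refine map_mem_of_span _ (fun y hy => ?_) (ih (by lia))
        rcases hy with ⟨s, x, hy, hs⟩ | ⟨r', d', hy, hr', h⟩
        · exact ((HWord.base hy).cons k).mem_properSpan (by lia) (by lia)
        · exact (hy.cons k).mem_properSpan (by lia) (by lia)
    have goal := add_mem (sub_mem hih (Submodule.smul_mem _ (2 : ℂ) hsum))
      (Submodule.smul_mem _ (-(2 * (r : ℂ) + 2)) heps)
    convert goal using 1
    rw [hcomm]
    push_cast
    module

theorem eps_pow_e_nonneg (hv : ∀ n ≥ 0, R.e n v = 0) (N : ℕ) (n : ℤ) (hn : 0 ≤ n) :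
    R.e n ((R.e (-1) ^ N) v) = 0 := by
  induction N with
  | zero => exact hv n hn
  | succ N ih => rw [pow_succ', Module.End.mul_apply, R.ee, ih, map_zero]

/-- Since `d ≤ D`, the number `r(D + 1) + d` encodes the lexicographic order of `(r, d)`, and the
top layer has a single value `ρ` of `r`. There `heSum + 2ρ e(-1)` lowers the layer, while on
`e(-1)^N v` it is just `2ρ e(-1)`. So each layer is removed at the price of one more power of
`e(-1)`. -/
theorem exists_eps_pow_mem_eSpan (hv : ∀ n ≥ 0, R.e n v = 0) (D μ N : ℕ)
    (h : (R.e (-1) ^ N) v ∈ properSpan R v (fun r d => d ≤ D ∧ r * (D + 1) + d ≤ μ)) :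
    ∃ N', (R.e (-1) ^ N') v ∈ properSpan R v (fun _ _ => False) := by
  induction μ generalizing N with
  | zero => exact ⟨N, properSpan_mono (fun r d hr h => by have := h.2; nlinarith) h⟩
  | succ μ ih =>
    refine ih (N + 1) ?_
    set P : ℕ → ℕ → ℕ → Prop := fun μ r d => d ≤ D ∧ r * (D + 1) + d ≤ μ with hP
    have hmono : ∀ μ r d r' d', P μ r d → r' ≤ r → d' ≤ d → P μ r' d' := fun μ r d r' d' h hr hd =>
      ⟨hd.trans h.1, (add_le_add (Nat.mul_le_mul_right _ hr) hd).trans h.2⟩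
    -- the number of factors `h(-k)` of the words in the top layer
    set ρ := (μ + 1) / (D + 1) with hρ
    have key : ∀ w ∈ properSpan R v (P (μ + 1)),
        (R.heSum D + (2 * (ρ : ℂ)) • R.e (-1)) w ∈ properSpan R v (P μ) := by
      intro w hw
      refine map_mem_of_span _ (fun w hw => ?_) hw
      rcases hw with hw | ⟨r, d, hw, hr, h⟩
      · obtain ⟨s, x, hw', hs⟩ := id hw
        rw [LinearMap.add_apply, heSum_eq_zero D (hw'.e_nonneg hv), zero_add]
        exact Submodule.smul_mem _ _ hw.eps.mem
      · have h₁ := properSpan_mono (Q := P μ) (fun r' d' _ h' => ⟨h'.2.1.trans h.1, by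
          have := h.2
          rcases h'.2.2 with h'' | h''
          · have := Nat.mul_le_mul_right (D + 1) (show r' + 1 ≤ r from h'')
            have := h'.2.1
            nlinarith
          · have := Nat.mul_le_mul_right (D + 1) h'.1
            lia⟩) (hw.heSum_add_mem hv h.1)
        rcases eq_or_lt_of_le h.2 with htop | hlow
        · have : ρ = r := by
            rw [hρ, ← htop, add_comm, Nat.add_mul_div_right _ _ (Nat.succ_pos D),
              Nat.div_eq_of_lt (Nat.lt_succ_of_le h.1), zero_add]
          rw [this]
          exact h₁
        · have h₂ : R.e (-1) w ∈ properSpan R v (P μ) :=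
            eps_mem_properSpan (hmono μ) (hw.mem_properSpan hr ⟨h.1, by lia⟩)
          have := add_mem h₁ (Submodule.smul_mem _ (2 * (ρ : ℂ) - 2 * r) h₂)
          convert this using 1
          simp only [LinearMap.add_apply, LinearMap.smul_apply]
          module
    rw [pow_succ', Module.End.mul_apply]
    rcases Nat.eq_zero_or_pos ρ with h0 | hpos
    · refine eps_mem_properSpan (hmono μ) (properSpan_mono (fun r d hr hh => ?_) h)
      rw [hρ, Nat.div_eq_zero_iff] at h0
      have := hh.2
      have := Nat.le_mul_of_pos_left (D + 1) hr
      lia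
    · have := key _ h
      rw [LinearMap.add_apply, heSum_eq_zero D (eps_pow_e_nonneg hv N), zero_add,
        LinearMap.smul_apply] at this
      exact (Submodule.smul_mem_iff _ (mul_ne_zero two_ne_zero (by exact_mod_cast hpos.ne'))).mp this

/-! ### Eliminating the modes `e(-l)`, `l ≥ 2` -/

variable (R v)

/-- The span of the words in the modes of `e` with at least `s` factors `e(-l)`, `l ≥ 2`. -/
def eSpan (s D : ℕ) : Submodule ℂ V :=
  Submodule.span ℂ {w | ∃ s' d, EWord R v s' d w ∧ s ≤ s' ∧ d ≤ D}

/-- The operator `∑_{n < D} e(-n-2) h(n+1)`. -/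
def ehSum (D : ℕ) : V →ₗ[ℂ] V := ∑ n ∈ Finset.range D, R.e (-(n : ℤ) - 2) ∘ₗ R.h (n + 1)

theorem ehSum_apply (D : ℕ) (w : V) :
    R.ehSum D w = ∑ n ∈ Finset.range D, R.e (-(n : ℤ) - 2) (R.h (n + 1) w) := by
  simp [ehSum]

variable {R v}

theorem EWord.mem_eSpan {s s' d D : ℕ} {w : V} (hw : EWord R v s' d w) (hs : s ≤ s') (hd : d ≤ D) :
    w ∈ eSpan R v s D := Submodule.subset_span ⟨s', d, hw, hs, hd⟩

/-- A factor `e(-a-2)` meets the summand `n = a` in `2e(-1)`, and `e(-a-2)` is put back on the left.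
For `n < a` the factor splits into two factors of the same kind, which raises `s`; for `n > a` a
nonnegative mode of `e` appears and gives `0`. -/
theorem EWord.ehSum_sub_mem (he : ∀ n ≥ 0, R.e n v = 0) (hh : ∀ n > 0, R.h n v = 0) {D s d : ℕ} {w : V}
    (hw : EWord R v s d w) (hd : d ≤ D) :
    R.ehSum D w - (2 * (s : ℂ)) • R.e (-1) w ∈ eSpan R v (s + 1) d := by
  induction hw with
  | base =>
    rw [ehSum_apply, Finset.sum_eq_zero fun n _ => by rw [hh _ (by lia), map_zero]]
    simp
  | @eps s d w hw ih =>
    have : R.ehSum D (R.e (-1) w) = R.e (-1) (R.ehSum D w) := by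
      rw [ehSum_apply, ehSum_apply, map_sum]
      refine Finset.sum_congr rfl fun n _ => ?_
      rw [R.he, hw.e_nonneg he _ (by lia), smul_zero, add_zero, R.ee]
    rw [this, ← map_smul, ← map_sub]
    refine map_mem_of_span _ ?_ (ih hd)
    rintro y ⟨s', d', hy, h⟩
    exact hy.eps.mem_eSpan h.1 h.2
  | @cons s d w a hw ih =>
    have hcomm : R.ehSum D (R.e (-(a : ℤ) - 2) w) = R.e (-(a : ℤ) - 2) (R.ehSum D w) +
        (2 : ℂ) • ∑ n ∈ Finset.range D, R.e (-(n : ℤ) - 2) (R.e (n + 1 + (-(a : ℤ) - 2)) w) := by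
      rw [ehSum_apply, ehSum_apply, map_sum, Finset.smul_sum, ← Finset.sum_add_distrib]
      refine Finset.sum_congr rfl fun n _ => ?_
      rw [R.he, map_add, map_smul, R.ee (-(a : ℤ) - 2)]
    have hsum : ∑ n ∈ Finset.range D, R.e (-(n : ℤ) - 2) (R.e (n + 1 + (-(a : ℤ) - 2)) w) -
        R.e (-1) (R.e (-(a : ℤ) - 2) w) ∈ eSpan R v (s + 1 + 1) (d + a + 1) := by
      rw [← Finset.add_sum_erase _ _ (Finset.mem_range.mpr (show a < D by lia)),
        show (a : ℤ) + 1 + (-(a : ℤ) - 2) = -1 by lia, R.ee (-1), add_sub_cancel_left]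
      refine sum_mem fun n hn => ?_
      obtain ⟨hna, -⟩ := Finset.mem_erase.mp hn
      rcases lt_or_gt_of_ne hna with h | h
      · obtain ⟨i, hi⟩ := Nat.exists_eq_add_of_lt h
        rw [show (n : ℤ) + 1 + (-(a : ℤ) - 2) = -(i : ℤ) - 2 by lia]
        exact ((hw.cons i).cons n).mem_eSpan le_rfl (by lia)
      · rw [hw.e_nonneg he _ (by lia), map_zero]
        exact zero_mem _
    have hih : R.e (-(a : ℤ) - 2) (R.ehSum D w) - (2 * (s : ℂ)) • R.e (-1) (R.e (-(a : ℤ) - 2) w) ∈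
        eSpan R v (s + 1 + 1) (d + a + 1) := by
      rw [R.ee (-1), ← map_smul, ← map_sub]
      refine map_mem_of_span _ ?_ (ih (by lia))
      rintro y ⟨s', d', hy, h⟩
      exact (hy.cons a).mem_eSpan (by lia) (by lia)
    have goal := add_mem hih (Submodule.smul_mem _ (2 : ℂ) hsum)
    convert goal using 1
    rw [hcomm]
    push_cast
    module

theorem eps_pow_h_pos (he : ∀ n ≥ 0, R.e n v = 0) (hh : ∀ n > 0, R.h n v = 0) (N : ℕ) (n : ℤ)
    (hn : 0 < n) : R.h n ((R.e (-1) ^ N) v) = 0 := by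
  induction N with
  | zero => exact hh n hn
  | succ N ih =>
    rw [pow_succ', Module.End.mul_apply, R.he, ih, map_zero, eps_pow_e_nonneg he N _ (by lia)]
    simp

/-- The operator `ehSum - 2s e(-1)` raises the number of factors by one, and on `e(-1)^N v` it
equals `-2s e(-1)`. Each factor contributes at least `1` to the degree, which stays at most `D`, so
the span is zero as soon as `s > D`. -/
theorem exists_eps_pow_eq_zero (he : ∀ n ≥ 0, R.e n v = 0) (hh : ∀ n > 0, R.h n v = 0) (D s N : ℕ)
    (hs : 0 < s) (h : (R.e (-1) ^ N) v ∈ eSpan R v s D) : ∃ N', (R.e (-1) ^ N') v = 0 := by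
  induction hk : D + 1 - s generalizing s N with
  | zero =>
    refine ⟨N, ?_⟩
    have : eSpan R v s D = ⊥ := by
      rw [eSpan, Submodule.span_eq_bot]
      rintro w ⟨s', d, hw, h₁, h₂⟩
      have := hw.le
      lia
    rwa [this, Submodule.mem_bot] at h
  | succ k ih =>
    refine ih (s + 1) (N + 1) (by lia) ?_ (by lia)
    have key : ∀ w ∈ eSpan R v s D,
        (R.ehSum D - (2 * (s : ℂ)) • R.e (-1)) w ∈ eSpan R v (s + 1) D := by
      intro w hw
      refine map_mem_of_span _ ?_ hw
      rintro w ⟨s', d, hw, h₁, h₂⟩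
      have h₃ : R.ehSum D w - (2 * (s' : ℂ)) • R.e (-1) w ∈ eSpan R v (s + 1) D :=
        Submodule.span_mono (by
          rintro y ⟨s'', d', hy, h₃, h₄⟩
          exact ⟨s'', d', hy, by lia, by lia⟩) (hw.ehSum_sub_mem he hh h₂)
      rcases eq_or_lt_of_le h₁ with rfl | hlt
      · exact h₃
      · have := add_mem h₃ (Submodule.smul_mem _ (2 * (s' : ℂ) - 2 * s)
          (hw.eps.mem_eSpan (s := s + 1) hlt h₂))
        convert this using 1
        simp only [LinearMap.sub_apply, LinearMap.smul_apply]
        module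
    have := key _ h
    rw [LinearMap.sub_apply, ehSum_apply,
      Finset.sum_eq_zero fun n _ => by rw [eps_pow_h_pos he hh N _ (by lia), map_zero], zero_sub,
      LinearMap.smul_apply, ← neg_smul, ← Module.End.mul_apply, ← pow_succ'] at this
    exact (Submodule.smul_mem_iff _
      (neg_ne_zero.mpr (mul_ne_zero two_ne_zero (by exact_mod_cast hs.ne')))).mp this

theorem exists_bound_of_mem_properSpan {w : V} (hw : w ∈ properSpan R v (fun _ _ => True)) :
    ∃ D r, w ∈ properSpan R v (fun r' d => d ≤ D ∧ r' ≤ r) := by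
  induction hw using Submodule.span_induction with
  | mem w hw =>
    rcases hw with hw | ⟨r, d, hw, hr, -⟩
    · exact ⟨0, 0, hw.mem⟩
    · exact ⟨d, r, hw.mem_properSpan hr ⟨le_rfl, le_rfl⟩⟩
  | zero => exact ⟨0, 0, zero_mem _⟩
  | add x y _ _ hx hy =>
    obtain ⟨D, r, hx⟩ := hx
    obtain ⟨D', r', hy⟩ := hy
    exact ⟨max D D', max r r', add_mem (properSpan_mono (fun _ _ _ _ => by lia) hx)
      (properSpan_mono (fun _ _ _ _ => by lia) hy)⟩
  | smul a x _ hx =>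
    obtain ⟨D, r, hx⟩ := hx
    exact ⟨D, r, Submodule.smul_mem _ _ hx⟩

theorem exists_bound_of_mem_eSpan {w : V} (hw : w ∈ properSpan R v (fun _ _ => False)) :
    ∃ D, w ∈ eSpan R v 1 D := by
  induction hw using Submodule.span_induction with
  | mem w hw =>
    rcases hw with ⟨s, d, hw, hs⟩ | ⟨r, d, -, -, h⟩
    · exact ⟨d, hw.mem_eSpan hs le_rfl⟩
    · exact h.elim
  | zero => exact ⟨0, zero_mem _⟩
  | add x y _ _ hx hy =>
    obtain ⟨D, hx⟩ := hx
    obtain ⟨D', hy⟩ := hy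
    refine ⟨max D D', add_mem (Submodule.span_mono ?_ hx) (Submodule.span_mono ?_ hy)⟩
    · rintro w ⟨s, d, hw, h₁, h₂⟩
      exact ⟨s, d, hw, h₁, by lia⟩
    · rintro w ⟨s, d, hw, h₁, h₂⟩
      exact ⟨s, d, hw, h₁, by lia⟩
  | smul a x _ hx =>
    obtain ⟨D, hx⟩ := hx
    exact ⟨D, Submodule.smul_mem _ _ hx⟩

/-- If a power of `e(-1)` maps `v` into the span of the proper words, then some power annihilates
`v`. -/
theorem exists_eps_pow_eq_zero_of_mem (he : ∀ n ≥ 0, R.e n v = 0) (hh : ∀ n > 0, R.h n v = 0) {N : ℕ}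
    (h : (R.e (-1) ^ N) v ∈ properSpan R v (fun _ _ => True)) : ∃ N', (R.e (-1) ^ N') v = 0 := by
  obtain ⟨D, r, h⟩ := exists_bound_of_mem_properSpan h
  obtain ⟨N', h'⟩ := exists_eps_pow_mem_eSpan he D (r * (D + 1) + D) N
    (properSpan_mono (fun r' d _ h => ⟨h.1, add_le_add (Nat.mul_le_mul_right _ h.2) h.1⟩) h)
  obtain ⟨D', h'⟩ := exists_bound_of_mem_eSpan h'
  exact exists_eps_pow_eq_zero he hh D' 1 N' one_pos h'

end ModeRep

namespace ModeRep

variable {V : Type*} [AddCommGroup V] [Module ℂ V] {R : ModeRep V} {m : ℕ} {qn : ℤ → ℂ} {v : V}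

/-! ### Saturation with respect to `e(-1)` -/

variable (R) in
/-- The vectors that some power of `e(-1)` maps into `p`. -/
def saturation (p : Submodule ℂ V) (hp : ∀ w ∈ p, R.e (-1) w ∈ p) : Submodule ℂ V where
  carrier := {w | ∃ N, (R.e (-1) ^ N) w ∈ p}
  zero_mem' := ⟨0, by simp⟩
  add_mem' {x y} hx hy := by
    have step : ∀ (K N : ℕ) (w : V), (R.e (-1) ^ N) w ∈ p → (R.e (-1) ^ (K + N)) w ∈ p := by
      intro K N w hw
      induction K with
      | zero => rwa [zero_add]
      | succ K ih => rw [add_right_comm, pow_succ', Module.End.mul_apply]; exact hp _ ih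
    obtain ⟨N, hN⟩ := hx
    obtain ⟨M, hM⟩ := hy
    exact ⟨M + N, by rw [map_add]; exact add_mem (step M N x hN) (add_comm N M ▸ step N M y hM)⟩
  smul_mem' c x hx := by
    obtain ⟨N, hN⟩ := hx
    exact ⟨N, by rw [map_smul]; exact Submodule.smul_mem _ _ hN⟩

theorem le_saturation {p : Submodule ℂ V} {hp : ∀ w ∈ p, R.e (-1) w ∈ p} : p ≤ R.saturation p hp :=
  fun w hw => ⟨0, by simpa using hw⟩

theorem mem_saturation_of_eps {p : Submodule ℂ V} {hp : ∀ w ∈ p, R.e (-1) w ∈ p} {w : V}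
    (hw : R.e (-1) w ∈ R.saturation p hp) : w ∈ R.saturation p hp := by
  obtain ⟨N, hN⟩ := hw
  exact ⟨N + 1, by rwa [pow_succ, Module.End.mul_apply]⟩

/-- To check a property of all vectors in a saturation, it suffices to check it on `p` and to be able
to remove `e(-1)`. -/
theorem saturation_induction {p : Submodule ℂ V} {hp : ∀ w ∈ p, R.e (-1) w ∈ p} {Q : V → Prop}
    (h₀ : ∀ w ∈ p, Q w) (h₁ : ∀ w ∈ R.saturation p hp, Q (R.e (-1) w) → Q w) {w : V}
    (hw : w ∈ R.saturation p hp) : Q w := by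
  obtain ⟨N, hN⟩ := id hw
  induction N generalizing w with
  | zero => exact h₀ w (by simpa using hN)
  | succ N ih =>
    have hN' : (R.e (-1) ^ N) (R.e (-1) w) ∈ p := by rwa [← Module.End.mul_apply, ← pow_succ]
    exact h₁ w hw (ih ⟨N, hN'⟩ hN')

theorem e_mem_saturation {p : Submodule ℂ V} {hp : ∀ w ∈ p, R.e (-1) w ∈ p}
    (he : ∀ n, ∀ w ∈ p, R.e n w ∈ p) (n : ℤ) {w : V} (hw : w ∈ R.saturation p hp) :
    R.e n w ∈ R.saturation p hp :=
  saturation_induction (hp := hp) (Q := fun w => R.e n w ∈ R.saturation p hp)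
    (fun w hw => le_saturation (he n w hw))
    (fun w _ h => mem_saturation_of_eps (by rwa [R.ee])) hw

theorem h_mem_saturation {p : Submodule ℂ V} {hp : ∀ w ∈ p, R.e (-1) w ∈ p}
    (he : ∀ n, ∀ w ∈ p, R.e n w ∈ p) (hh : ∀ n, ∀ w ∈ p, R.h n w ∈ p) (n : ℤ) {w : V}
    (hw : w ∈ R.saturation p hp) : R.h n w ∈ R.saturation p hp :=
  saturation_induction (hp := hp) (Q := fun w => R.h n w ∈ R.saturation p hp)
    (fun w hw => le_saturation (hh n w hw))
    (fun w hw h => mem_saturation_of_eps (by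
      rw [eq_sub_of_add_eq (R.he n (-1) w).symm]
      exact sub_mem h (Submodule.smul_mem _ _ (e_mem_saturation he _ hw)))) hw

/-- Commuting `f(n)` with `e(-1)` produces only `h(n-1)` and a scalar, both of which already
preserve the saturation. -/
theorem f_mem_saturation {p : Submodule ℂ V} {hp : ∀ w ∈ p, R.e (-1) w ∈ p}
    (he : ∀ n, ∀ w ∈ p, R.e n w ∈ p) (hh : ∀ n, ∀ w ∈ p, R.h n w ∈ p)
    (hf : ∀ n, ∀ w ∈ p, R.f n w ∈ R.saturation p hp) (n : ℤ) {w : V}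
    (hw : w ∈ R.saturation p hp) : R.f n w ∈ R.saturation p hp :=
  saturation_induction (hp := hp) (Q := fun w => R.f n w ∈ R.saturation p hp)
    (fun w hw => hf n w hw)
    (fun w hw h => mem_saturation_of_eps (by
      rw [R.ef]
      exact add_mem (add_mem h (h_mem_saturation he hh _ hw)) (Submodule.smul_mem _ _ hw))) hw

/-! ### Words span the representation up to saturation -/

variable (R v) in
/-- The span of all words in the negative modes of `h` and `e`. -/
def wordSpan : Submodule ℂ V := hSpan R v (fun _ _ => True)

theorem e_mem_wordSpan (hv : R.IsWeylVector m qn v) (n : ℤ) (w : V) (hw : w ∈ R.wordSpan v) :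
    R.e n w ∈ R.wordSpan v := by
  refine map_mem_of_span _ ?_ hw
  rintro w ⟨r, d, hw, -⟩
  rcases lt_or_ge n 0 with hn | hn
  · obtain ⟨l, hl⟩ := Int.eq_ofNat_of_zero_le (show 0 ≤ -n - 1 by lia)
    rw [show n = -(l : ℤ) - 1 by lia]
    exact hSpan_mono (fun _ _ _ => trivial) (hw.e_neg l)
  · obtain ⟨j, rfl⟩ := Int.eq_ofNat_of_zero_le hn
    exact hSpan_mono (fun _ _ _ => trivial) (hw.e_nonneg hv.e_v j)

theorem EWord.h_nonneg_mem (hv : R.IsWeylVector m qn v) {n : ℤ} (hn : 0 ≤ n) {s d : ℕ} {w : V}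
    (hw : EWord R v s d w) : R.h n w ∈ Submodule.span ℂ {w | ∃ s d, EWord R v s d w} := by
  have hmem : ∀ k : ℤ, ∀ w ∈ Submodule.span ℂ {w | ∃ s d, EWord R v s d w},
      R.e k w ∈ Submodule.span ℂ {w | ∃ s d, EWord R v s d w} := by
    intro k w hw
    refine map_mem_of_span _ ?_ hw
    rintro w ⟨s, d, hw⟩
    rcases lt_or_ge k 0 with hk | hk
    · obtain ⟨l, hl⟩ := Int.eq_ofNat_of_zero_le (show 0 ≤ -k - 1 by lia)
      rw [show k = -(l : ℤ) - 1 by lia]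
      obtain ⟨s', d', hw', -⟩ := hw.e_neg l
      exact Submodule.subset_span ⟨s', d', hw'⟩
    · rw [hw.e_nonneg hv.e_v k hk]
      exact zero_mem _
  induction hw with
  | base =>
    rcases eq_or_lt_of_le hn with rfl | hn
    · rw [hv.h_zero]
      exact Submodule.smul_mem _ _ (Submodule.subset_span ⟨0, 0, .base⟩)
    · rw [hv.h_v n hn]
      exact zero_mem _
  | @eps s d w hw ih =>
    rw [R.he]
    exact add_mem (hmem _ _ ih)
      (Submodule.smul_mem _ _ (hmem _ _ (Submodule.subset_span ⟨s, d, hw⟩)))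
  | @cons s d w a hw ih =>
    rw [R.he]
    exact add_mem (hmem _ _ ih)
      (Submodule.smul_mem _ _ (hmem _ _ (Submodule.subset_span ⟨s, d, hw⟩)))

theorem h_mem_wordSpan (hv : R.IsWeylVector m qn v) (n : ℤ) (w : V) (hw : w ∈ R.wordSpan v) :
    R.h n w ∈ R.wordSpan v := by
  have hneg : ∀ k : ℕ, ∀ w ∈ R.wordSpan v, R.h (-(k : ℤ) - 1) w ∈ R.wordSpan v :=
    fun k w hw => h_mem_hSpan k (fun _ _ _ => trivial) hw
  rcases lt_or_ge n 0 with hn | hn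
  · obtain ⟨l, hl⟩ := Int.eq_ofNat_of_zero_le (show 0 ≤ -n - 1 by lia)
    rw [show n = -(l : ℤ) - 1 by lia]
    exact hneg l w hw
  · refine map_mem_of_span _ ?_ hw
    rintro w ⟨r, d, hw, -⟩
    induction hw with
    | base hw =>
      refine Submodule.span_mono ?_ (hw.h_nonneg_mem hv hn)
      rintro w ⟨s, d, hw⟩
      exact ⟨0, 0, .base hw, trivial⟩
    | cons k hw ih =>
      rw [R.hh]
      exact add_mem (hneg k _ ih) (Submodule.smul_mem _ _ (hw.mem_hSpan trivial))

/-- The saturation of the span of all words. -/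
def IsWeylVector.satWords (hv : R.IsWeylVector m qn v) : Submodule ℂ V :=
  R.saturation (R.wordSpan v) (e_mem_wordSpan hv (-1))

/-- Since `S_{n-1}` acts by a scalar, `∑ :e(j) f(n-1-j): w` is a combination of words. Its term `j =
-1` is `e(-1) f(n) w`. Terms with `j < -1` involve `f` with a larger index, handled by descending
induction from the smoothness bound; terms with `j ≥ 0` apply `f` to `e(j) w`, which has fewer
factors `h`. Saturation then removes `e(-1)`. -/
theorem HWord.f_mem_satWords (hv : R.IsWeylVector m qn v) {r d : ℕ} {w : V} (hw : HWord R v r d w)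
    (n : ℤ) : R.f n w ∈ hv.satWords := by
  induction r using Nat.strong_induction_on generalizing d w n with
  | _ r ihr =>
  obtain ⟨K, hK⟩ := R.f_smooth w
  have hwB : w ∈ R.wordSpan v := hw.mem_hSpan trivial
  have main : ∀ i : ℕ, ∀ n : ℤ, K - i ≤ n → R.f n w ∈ hv.satWords := by
    intro i
    induction i with
    | zero => intro n hn; rw [hK n (by lia)]; exact zero_mem _
    | succ i ih =>
      intro n hn
      have h₁ : normalProd R.h_smooth R.h_smooth (n - 1) w ∈ R.wordSpan v :=
        (hasFinsum_normalProd R.h_smooth R.h_smooth (n - 1) w).mem fun j => by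
          rcases lt_or_ge j 0 with hj | hj
          · rw [nord_of_neg _ _ hj]
            exact h_mem_wordSpan hv _ _ (h_mem_wordSpan hv _ _ hwB)
          · rw [nord_of_nonneg _ _ hj]
            exact h_mem_wordSpan hv _ _ (h_mem_wordSpan hv _ _ hwB)
      have h₂ : normalProd R.e_smooth R.f_smooth (n - 1) w ∈ R.wordSpan v := by
        have h := R.sug_apply (n - 1) w
        rw [hv.sug_eq] at h
        rw [← sub_eq_iff_eq_add, ← sub_eq_iff_eq_add] at h
        rw [← h]
        exact sub_mem (sub_mem (Submodule.smul_mem _ _ hwB)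
          (Submodule.smul_mem _ _ (h_mem_wordSpan hv _ _ hwB))) (Submodule.smul_mem _ _ h₁)
      have h₃ := ((hasFinsum_normalProd R.e_smooth R.f_smooth (n - 1) w).sub
        (.single_ite (-1) (R.e (-1) (R.f n w)))).mem (p := hv.satWords) fun j => by
          rcases lt_trichotomy j (-1) with hj | rfl | hj
          · rw [nord_of_neg _ _ (by lia), if_neg (by lia), sub_zero]
            exact e_mem_saturation (e_mem_wordSpan hv) _ (ih _ (by lia))
          · rw [nord_of_neg _ _ (by lia), if_pos rfl]
            simp
          · rw [nord_of_nonneg _ _ (by lia), if_neg (by lia), sub_zero]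
            obtain ⟨j, rfl⟩ := Int.eq_ofNat_of_zero_le (show 0 ≤ j by lia)
            refine map_mem_of_span _ ?_ (hw.e_nonneg hv.e_v j)
            rintro y ⟨r', d', hy, h, -⟩
            exact ihr r' h hy _
      refine mem_saturation_of_eps ?_
      have h₄ := sub_mem (le_saturation h₂ : _ ∈ hv.satWords) h₃
      rwa [sub_sub_cancel] at h₄
  exact main (K - n).toNat n (by lia)

theorem IsWeylVector.satWords_eq_top (hv : R.IsWeylVector m qn v) : hv.satWords = ⊤ :=
  hv.gen _ (le_saturation ((HWord.base .base).mem_hSpan trivial))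
    (fun n _ hw => e_mem_saturation (e_mem_wordSpan hv) n hw)
    (fun n _ hw => h_mem_saturation (e_mem_wordSpan hv) (h_mem_wordSpan hv) n hw)
    (fun n _ hw => f_mem_saturation (e_mem_wordSpan hv) (h_mem_wordSpan hv) (fun n _ hw =>
      map_mem_of_span _ (by rintro w ⟨r, d, hw, -⟩; exact hw.f_mem_satWords hv n) hw) n hw)

theorem eps_mem_properSpan_true (w : V) (hw : w ∈ properSpan R v (fun _ _ => True)) :
    R.e (-1) w ∈ properSpan R v (fun _ _ => True) :=
  eps_mem_properSpan (fun _ _ _ _ _ _ _ => trivial) hw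

/-- Up to powers of `e(-1)` every vector is a combination of words, and putting `e(-l)`, `l ≥ 2`, or
`h(-k)` in front makes words proper. Commuting these modes with `e(-1)` stays inside the span. -/
theorem IsWeylVector.coinvKer_le (hv : R.IsWeylVector m qn v) : R.coinvKer ≤
    R.saturation (properSpan R v (fun _ _ => True)) eps_mem_properSpan_true := by
  have top : ∀ w, w ∈ hv.satWords := fun w => hv.satWords_eq_top ▸ Submodule.mem_top
  have he : ∀ l < (-1 : ℤ), ∀ y, R.e l y ∈
      R.saturation (properSpan R v (fun _ _ => True)) eps_mem_properSpan_true := by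
    intro l hl y
    refine saturation_induction (Q := fun y => R.e l y ∈ R.saturation _ eps_mem_properSpan_true)
      (fun w hw => le_saturation ?_) (fun w _ h => mem_saturation_of_eps (by rwa [R.ee])) (top y)
    refine map_mem_of_span _ ?_ hw
    rintro w ⟨r, d, hw, -⟩
    obtain ⟨k, hk⟩ := Int.eq_ofNat_of_zero_le (show 0 ≤ -l - 2 by lia)
    rw [show l = -((k + 1 : ℕ) : ℤ) - 1 by push_cast; lia]
    exact properSpan_mono (fun _ _ _ _ => trivial) (hw.e_neg_proper k)
  refine Submodule.span_le.mpr ?_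
  rintro w (⟨l, hl, y, rfl⟩ | ⟨k, hk, y, rfl⟩)
  · exact he l hl y
  · refine saturation_induction (Q := fun y => R.h k y ∈ R.saturation _ eps_mem_properSpan_true)
      (fun w hw => le_saturation ?_) (fun w _ h => mem_saturation_of_eps ?_) (top y)
    · obtain ⟨j, hj⟩ := Int.eq_ofNat_of_zero_le (show 0 ≤ -k - 1 by lia)
      rw [show k = -(j : ℤ) - 1 by lia]
      exact h_mem_properSpan j (fun _ _ _ => trivial) hw
    · rw [eq_sub_of_add_eq (R.he k (-1) w).symm]
      exact sub_mem h (Submodule.smul_mem _ _ (he _ (by lia) _))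

/-! ### Powers of `e(-1)` do not annihilate the highest weight vector -/

theorem IsWeylVector.h_zero_eps_pow (hv : R.IsWeylVector m qn v) (N : ℕ) :
    R.h 0 ((R.e (-1) ^ N) v) = ((m : ℂ) + 2 * N) • (R.e (-1) ^ N) v := by
  induction N with
  | zero => simpa using hv.h_zero
  | succ N ih =>
    rw [pow_succ', Module.End.mul_apply, R.he, ih, map_smul, zero_add]
    push_cast
    module

/-- `e(-1)` and `f(1)` generate a copy of `sl₂` with `[e(-1), f(1)] = h(0) + 2`, in which `v` is a
lowest weight vector of weight `m + 2 > 0`. Hence the factor never vanishes. -/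
theorem IsWeylVector.f_one_eps_pow (hv : R.IsWeylVector m qn v) (N : ℕ) :
    R.f 1 ((R.e (-1) ^ (N + 1)) v) =
      (-(((N : ℂ) + 1) * ((m : ℂ) + N + 2))) • (R.e (-1) ^ N) v := by
  have hfe : ∀ w, R.f 1 (R.e (-1) w) = R.e (-1) (R.f 1 w) - R.h 0 w - (2 : ℂ) • w := by
    intro w
    rw [R.ef, if_pos (by lia), show (-1 : ℤ) + 1 = 0 by lia]
    push_cast
    module
  induction N with
  | zero =>
    simp only [zero_add, pow_one, pow_zero, Module.End.one_apply]
    rw [hfe, hv.f_v 1 one_pos, map_zero, hv.h_zero]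
    push_cast
    module
  | succ N ih =>
    rw [pow_succ', Module.End.mul_apply, hfe, ih, hv.h_zero_eps_pow, map_smul,
      ← Module.End.mul_apply, ← pow_succ']
    push_cast
    module

theorem IsWeylVector.eq_zero_of_eps_pow (hv : R.IsWeylVector m qn v) {N : ℕ}
    (h : (R.e (-1) ^ N) v = 0) : v = 0 := by
  induction N with
  | zero => simpa using h
  | succ N ih =>
    apply ih
    have := hv.f_one_eps_pow N
    rw [h, map_zero] at this
    refine (smul_eq_zero.mp this.symm).resolve_left (neg_ne_zero.mpr (mul_ne_zero ?_ ?_))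
    · exact_mod_cast N.succ_ne_zero
    · exact_mod_cast (show m + N + 2 ≠ 0 by lia)

/-- A Weyl vector with nonzero Frobenius obstruction vanishes. -/
theorem IsWeylVector.obstruction_eq_zero (hv : R.IsWeylVector m qn v) (hv0 : v ≠ 0) :
    obstruction m (fun i => qn (-(i : ℤ))) = 0 := by
  by_contra hP
  have hmem : v ∈ R.coinvKer := (Submodule.smul_mem_iff _ hP).mp hv.obstruction_smul_mem
  obtain ⟨N, hN⟩ := hv.coinvKer_le hmem
  obtain ⟨N', hN'⟩ := exists_eps_pow_eq_zero_of_mem hv.e_v hv.h_v hN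
  exact hv0 (hv.eq_zero_of_eps_pow hN')

end ModeRep

/-! ### Coefficients of Laurent series -/

theorem tpow_mul_coeff (d : ℤ) (f : Laurent) (n : ℤ) : (tpow d * f).coeff n = f.coeff (n - d) := by
  rw [tpow, HahnSeries.coeff_single_mul, one_mul]

theorem tpow_add (a b : ℤ) : tpow (a + b) = tpow a * tpow b := by
  rw [tpow, tpow, tpow, HahnSeries.single_mul_single, one_mul]

theorem C_mul_coeff (r : ℂ) (f : Laurent) (n : ℤ) : (HahnSeries.C r * f).coeff n = r * f.coeff n := by
  rw [← smul_eq_C_mul, HahnSeries.coeff_smul, smul_eq_mul]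

/-- The power series with the given coefficients, as a Laurent series. -/
def ofSeq (a : ℕ → ℂ) : Laurent := HahnSeries.ofPowerSeries ℤ ℂ (PowerSeries.mk a)

theorem ofSeq_coeff_nat (a : ℕ → ℂ) (n : ℕ) : (ofSeq a).coeff n = a n := by
  rw [ofSeq, LaurentSeries.coeff_coe_powerSeries, PowerSeries.coeff_mk]

theorem ofSeq_coeff_neg (a : ℕ → ℂ) {n : ℤ} (hn : n < 0) : (ofSeq a).coeff n = 0 := by
  rw [ofSeq, PowerSeries.coeff_coe, if_pos hn]

theorem eq_tpow_mul_ofSeq {f : Laurent} {d : ℤ} (h : ∀ n < d, f.coeff n = 0) :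
    f = tpow d * ofSeq (fun k => f.coeff (d + k)) := by
  ext n
  rw [tpow_mul_coeff]
  rcases lt_or_ge n d with hn | hn
  · rw [h n hn, ofSeq_coeff_neg _ (by lia)]
  · obtain ⟨k, hk⟩ := Int.eq_ofNat_of_zero_le (show 0 ≤ n - d by lia)
    rw [hk, ofSeq_coeff_nat, show d + (k : ℤ) = n by lia]

theorem coeff_mul_eq_sum {f g : Laurent} {a b : ℤ} (hf : ∀ n < a, f.coeff n = 0)
    (hg : ∀ n < b, g.coeff n = 0) (n : ℕ) : (f * g).coeff (a + b + n) =
      ∑ i ∈ Finset.range (n + 1), f.coeff (a + i) * g.coeff (b + (n - i : ℕ)) := by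
  conv_lhs => rw [eq_tpow_mul_ofSeq hf, eq_tpow_mul_ofSeq hg]
  rw [mul_mul_mul_comm, ← tpow_add, tpow_mul_coeff, add_sub_cancel_left, ofSeq, ofSeq,
    ← PowerSeries.coe_mul, LaurentSeries.coeff_coe_powerSeries, PowerSeries.coeff_mul]
  simp only [PowerSeries.coeff_mk]
  exact Finset.Nat.sum_antidiagonal_eq_sum_range_succ
    (fun i j : ℕ => f.coeff (a + i) * g.coeff (b + j)) n

theorem coeff_mul_eq_zero {f g : Laurent} {a b : ℤ} (hf : ∀ n < a, f.coeff n = 0)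
    (hg : ∀ n < b, g.coeff n = 0) {n : ℤ} (hn : n < a + b) : (f * g).coeff n = 0 := by
  rw [eq_tpow_mul_ofSeq hf, eq_tpow_mul_ofSeq hg, mul_mul_mul_comm, ← tpow_add, tpow_mul_coeff, ofSeq,
    ofSeq, ← PowerSeries.coe_mul, PowerSeries.coeff_coe, if_pos (by lia)]

theorem ddt_C (r : ℂ) : ddt (HahnSeries.C r) = 0 := by
  ext n
  rw [ddt_coeff, HahnSeries.C_apply, HahnSeries.coeff_single]
  split_ifs with h
  · rw [show (n : ℂ) = -1 by exact_mod_cast (show n = -1 by lia)]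
    simp
  · simp

theorem ddt_C_mul (r : ℂ) (f : Laurent) : ddt (HahnSeries.C r * f) = HahnSeries.C r * ddt f := by
  rw [ddt_mul, ddt_C, zero_mul, zero_add]

theorem ddt_tpow (d : ℤ) : ddt (tpow d) = HahnSeries.C (d : ℂ) * tpow (d - 1) := by
  ext n
  rw [ddt_coeff, C_mul_coeff, tpow, tpow, HahnSeries.coeff_single, HahnSeries.coeff_single]
  by_cases h : n + 1 = d
  · rw [if_pos h, if_pos (by lia), ← h]
    push_cast
    ring
  · rw [if_neg h, if_neg (by lia)]
    simp

/-! ### The Frobenius method -/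

/-- The equation satisfied by `A` if `t^{e/2} A` is annihilated by `∂_t² - q`. -/
def IsFrobSol (e : ℂ) (q A : Laurent) : Prop :=
  ddt (ddt A) + HahnSeries.C e * (tpow (-1) * ddt A) +
    HahnSeries.C (e / 2 * (e / 2 - 1)) * (tpow (-2) * A) = q * A

/-- Compare coefficients of `t^{n-2}`: by the indicial equation the leading term of `q` cancels the
constant part of the conjugated operator, leaving the diagonal factor `n(n - 1 + e)`. -/
theorem isFrobSol_iff {e : ℂ} {q A : Laurent} (hq : ∀ n < (-2 : ℤ), q.coeff n = 0)
    (hq₂ : q.coeff (-2) = e / 2 * (e / 2 - 1)) (hA : ∀ n < (0 : ℤ), A.coeff n = 0) :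
    IsFrobSol e q A ↔ ∀ n : ℕ, (n : ℂ) * ((n : ℂ) - 1 + e) * A.coeff n =
      ∑ i ∈ Finset.range n, q.coeff ((n - i : ℕ) - 2) * A.coeff i := by
  have hL : ∀ k : ℤ, (ddt (ddt A) + HahnSeries.C e * (tpow (-1) * ddt A) +
      HahnSeries.C (e / 2 * (e / 2 - 1)) * (tpow (-2) * A)).coeff (k - 2) =
      ((k : ℂ) * ((k : ℂ) - 1 + e) + e / 2 * (e / 2 - 1)) * A.coeff k := by
    intro k
    rw [HahnSeries.coeff_add, HahnSeries.coeff_add, C_mul_coeff, C_mul_coeff, tpow_mul_coeff,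
      tpow_mul_coeff, ddt_coeff, ddt_coeff, ddt_coeff, show k - 2 + 1 + 1 = k by lia,
      show k - 2 - -1 + 1 = k by lia, show k - 2 - -2 = k by lia]
    push_cast
    ring
  have hR : ∀ n : ℕ, (q * A).coeff (n - 2) =
      ∑ i ∈ Finset.range n, q.coeff ((n - i : ℕ) - 2) * A.coeff i +
        e / 2 * (e / 2 - 1) * A.coeff n := by
    intro n
    rw [mul_comm, show (n : ℤ) - 2 = 0 + -2 + n by lia, coeff_mul_eq_sum hA hq,
      Finset.sum_range_succ, Nat.sub_self, Nat.cast_zero, add_zero, hq₂, zero_add]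
    congr 1
    · refine Finset.sum_congr rfl fun i _ => ?_
      rw [zero_add, mul_comm, show (-2 : ℤ) + (n - i : ℕ) = (n - i : ℕ) - 2 by lia]
    · ring
  constructor
  · intro h n
    have h₁ := congrArg (fun f : Laurent => f.coeff (n - 2)) h
    simp only [hL, hR] at h₁
    push_cast at h₁
    linear_combination h₁
  · intro h
    rw [IsFrobSol]
    ext k
    rw [show k = k + 2 - 2 by lia]
    rcases lt_or_ge (k + 2) 0 with hk | hk
    · rw [hL, hA _ hk, mul_zero, coeff_mul_eq_zero hq hA (by lia)]
    · obtain ⟨n, hn⟩ := Int.eq_ofNat_of_zero_le hk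
      rw [hn, hL, hR, ← h n]
      push_cast
      ring

/-- The coefficient of `t^{i-2}` in `q`. -/
def qSeq (q : Laurent) (i : ℕ) : ℂ := q.coeff (i - 2)

/-- For the larger exponent the diagonal factors are `(n + 1)(n + m + 2)`, which never vanish. -/
theorem exists_frobSol_high {m : ℕ} {q : Laurent} (hq : ∀ n < (-2 : ℤ), q.coeff n = 0)
    (hq₂ : q.coeff (-2) = (m : ℂ) * ((m : ℂ) + 2) / 4) :
    ∃ a : ℕ → ℂ, a 0 = 1 ∧ IsFrobSol ((m : ℂ) + 2) q (ofSeq a) := by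
  refine ⟨frob (-((m : ℂ) + 2)) (qSeq q), frob_zero _ _,
    (isFrobSol_iff hq (by rw [hq₂]; ring) fun n hn => ofSeq_coeff_neg _ hn).mpr fun n => ?_⟩
  rcases n with _ | n
  · simp
  · have h := frob_succ (-((m : ℂ) + 2)) (qSeq q) (n := n) (fun h => by
      have h' : (n : ℂ) + ((m : ℂ) + 2) = 0 := by rw [h]; ring
      exact absurd h' (by exact_mod_cast (show n + (m + 2) ≠ 0 by lia)))
    simp only [ofSeq_coeff_nat]
    push_cast at h ⊢
    rw [show (n : ℂ) + 1 - 1 + (m + 2) = n - -(m + 2) by ring, h]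
    exact Finset.sum_congr rfl fun i _ => by rw [qSeq]

/-- The coefficients up to index `m` are forced. The next equation has left-hand side `0`, so it is
the vanishing of the obstruction, and the later ones are solvable again. -/
theorem exists_frobSol_iff {m : ℕ} {q : Laurent} (hq : ∀ n < (-2 : ℤ), q.coeff n = 0)
    (hq₂ : q.coeff (-2) = (m : ℂ) * ((m : ℂ) + 2) / 4) :
    (∃ a : ℕ → ℂ, a 0 = 1 ∧ IsFrobSol (-(m : ℂ)) q (ofSeq a)) ↔
    obstruction m (qSeq q) = 0 := by
  have key := fun a : ℕ → ℂ => isFrobSol_iff (e := -(m : ℂ)) hq (by rw [hq₂]; ring)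
    fun n hn => ofSeq_coeff_neg a hn
  simp only [ofSeq_coeff_nat] at key
  constructor
  · rintro ⟨a, ha₀, ha⟩
    rw [key] at ha
    have hfrob : ∀ n ≤ m, a n = frob m (qSeq q) n := by
      intro n
      induction n using Nat.strong_induction_on with
      | _ n ih =>
      intro hn
      rcases n with _ | n
      · rw [ha₀, frob_zero]
      · have h₁ := ha (n + 1)
        have h₂ := frob_succ m (qSeq q) (n := n) (by exact_mod_cast (show n ≠ m by lia))
        have hne : ((n : ℂ) + 1) * ((n : ℂ) - m) ≠ 0 := mul_ne_zero
          (by exact_mod_cast n.succ_ne_zero)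
          (sub_ne_zero.mpr (by exact_mod_cast (show n ≠ m by lia)))
        refine mul_left_cancel₀ hne ?_
        rw [h₂]
        push_cast at h₁
        rw [show (n : ℂ) + 1 - 1 + -m = n - m by ring] at h₁
        rw [h₁]
        refine Finset.sum_congr rfl fun i hi => ?_
        have hi' := Finset.mem_range.mp hi
        rw [ih i hi' (by lia), qSeq]
    have h := ha (m + 1)
    push_cast at h
    rw [show (m : ℂ) + 1 - 1 + -m = 0 by ring, mul_zero, zero_mul] at h
    rw [obstruction, h]
    refine Finset.sum_congr rfl fun i hi => ?_
    rw [hfrob i (by have := Finset.mem_range.mp hi; lia), qSeq]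
  · intro h
    refine ⟨frob m (qSeq q), frob_zero _ _, (key _).mpr fun n => ?_⟩
    rcases n with _ | n
    · simp
    · push_cast
      rw [show (n : ℂ) + 1 - 1 + -m = n - m by ring]
      by_cases hn : n = m
      · subst hn
        rw [sub_self, mul_zero, zero_mul, ← h, obstruction]
        rfl
      · rw [frob_succ m (qSeq q) (by exact_mod_cast hn)]
        rfl

theorem exists_ofSeq_mul_ofSeq_eq_one {a : ℕ → ℂ} (ha : a 0 = 1) : ∃ b, ofSeq a * ofSeq b = 1 := by
  refine ⟨fun n => PowerSeries.coeff n (PowerSeries.mk a)⁻¹, ?_⟩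
  have : PowerSeries.mk (fun n => PowerSeries.coeff n (PowerSeries.mk a)⁻¹) = (PowerSeries.mk a)⁻¹ := by
    ext n
    rw [PowerSeries.coeff_mk]
  rw [ofSeq, ofSeq, this, ← PowerSeries.coe_mul, PowerSeries.mul_inv_cancel, PowerSeries.coe_one]
  rw [← PowerSeries.coeff_zero_eq_constantCoeff_apply, PowerSeries.coeff_mk, ha]
  exact one_ne_zero

theorem exists_log_deriv_eq (g : Laurent) (hg : ∀ n < (0 : ℤ), g.coeff n = 0) :
    ∃ a : ℕ → ℂ, a 0 = 1 ∧ ddt (ofSeq a) = g * ofSeq a := by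
  let a : ℕ → ℂ := fun n => Nat.strongRec (motive := fun _ => ℂ) (fun n ih => match n, ih with
    | 0, _ => 1
    | n + 1, ih => (∑ i : Fin (n + 1), ih i i.2 * g.coeff (n - i : ℕ)) / ((n : ℂ) + 1)) n
  have ha₀ : a 0 = 1 := by
    simp only [a]
    rw [Nat.strongRec]
  have ha : ∀ n : ℕ, ((n : ℂ) + 1) * a (n + 1) =
      ∑ i ∈ Finset.range (n + 1), a i * g.coeff (n - i : ℕ) := by
    intro n
    have h₁ : ((n : ℂ) + 1) ≠ 0 := by exact_mod_cast n.succ_ne_zero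
    have : a (n + 1) = (∑ i : Fin (n + 1), a i * g.coeff (n - i : ℕ)) / ((n : ℂ) + 1) := by
      simp only [a]
      rw [Nat.strongRec]
    rw [this, mul_div_cancel₀ _ h₁, Finset.sum_range (fun i => a i * g.coeff (n - i : ℕ))]
  refine ⟨a, ha₀, ?_⟩
  have hA : ∀ n < (0 : ℤ), (ofSeq a).coeff n = 0 := fun n hn => ofSeq_coeff_neg a hn
  ext k
  rw [ddt_coeff, mul_comm]
  rcases lt_or_ge k 0 with hk | hk
  · rw [mul_comm g, coeff_mul_eq_zero hA hg (by lia)]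
    rcases eq_or_ne k (-1) with rfl | hk'
    · simp
    · rw [hA _ (by lia), zero_mul]
  · obtain ⟨n, rfl⟩ := Int.eq_ofNat_of_zero_le hk
    have h := coeff_mul_eq_sum hA hg n
    rw [add_zero, zero_add] at h
    rw [mul_comm g, h, show ((n : ℤ) + 1) = ((n + 1 : ℕ) : ℤ) by push_cast; rfl, ofSeq_coeff_nat, mul_comm]
    push_cast
    rw [ha]
    refine Finset.sum_congr rfl fun i _ => ?_
    rw [zero_add, ofSeq_coeff_nat, zero_add]

/-! ### The Miura (Riccati) equation. -/

/-- For `φ = t^{-m/2} a` put `χ = -2φ'/φ = m/t - 2a'/a`; then `φ''/φ = χ²/4 - χ'/2`. The condition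
on the residue of `χ` says that `g = a'/a` has no pole, which is what allows `a` to be recovered
from `χ`. -/
theorem exists_miura_iff {m : ℕ} {q : Laurent} :
    (∃ χ : Laurent, (∀ n < (-1 : ℤ), χ.coeff n = 0) ∧ χ.coeff (-1) = (m : ℂ) ∧
      q = (1 / 4 : ℂ) • χ ^ 2 - (1 / 2 : ℂ) • ddt χ) ↔
    ∃ a : ℕ → ℂ, a 0 = 1 ∧ IsFrobSol (-(m : ℂ)) q (ofSeq a) := by
  have h4 : (4 : Laurent) * HahnSeries.C (1 / 4 : ℂ) = 1 := by
    rw [show (4 : Laurent) = HahnSeries.C 4 from (map_ofNat HahnSeries.C 4).symm, ← map_mul]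
    norm_num
  have e4 : (4 : Laurent) ≠ 0 := left_ne_zero_of_mul_eq_one h4
  have h2 : (2 : Laurent) * HahnSeries.C (1 / 2 : ℂ) = 1 := by
    rw [show (2 : Laurent) = HahnSeries.C 2 from (map_ofNat HahnSeries.C 2).symm, ← map_mul]
    norm_num
  have hcst : (4 : Laurent) * HahnSeries.C (-(m : ℂ) / 2 * (-(m : ℂ) / 2 - 1)) =
      HahnSeries.C (m : ℂ) * HahnSeries.C (m : ℂ) + 2 * HahnSeries.C (m : ℂ) := by
    rw [show (4 : Laurent) = HahnSeries.C 4 from (map_ofNat HahnSeries.C 4).symm,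
      show (2 : Laurent) = HahnSeries.C 2 from (map_ofNat HahnSeries.C 2).symm, ← map_mul, ← map_mul,
      ← map_mul, ← map_add]
    congr 1
    ring
  have hneg : HahnSeries.C (Γ := ℤ) (-(m : ℂ)) = -HahnSeries.C (m : ℂ) := map_neg _ _
  have hT2 : tpow (-2) = tpow (-1) * tpow (-1) := by rw [← tpow_add]; rfl
  have hdT : ddt (tpow (-1)) = -tpow (-2) := by
    rw [ddt_tpow]
    push_cast
    rw [map_neg, map_one]
    norm_num
  constructor
  · rintro ⟨χ, hχ, hχ₁, hqχ⟩
    set g : Laurent := HahnSeries.C (1 / 2 : ℂ) * (HahnSeries.C (m : ℂ) * tpow (-1) - χ) with hg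
    have hg0 : ∀ n < (0 : ℤ), g.coeff n = 0 := by
      intro n hn
      rw [hg, C_mul_coeff, HahnSeries.coeff_sub, C_mul_coeff, tpow, HahnSeries.coeff_single]
      rcases eq_or_ne n (-1) with rfl | hne
      · rw [hχ₁, if_pos rfl]
        ring
      · rw [if_neg hne, hχ n (by lia)]
        ring
    obtain ⟨a, ha₀, ha⟩ := exists_log_deriv_eq g hg0
    refine ⟨a, ha₀, ?_⟩
    have hχg : χ = HahnSeries.C (m : ℂ) * tpow (-1) - 2 * g := by
      rw [hg]
      linear_combination (HahnSeries.C (m : ℂ) * tpow (-1) - χ) * h2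
    have hdχ : ddt χ = -(HahnSeries.C (m : ℂ) * tpow (-2)) - 2 * ddt g := by
      rw [hχg, map_sub, ddt_C_mul, hdT, AffineSl2.ddt_two_mul]
      ring
    rw [smul_eq_C_mul, smul_eq_C_mul, hdχ] at hqχ
    rw [IsFrobSol, ha, ddt_mul, ha, hqχ, hneg]
    refine mul_left_cancel₀ e4 ?_
    rw [hχg, hT2]
    linear_combination (tpow (-1) * tpow (-1) * ofSeq a) * hcst -
      ((HahnSeries.C (m : ℂ) * tpow (-1) - 2 * g) ^ 2 * ofSeq a) * h4 +
      (2 * (-(HahnSeries.C (m : ℂ) * (tpow (-1) * tpow (-1))) - 2 * ddt g) * ofSeq a) * h2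
  · rintro ⟨a, ha₀, ha⟩
    obtain ⟨b, hb⟩ := exists_ofSeq_mul_ofSeq_eq_one ha₀
    set A := ofSeq a with hA
    set g := ddt A * ofSeq b with hg
    have hgA : g * A = ddt A := by
      rw [hg]
      linear_combination ddt A * hb
    have hg0 : ∀ n < (0 : ℤ), g.coeff n = 0 := by
      intro n hn
      refine coeff_mul_eq_zero (a := 0) (b := 0) (fun k hk => ?_) (fun k hk => ofSeq_coeff_neg b hk)
        (by lia)
      rw [ddt_coeff]
      rcases eq_or_ne k (-1) with rfl | hne
      · simp
      · rw [hA, ofSeq_coeff_neg a (by lia), mul_zero]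
    have hA0 : A ≠ 0 := left_ne_zero_of_mul_eq_one hb
    have hdd : ddt (ddt A) = ddt g * A + g * ddt A := by rw [← ddt_mul, hgA]
    refine ⟨HahnSeries.C (m : ℂ) * tpow (-1) - 2 * g, fun n hn => ?_, ?_, ?_⟩
    · rw [HahnSeries.coeff_sub, C_mul_coeff, tpow, HahnSeries.coeff_single, if_neg (by lia), two_mul,
        HahnSeries.coeff_add, hg0 n (by lia)]
      simp
    · rw [HahnSeries.coeff_sub, C_mul_coeff, tpow, HahnSeries.coeff_single, if_pos rfl, two_mul,
        HahnSeries.coeff_add, hg0 _ (by lia)]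
      simp
    · have hdχ : ddt (HahnSeries.C (m : ℂ) * tpow (-1) - 2 * g) =
          -(HahnSeries.C (m : ℂ) * tpow (-2)) - 2 * ddt g := by
        rw [map_sub, ddt_C_mul, hdT, AffineSl2.ddt_two_mul]
        ring
      rw [hdχ, smul_eq_C_mul, smul_eq_C_mul]
      rw [IsFrobSol, hdd, ← hgA, hneg] at ha
      refine mul_left_cancel₀ e4 (mul_right_cancel₀ hA0 ?_)
      rw [hT2] at ha ⊢
      linear_combination (-4) * ha + (tpow (-1) * tpow (-1) * A) * hcst -
        ((HahnSeries.C (m : ℂ) * tpow (-1) - 2 * g) ^ 2 * A) * h4 +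
        (2 * (-(HahnSeries.C (m : ℂ) * (tpow (-1) * tpow (-1))) - 2 * ddt g) * A) * h2

/-! ### Half-integral powers and logarithms -/

theorem halfDeriv_coeff (f : Laurent) (n : ℤ) :
    (halfDeriv f).coeff n = ((n : ℂ) + 2) / 2 * f.coeff (n + 2) := by
  rw [halfDeriv, LinearMap.comp_apply, LinearMap.mulLeft_apply, HahnSeries.coeff_single_mul, ddt_coeff,
    show n - -1 + 1 = n + 2 by lia]
  push_cast
  ring

theorem halfDeriv_mul (f g : Laurent) :
    halfDeriv (f * g) = halfDeriv f * g + f * halfDeriv g := by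
  simp only [halfDeriv, LinearMap.comp_apply, LinearMap.mulLeft_apply, ddt_mul]
  ring

theorem halfDeriv_tpow (d : ℤ) : halfDeriv (tpow d) = HahnSeries.C ((d : ℂ) / 2) * tpow (d - 2) := by
  ext n
  rw [halfDeriv_coeff, C_mul_coeff, tpow, tpow, HahnSeries.coeff_single, HahnSeries.coeff_single]
  by_cases h : n + 2 = d
  · rw [if_pos h, if_pos (by lia), ← h]
    push_cast
    ring
  · rw [if_neg h, if_neg (by lia)]
    simp

theorem halfDeriv_C_mul (r : ℂ) (f : Laurent) :
    halfDeriv (HahnSeries.C r * f) = HahnSeries.C r * halfDeriv f := by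
  rw [← smul_eq_C_mul, map_smul, smul_eq_C_mul]

theorem eq_C_of_halfDeriv_eq_zero {f : Laurent} (h : halfDeriv f = 0) :
    f = HahnSeries.C (f.coeff 0) := by
  ext n
  rw [HahnSeries.C_apply, HahnSeries.coeff_single]
  split_ifs with hn
  · rw [hn]
  · have h₁ := congrArg (fun g : Laurent => g.coeff (n - 2)) h
    simp only [halfDeriv_coeff, HahnSeries.coeff_zero, sub_add_cancel] at h₁
    refine (mul_eq_zero.mp h₁).resolve_left ?_
    push_cast
    rw [sub_add_cancel]
    exact div_ne_zero (by exact_mod_cast hn) two_ne_zero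

theorem substSq_coeff_two_mul (f : Laurent) (n : ℤ) : (substSq f).coeff (2 * n) = f.coeff n := by
  exact HahnSeries.embDomain_coeff (f := ⟨⟨fun k : ℤ => 2 * k, fun a b h => by simpa using h⟩,
      fun {a b} => mul_le_mul_iff_right₀ two_pos⟩)

theorem substSq_coeff_odd (f : Laurent) {n : ℤ} (hn : Odd n) : (substSq f).coeff n = 0 := by
  refine HahnSeries.embDomain_of_notMem_range
    (f := ⟨⟨fun k : ℤ => 2 * k, fun a b h => by simpa using h⟩,
      fun {a b} => mul_le_mul_iff_right₀ two_pos⟩) ?_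
  rintro ⟨k, hk⟩
  have hk' : 2 * k = n := hk
  rw [← hk'] at hn
  exact (Int.not_odd_iff_even.mpr (even_two_mul k)) hn

theorem halfDeriv_substSq (f : Laurent) : halfDeriv (substSq f) = substSq (ddt f) := by
  ext n
  rw [halfDeriv_coeff]
  rcases Int.even_or_odd' n with ⟨k, rfl | rfl⟩
  · rw [show 2 * k + 2 = 2 * (k + 1) by ring, substSq_coeff_two_mul, substSq_coeff_two_mul, ddt_coeff]
    push_cast
    ring
  · rw [substSq_coeff_odd _ ⟨k + 1, by ring⟩, substSq_coeff_odd _ ⟨k, rfl⟩, mul_zero]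

theorem substSq_tpow (d : ℤ) : substSq (tpow d) = tpow (2 * d) := by
  ext n
  rcases Int.even_or_odd' n with ⟨k, rfl | rfl⟩
  · rw [substSq_coeff_two_mul, tpow, tpow, HahnSeries.coeff_single, HahnSeries.coeff_single]
    by_cases h : k = d
    · rw [if_pos h, if_pos (by lia)]
    · rw [if_neg h, if_neg (by lia)]
  · rw [substSq_coeff_odd _ ⟨k, rfl⟩, tpow, HahnSeries.coeff_single, if_neg (by lia)]

theorem substSq_C (r : ℂ) : substSq (HahnSeries.C r) = HahnSeries.C r := by
  ext n
  rcases Int.even_or_odd' n with ⟨k, rfl | rfl⟩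
  · rw [substSq_coeff_two_mul, HahnSeries.C_apply, HahnSeries.coeff_single, HahnSeries.coeff_single]
    by_cases h : k = 0
    · rw [if_pos h, if_pos (by lia)]
    · rw [if_neg h, if_neg (by lia)]
  · rw [substSq_coeff_odd _ ⟨k, rfl⟩, HahnSeries.C_apply, HahnSeries.coeff_single, if_neg (by lia)]

/-- In the variable `s = t^{1/2}` the monomial `tpow e` is `t^{e/2}`, and conjugating `∂_t` by it
gives `∂_t + (e/2)t⁻¹`. -/
theorem isFrobSol_iff_halfDeriv (e : ℤ) (q A : Laurent) : IsFrobSol (e : ℂ) q A ↔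
    halfDeriv (halfDeriv (tpow e * substSq A)) = substSq q * (tpow e * substSq A) := by
  have hD : ∀ g, halfDeriv (tpow e * g) =
      tpow e * (halfDeriv g + HahnSeries.C ((e : ℂ) / 2) * (tpow (-2) * g)) := by
    intro g
    rw [halfDeriv_mul, halfDeriv_tpow, sub_eq_add_neg, tpow_add]
    ring
  have hT : halfDeriv (tpow (-2)) = -(tpow (-2) * tpow (-2)) := by
    rw [halfDeriv_tpow, ← tpow_add]
    push_cast
    rw [show (-2 : ℂ) / 2 = -1 by norm_num, map_neg, map_one]
    norm_num
  have hT4 : tpow (-4) = tpow (-2) * tpow (-2) := by rw [← tpow_add]; rfl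
  have he : HahnSeries.C (Γ := ℤ) (e : ℂ) = HahnSeries.C ((e : ℂ) / 2) + HahnSeries.C ((e : ℂ) / 2) := by
    rw [← map_add, add_halves]
  have hL : halfDeriv (halfDeriv (tpow e * substSq A)) = tpow e *
      substSq (ddt (ddt A) + HahnSeries.C (e : ℂ) * (tpow (-1) * ddt A) +
        HahnSeries.C ((e : ℂ) / 2 * ((e : ℂ) / 2 - 1)) * (tpow (-2) * A)) := by
    rw [hD, hD, map_add, halfDeriv_C_mul, halfDeriv_mul, hT]
    simp only [map_add, map_mul, substSq_C, substSq_tpow, ← halfDeriv_substSq, map_sub, map_one, he]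
    rw [show (2 : ℤ) * (-1) = -2 by norm_num, show (2 : ℤ) * (-2) = -4 by norm_num, hT4]
    ring
  have hne : tpow e ≠ 0 := by
    rw [tpow]
    exact HahnSeries.single_ne_zero one_ne_zero
  rw [IsFrobSol, hL, mul_left_comm (substSq q), mul_right_inj' hne, ← map_mul]
  exact substSq.injective.eq_iff.symm

theorem lsum_monomial_comp_coeff (D : Laurent →ₗ[ℂ] Laurent) (φ : LogLaurent) (k : ℕ) :
    (Polynomial.lsum (fun k => (Polynomial.monomial k).restrictScalars ℂ ∘ₗ D) φ).coeff k =
      D (φ.coeff k) := by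
  rw [Polynomial.lsum_apply, Polynomial.sum_def, Polynomial.finsetSum_coeff]
  simp only [LinearMap.comp_apply, LinearMap.restrictScalars_apply, Polynomial.coeff_monomial]
  rw [Finset.sum_ite_eq']
  split_ifs with h
  · rfl
  · rw [Polynomial.notMem_support_iff.mp h, map_zero]

theorem logDeriv_coeff (φ : LogLaurent) (k : ℕ) : (logDeriv φ).coeff k =
    halfDeriv (φ.coeff k) + tpow (-2) * (φ.coeff (k + 1) * ((k : Laurent) + 1)) := by
  rw [logDeriv, LinearMap.add_apply, Polynomial.coeff_add, lsum_monomial_comp_coeff]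
  congr 1
  rw [LinearMap.comp_apply, LinearMap.restrictScalars_apply, LinearMap.mulLeft_apply,
    LinearMap.restrictScalars_apply, Polynomial.coeff_C_mul, Polynomial.coeff_derivative]

theorem logDeriv_C (f : Laurent) : logDeriv (Polynomial.C f) = Polynomial.C (halfDeriv f) := by
  ext1 k
  rw [logDeriv_coeff, Polynomial.coeff_C_succ, zero_mul, mul_zero, add_zero, Polynomial.coeff_C,
    Polynomial.coeff_C]
  split_ifs
  · rfl
  · exact map_zero _

theorem logDeriv_C_mul (f : Laurent) (φ : LogLaurent) : logDeriv (Polynomial.C f * φ) =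
    Polynomial.C (halfDeriv f) * φ + Polynomial.C f * logDeriv φ := by
  ext1 k
  rw [Polynomial.coeff_add, logDeriv_coeff, Polynomial.coeff_C_mul, Polynomial.coeff_C_mul,
    Polynomial.coeff_C_mul, Polynomial.coeff_C_mul, logDeriv_coeff, halfDeriv_mul]
  ring

theorem natCast_coeff_mul (f : Laurent) (k : ℕ) (n : ℤ) :
    (f * ((k : Laurent) + 1)).coeff n = f.coeff n * ((k : ℂ) + 1) := by
  rw [show ((k : Laurent) + 1) = HahnSeries.C ((k : ℂ) + 1) by rw [map_add, map_natCast, map_one],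
    mul_comm, C_mul_coeff, mul_comm]

/-- The top coefficient in `log t` is a constant `c`. If it stands at a positive power, the next
coefficient must have derivative a nonzero multiple of `c t⁻¹`; but `halfDeriv` never produces `s⁻²
= t⁻¹`, so `c = 0`. -/
theorem exists_eq_C_of_logDeriv_eq_zero {φ : LogLaurent} (h : logDeriv φ = 0) :
    ∃ r : ℂ, φ = Polynomial.C (HahnSeries.C r) := by
  have hdeg : φ.natDegree = 0 := by
    by_contra hN
    obtain ⟨N, hN⟩ := Nat.exists_eq_succ_of_ne_zero hN
    have hne : φ.coeff (N + 1) ≠ 0 := by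
      have : φ ≠ 0 := fun h => by simp [h] at hN
      rw [show N + 1 = φ.natDegree from hN.symm]
      exact Polynomial.leadingCoeff_ne_zero.mpr this
    have h₁ := congrArg (fun ψ : LogLaurent => ψ.coeff (N + 1)) h
    simp only [logDeriv_coeff, Polynomial.coeff_zero] at h₁
    rw [Polynomial.coeff_eq_zero_of_natDegree_lt (n := N + 1 + 1) (by lia), zero_mul, mul_zero,
      add_zero] at h₁
    have hc := eq_C_of_halfDeriv_eq_zero h₁
    have h₂ := congrArg (fun ψ : LogLaurent => (ψ.coeff N).coeff (-2)) h
    simp only [logDeriv_coeff, Polynomial.coeff_zero, HahnSeries.coeff_add, halfDeriv_coeff,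
      tpow_mul_coeff, natCast_coeff_mul, HahnSeries.coeff_zero] at h₂
    push_cast at h₂
    norm_num at h₂
    rcases h₂ with h₂ | h₂
    · rw [h₂, map_zero] at hc
      exact hne hc
    · exact absurd h₂ (by exact_mod_cast N.succ_ne_zero)
  rw [Polynomial.eq_C_of_natDegree_eq_zero hdeg] at h ⊢
  rw [logDeriv_C] at h
  exact ⟨_, congrArg _ (eq_C_of_halfDeriv_eq_zero (Polynomial.C_eq_zero.mp h))⟩

/-! ### The solution space and the Wronskian. -/

theorem mem_solutions {q : Laurent} {φ : LogLaurent} :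
    φ ∈ solutions q ↔ logDeriv (logDeriv φ) = Polynomial.C (substSq q) * φ := Iff.rfl

theorem C_mem_solutions {q f : Laurent} :
    Polynomial.C f ∈ solutions q ↔ halfDeriv (halfDeriv f) = substSq q * f := by
  rw [mem_solutions, logDeriv_C, logDeriv_C, ← Polynomial.C_mul]
  exact Polynomial.C_injective.eq_iff

instance : IsCancelAdd LogLaurent where
  add_left_cancel a b c h := Polynomial.ext fun n => add_left_cancel (a := a.coeff n)
    (by simpa using congrArg (fun p : LogLaurent => p.coeff n) h)
  add_right_cancel a b c h := Polynomial.ext fun n => add_right_cancel (b := a.coeff n)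
    (by simpa using congrArg (fun p : LogLaurent => p.coeff n) h)

theorem logDeriv_sub (φ ψ : LogLaurent) : logDeriv (φ - ψ) = logDeriv φ - logDeriv ψ :=
  @LinearMap.map_sub ℂ ℂ LogLaurent LogLaurent _ _ Polynomial.ring.toAddCommGroup
    Polynomial.ring.toAddCommGroup _ _ (RingHom.id ℂ) logDeriv φ ψ

theorem exists_ne_zero_of_finrank_solutions {q : Laurent} (h : Module.finrank ℂ (solutions q) = 2)
    (L : solutions q →ₗ[ℂ] ℂ) : ∃ φ ≠ 0, L φ = 0 := by
  let : AddCommGroup (solutions q) := Module.addCommMonoidToAddCommGroup ℂ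
  have : Module.Finite ℂ (solutions q) := Module.finite_of_finrank_pos (by rw [h]; norm_num)
  obtain ⟨φ, hφL, hφ0⟩ := Submodule.exists_mem_ne_zero_of_ne_bot
    (LinearMap.ker_ne_bot_of_finrank_lt (f := L) (by rw [h, Module.finrank_self]; lia))
  exact ⟨φ, hφ0, hφL⟩

theorem finrank_solutions_eq_two {q : Laurent} {φ ψ : LogLaurent}
    (h : solutions q = Submodule.span ℂ {φ, ψ})
    (hli : ∀ a b : ℂ, a • φ + b • ψ = 0 → a = 0 ∧ b = 0) : Module.finrank ℂ (solutions q) = 2 := by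
  let : AddCommGroup LogLaurent := Module.addCommMonoidToAddCommGroup ℂ
  have : LinearIndependent ℂ ![φ, ψ] := LinearIndependent.pair_iff.mpr hli
  rw [h, ← Matrix.range_cons_cons_empty φ ψ ![], finrank_span_eq_card this, Fintype.card_fin]

theorem smul_eq_C_C_mul (r : ℂ) (φ : LogLaurent) :
    r • φ = Polynomial.C (HahnSeries.C r) * φ := by
  ext1 k
  rw [Polynomial.coeff_smul, Polynomial.coeff_C_mul, smul_eq_C_mul]

theorem neg_one_smul_eq_neg (φ : LogLaurent) : (-1 : ℂ) • φ = -φ := by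
  ext1 k
  rw [Polynomial.coeff_smul, Polynomial.coeff_neg, neg_one_smul]

/-- Two logarithm-free solutions with nonzero Wronskian span all solutions. -/
theorem exists_eq_of_wronskian_ne_zero {q f₁ f₂ : Laurent}
    (h₁ : halfDeriv (halfDeriv f₁) = substSq q * f₁) (h₂ : halfDeriv (halfDeriv f₂) = substSq q * f₂)
    (hw : (f₁ * halfDeriv f₂ - halfDeriv f₁ * f₂).coeff 0 ≠ 0) {φ : LogLaurent}
    (hφ : φ ∈ solutions q) : ∃ a b : ℂ, φ = a • Polynomial.C f₁ + b • Polynomial.C f₂ := by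
  have hwc : f₁ * halfDeriv f₂ - halfDeriv f₁ * f₂ =
      HahnSeries.C ((f₁ * halfDeriv f₂ - halfDeriv f₁ * f₂).coeff 0) := by
    refine eq_C_of_halfDeriv_eq_zero ?_
    rw [map_sub, halfDeriv_mul, halfDeriv_mul, h₁, h₂]
    ring
  set w := (f₁ * halfDeriv f₂ - halfDeriv f₁ * f₂).coeff 0 with hw_def
  -- The Wronskian of `φ` with a logarithm-free solution is constant even if `φ` contains
  -- logarithms. The two resulting linear equations for `φ` and its derivative have determinant `w`,
  -- and Cramer's rule gives `φ`.
  have hW : ∀ f, halfDeriv (halfDeriv f) = substSq q * f → ∃ r : ℂ,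
      Polynomial.C f * logDeriv φ - Polynomial.C (halfDeriv f) * φ =
        Polynomial.C (HahnSeries.C r) := by
    intro f hf
    refine exists_eq_C_of_logDeriv_eq_zero ?_
    rw [logDeriv_sub, logDeriv_C_mul, logDeriv_C_mul, hf, mem_solutions.mp hφ, Polynomial.C_mul]
    ring
  obtain ⟨α, hα⟩ := hW f₁ h₁
  obtain ⟨β, hβ⟩ := hW f₂ h₂
  refine ⟨-(β / w), α / w, ?_⟩
  have hne : Polynomial.C (HahnSeries.C (Γ := ℤ) w) ≠ 0 := by
    rw [Ne, Polynomial.C_eq_zero]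
    exact fun h => hw (HahnSeries.C_injective (h.trans (map_zero _).symm))
  have hdiv : ∀ r : ℂ, Polynomial.C (HahnSeries.C (Γ := ℤ) w) * Polynomial.C (HahnSeries.C (r / w)) =
      Polynomial.C (HahnSeries.C r) := by
    intro r
    rw [← Polynomial.C_mul, ← map_mul, mul_div_cancel₀ _ hw]
  refine mul_left_cancel₀ hne ?_
  rw [smul_eq_C_C_mul, smul_eq_C_C_mul, map_neg, map_neg]
  have hwC := congrArg Polynomial.C hwc
  rw [map_sub, Polynomial.C_mul, Polynomial.C_mul] at hwC
  linear_combination (-φ) * hwC + Polynomial.C f₂ * hα - Polynomial.C f₁ * hβ -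
    (Polynomial.C f₁) * (-hdiv β) - Polynomial.C f₂ * hdiv α

/-! ### Monodromy and the Frobenius solutions. -/

theorem negSubst_coeff (f : Laurent) (n : ℤ) : (negSubst f).coeff n = (-1 : ℂ) ^ n * f.coeff n := rfl

theorem monodromy_C (f : Laurent) : monodromy (Polynomial.C f) = Polynomial.C (negSubst f) := by
  have : Polynomial.lsum (fun k => (Polynomial.monomial k).restrictScalars ℂ ∘ₗ negSubst)
      (Polynomial.C f) = Polynomial.C (negSubst f) := by
    ext1 k
    rw [lsum_monomial_comp_coeff, Polynomial.coeff_C, Polynomial.coeff_C]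
    split_ifs
    · rfl
    · exact map_zero _
  rw [monodromy, LinearMap.comp_apply, this]
  exact Polynomial.taylor_C _ _

theorem taylor_coeff_natDegree_pred {R : Type*} [CommRing R] (r : R) (p : Polynomial R) {N : ℕ}
    (hN : p.natDegree ≤ N + 1) : (Polynomial.taylor r p).coeff (N + 1) = p.coeff (N + 1) ∧
    (Polynomial.taylor r p).coeff N = p.coeff N + ((N : R) + 1) * p.coeff (N + 1) * r := by
  constructor
  · rw [Polynomial.taylor_coeff, Polynomial.eval_eq_sum_range' (n := 1)]
    · simp [Polynomial.hasseDeriv_coeff]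
    · have := Polynomial.natDegree_hasseDeriv_le p (N + 1)
      lia
  · rw [Polynomial.taylor_coeff, Polynomial.eval_eq_sum_range' (n := 2)]
    · rw [Finset.sum_range_succ, Finset.sum_range_one, Polynomial.hasseDeriv_coeff,
        Polynomial.hasseDeriv_coeff, Nat.add_comm 1 N, Nat.choose_succ_self_right]
      simp
    · have := Polynomial.natDegree_hasseDeriv_le p N
      lia

/-- If the top power were `(log t)^{N+1}`, its coefficient would force `σ = (-1)^k` for any exponent
`k` occurring in it. The coefficient of `(log t)^N` then acquires the nonzero extra term `2πi(N +
1)` times it, which the eigenvalue equation does not permit. -/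
theorem natDegree_eq_zero_of_monodromy_eq {σ : ℂ} {φ : LogLaurent} (h : monodromy φ = σ • φ) :
    φ.natDegree = 0 := by
  by_contra hN
  obtain ⟨N, hN⟩ := Nat.exists_eq_succ_of_ne_zero hN
  have hne : φ.coeff (N + 1) ≠ 0 := by
    have : φ ≠ 0 := fun h => by simp [h] at hN
    rw [show N + 1 = φ.natDegree from hN.symm]
    exact Polynomial.leadingCoeff_ne_zero.mpr this
  obtain ⟨k, hk⟩ : ∃ k, (φ.coeff (N + 1)).coeff k ≠ 0 := by
    by_contra! h0
    exact hne (HahnSeries.ext (funext h0))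
  set ψ := Polynomial.lsum (fun k => (Polynomial.monomial k).restrictScalars ℂ ∘ₗ negSubst) φ with hψ
  have hψd : ψ.natDegree ≤ N + 1 := by
    refine Polynomial.natDegree_le_iff_coeff_eq_zero.mpr fun j hj => ?_
    rw [hψ, lsum_monomial_comp_coeff, Polynomial.coeff_eq_zero_of_natDegree_lt (by lia), map_zero]
  obtain ⟨ht₁, ht₂⟩ := taylor_coeff_natDegree_pred
    (HahnSeries.C (2 * Real.pi * Complex.I) : Laurent) ψ hψd
  have hm : Polynomial.taylor (HahnSeries.C (2 * Real.pi * Complex.I) : Laurent) ψ = σ • φ := h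
  rw [hm, hψ, lsum_monomial_comp_coeff, Polynomial.coeff_smul] at ht₁
  rw [hm, hψ, lsum_monomial_comp_coeff, lsum_monomial_comp_coeff, Polynomial.coeff_smul] at ht₂
  have e₁ := congrArg (fun f : Laurent => f.coeff k) ht₁
  have e₂ := congrArg (fun f : Laurent => f.coeff k) ht₂
  simp only [HahnSeries.coeff_smul, smul_eq_mul, negSubst_coeff, HahnSeries.coeff_add] at e₁ e₂
  rw [mul_comm ((N : Laurent) + 1), mul_comm _ (HahnSeries.C _), C_mul_coeff, natCast_coeff_mul,
    negSubst_coeff] at e₂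
  have hσ : σ = (-1) ^ k := mul_right_cancel₀ hk e₁
  rw [hσ, left_eq_add] at e₂
  refine absurd e₂ (mul_ne_zero Complex.two_pi_I_ne_zero (mul_ne_zero (mul_ne_zero ?_ hk) ?_))
  · exact zpow_ne_zero _ (by norm_num)
  · exact_mod_cast N.succ_ne_zero

theorem negSubst_tpow_mul_substSq (d : ℤ) (A : Laurent) :
    negSubst (tpow d * substSq A) = (-1 : ℂ) ^ d • (tpow d * substSq A) := by
  ext n
  rw [negSubst_coeff, HahnSeries.coeff_smul, smul_eq_mul, tpow_mul_coeff]
  rcases Int.even_or_odd (n - d) with h | h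
  · rw [show n = d + (n - d) by lia, zpow_add₀ (by norm_num), h.neg_one_zpow, mul_one]
  · rw [substSq_coeff_odd _ h, mul_zero, mul_zero]

theorem tpow_mul_substSq_ofSeq_coeff_self (d : ℤ) (a : ℕ → ℂ) :
    (tpow d * substSq (ofSeq a)).coeff d = a 0 := by
  rw [tpow_mul_coeff, sub_self, ← mul_zero (2 : ℤ), substSq_coeff_two_mul]
  exact ofSeq_coeff_nat a 0

theorem tpow_mul_substSq_ofSeq_coeff_lt (d : ℤ) (a : ℕ → ℂ) {n : ℤ} (hn : n < d) :
    (tpow d * substSq (ofSeq a)).coeff n = 0 := by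
  rw [tpow_mul_coeff]
  rcases Int.even_or_odd' (n - d) with ⟨k, h | h⟩
  · rw [h, substSq_coeff_two_mul, ofSeq_coeff_neg _ (by lia)]
  · rw [substSq_coeff_odd _ ⟨k, h⟩]

theorem hasMonodromy_of_frobSol {m : ℕ} {q : Laurent} (hq : ∀ n < (-2 : ℤ), q.coeff n = 0)
    (hq₂ : q.coeff (-2) = (m : ℂ) * ((m : ℂ) + 2) / 4) {a : ℕ → ℂ} (ha₀ : a 0 = 1)
    (ha : IsFrobSol (-(m : ℂ)) q (ofSeq a)) : HasMonodromyPlusMinusOne q := by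
  obtain ⟨b, hb₀, hb⟩ := exists_frobSol_high hq hq₂
  rw [show (-(m : ℂ)) = ((-(m : ℤ) : ℤ) : ℂ) by push_cast; rfl, isFrobSol_iff_halfDeriv] at ha
  rw [show ((m : ℂ) + 2) = (((m : ℤ) + 2 : ℤ) : ℂ) by push_cast; rfl, isFrobSol_iff_halfDeriv] at hb
  have hf₁ := negSubst_tpow_mul_substSq (-(m : ℤ)) (ofSeq a)
  have hf₂ := negSubst_tpow_mul_substSq ((m : ℤ) + 2) (ofSeq b)
  have hs : ((-1 : ℂ) ^ ((m : ℤ) + 2)) = (-1 : ℂ) ^ (-(m : ℤ)) := by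
    rw [show (m : ℤ) + 2 = -(m : ℤ) + 2 * (m + 1) by ring, zpow_add₀ (by norm_num),
      (even_two_mul _).neg_one_zpow, mul_one]
  rw [hs] at hf₂
  have c₁ := tpow_mul_substSq_ofSeq_coeff_self (-(m : ℤ)) a
  have c₂ := tpow_mul_substSq_ofSeq_coeff_self ((m : ℤ) + 2) b
  have z₁ := fun n (hn : n < -(m : ℤ)) => tpow_mul_substSq_ofSeq_coeff_lt (-(m : ℤ)) a hn
  have z₂ := fun n (hn : n < (m : ℤ) + 2) => tpow_mul_substSq_ofSeq_coeff_lt ((m : ℤ) + 2) b hn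
  rw [ha₀] at c₁
  rw [hb₀] at c₂
  generalize tpow (-(m : ℤ)) * substSq (ofSeq a) = f₁ at *
  generalize tpow ((m : ℤ) + 2) * substSq (ofSeq b) = f₂ at *
  -- The leading coefficient of the Wronskian is the difference `m + 1` of the exponents.
  have hw : (f₁ * halfDeriv f₂ - halfDeriv f₁ * f₂).coeff 0 ≠ 0 := by
    have e₁ := coeff_mul_eq_sum (g := halfDeriv f₂) (b := m) z₁
      (fun n hn => by rw [halfDeriv_coeff, z₂ _ (by lia), mul_zero]) 0
    have e₂ := coeff_mul_eq_sum (f := halfDeriv f₁) (a := -(m : ℤ) - 2)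
      (fun n hn => by rw [halfDeriv_coeff, z₁ _ (by lia), mul_zero]) z₂ 0
    rw [show -(m : ℤ) + m + (0 : ℕ) = 0 by lia] at e₁
    rw [show -(m : ℤ) - 2 + (m + 2) + (0 : ℕ) = 0 by lia] at e₂
    rw [HahnSeries.coeff_sub, e₁, e₂]
    simp only [zero_add, Finset.sum_range_one, Nat.sub_self, Nat.cast_zero, add_zero, halfDeriv_coeff,
      sub_add_cancel, c₁, c₂]
    push_cast
    have : (1 : ℂ) * (((m : ℂ) + 2) / 2 * 1) - (-(m : ℂ) - 2 + 2) / 2 * 1 * 1 = m + 1 := by ring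
    rw [this]
    exact_mod_cast m.succ_ne_zero
  have hspan : solutions q = Submodule.span ℂ {Polynomial.C f₁, Polynomial.C f₂} := by
    refine le_antisymm (fun φ hφ => ?_) (Submodule.span_le.mpr ?_)
    · obtain ⟨α, β, rfl⟩ := exists_eq_of_wronskian_ne_zero ha hb hw hφ
      exact Submodule.mem_span_pair.mpr ⟨α, β, rfl⟩
    · rintro _ (rfl | rfl)
      · exact C_mem_solutions.mpr ha
      · exact C_mem_solutions.mpr hb
  have hli : ∀ α β : ℂ, α • Polynomial.C f₁ + β • Polynomial.C f₂ = 0 → α = 0 ∧ β = 0 := by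
    intro α β h
    have h' := congrArg (fun φ : LogLaurent => φ.coeff 0) h
    simp only [Polynomial.coeff_add, Polynomial.coeff_smul, Polynomial.coeff_C_zero,
      Polynomial.coeff_zero] at h'
    have hα : α = 0 := by
      have := congrArg (fun f : Laurent => f.coeff (-(m : ℤ))) h'
      simpa [c₁, z₂ (-(m : ℤ)) (by lia)] using this
    have hβ : β = 0 := by
      have := congrArg (fun f : Laurent => f.coeff ((m : ℤ) + 2)) h'
      simpa [hα, c₂] using this
    exact ⟨hα, hβ⟩
  refine ⟨finrank_solutions_eq_two hspan hli, ?_⟩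
  have hmon : ∀ φ ∈ solutions q, monodromy φ = (-1 : ℂ) ^ (-(m : ℤ)) • φ := by
    intro φ hφ
    obtain ⟨α, β, rfl⟩ := exists_eq_of_wronskian_ne_zero ha hb hw hφ
    rw [map_add, map_smul, map_smul, monodromy_C, monodromy_C, hf₁, hf₂]
    simp only [smul_eq_C_C_mul, smul_eq_C_mul, Polynomial.C_mul]
    ring
  rcases neg_one_pow_eq_or ℂ m with h | h
  · refine Or.inl fun φ hφ => ?_
    rw [hmon φ hφ, zpow_neg, zpow_natCast, h, inv_one, one_smul]
  · refine Or.inr fun φ hφ => ?_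
    rw [hmon φ hφ, zpow_neg, zpow_natCast, h, inv_neg, inv_one, neg_one_smul_eq_neg]

theorem exists_frobSol_of_hasMonodromy {m : ℕ} {q : Laurent} (hq : ∀ n < (-2 : ℤ), q.coeff n = 0)
    (hq₂ : q.coeff (-2) = (m : ℂ) * ((m : ℂ) + 2) / 4) (h : HasMonodromyPlusMinusOne q) :
    ∃ a : ℕ → ℂ, a 0 = 1 ∧ IsFrobSol (-(m : ℂ)) q (ofSeq a) := by
  obtain ⟨hdim, hmon⟩ := h
  obtain ⟨σ, hσ⟩ : ∃ σ : ℂ, ∀ φ ∈ solutions q, monodromy φ = σ • φ := by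
    rcases hmon with h | h
    · exact ⟨1, fun φ hφ => by rw [h φ hφ, one_smul]⟩
    · exact ⟨-1, fun φ hφ => by rw [h φ hφ, neg_one_smul_eq_neg]⟩
  -- A nonzero solution in the kernel of this functional cannot start at `s^{m+2} = t^{m/2+1}`, so
  -- the indicial equation leaves only the exponent `-m/2`.
  let L : solutions q →ₗ[ℂ] ℂ :=
    { toFun := fun φ => ((φ : LogLaurent).coeff 0).coeff ((m : ℤ) + 2)
      map_add' := fun φ ψ => by simp
      map_smul' := fun r φ => by simp }
  obtain ⟨⟨φ, hφ⟩, hφ0, hφL⟩ := exists_ne_zero_of_finrank_solutions hdim L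
  have hL : (φ.coeff 0).coeff ((m : ℤ) + 2) = 0 := hφL
  obtain ⟨f, rfl⟩ : ∃ f, φ = Polynomial.C f :=
    ⟨_, Polynomial.eq_C_of_natDegree_eq_zero (natDegree_eq_zero_of_monodromy_eq (hσ φ hφ))⟩
  rw [Polynomial.coeff_C_zero] at hL
  have hm := hσ _ hφ
  have hf0 : f ≠ 0 := by
    rintro rfl
    exact hφ0 (Subtype.ext (map_zero Polynomial.C))
  rw [C_mem_solutions] at hφ
  rw [monodromy_C, Polynomial.smul_C] at hm
  have hm' := Polynomial.C_injective hm
  have hd := HahnSeries.coeff_order_eq_zero.not.mpr hf0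
  have hlt : ∀ n < f.order, f.coeff n = 0 := fun n hn => HahnSeries.coeff_eq_zero_of_lt_order hn
  set d := f.order with hd_def
  have hind : ((d : ℂ) + m) * ((d : ℂ) - (m + 2)) = 0 := by
    have e := congrArg (fun g : Laurent => g.coeff (-4 + d)) hφ
    simp only [halfDeriv_coeff] at e
    have e₂ := coeff_mul_eq_sum (f := substSq q) (a := -4) (fun n hn => by
      rcases Int.even_or_odd' n with ⟨k, rfl | rfl⟩
      · rw [substSq_coeff_two_mul, hq _ (by lia)]
      · rw [substSq_coeff_odd _ ⟨k, rfl⟩]) hlt 0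
    simp only [zero_add, Finset.sum_range_one, Nat.sub_self, Nat.cast_zero, add_zero] at e₂
    rw [e₂, show (-4 : ℤ) = 2 * (-2) by norm_num, substSq_coeff_two_mul, hq₂,
      show 2 * (-2) + d + 2 + 2 = d by lia] at e
    push_cast at e
    refine mul_right_cancel₀ hd ?_
    linear_combination 4 * e
  have hdm : d = -(m : ℤ) := by
    rcases mul_eq_zero.mp hind with h | h
    · exact eq_neg_of_add_eq_zero_left (by exact_mod_cast h)
    · refine absurd hL ?_
      rw [← show d = (m : ℤ) + 2 from sub_eq_zero.mp (by exact_mod_cast h)]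
      exact hd
  have hσd : σ = (-1) ^ d := by
    have e := congrArg (fun g : Laurent => g.coeff d) hm'
    simp only [negSubst_coeff, HahnSeries.coeff_smul, smul_eq_mul] at e
    exact (mul_right_cancel₀ hd e).symm
  -- An eigenvector of `s ↦ -s` contains only exponents of one parity, so `f` is `s^d` times a
  -- series in `t`.
  have hodd : ∀ n, Odd n → f.coeff (d + n) = 0 := by
    intro n hn
    have e := congrArg (fun g : Laurent => g.coeff (d + n)) hm'
    simp only [negSubst_coeff, HahnSeries.coeff_smul, smul_eq_mul] at e
    rw [zpow_add₀ (by norm_num), hn.neg_one_zpow, ← hσd] at e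
    have hσ0 : σ ≠ 0 := by rw [hσd]; exact zpow_ne_zero _ (by norm_num)
    have : 2 * σ * f.coeff (d + n) = 0 := by linear_combination -e
    exact (mul_eq_zero.mp this).resolve_left (mul_ne_zero two_ne_zero hσ0)
  set c := f.coeff d with hc
  refine ⟨fun n => c⁻¹ * f.coeff (d + 2 * n), ?_, ?_⟩
  · beta_reduce
    rw [Nat.cast_zero, mul_zero, add_zero, ← hc, inv_mul_cancel₀ hd]
  · have hfa : tpow d * substSq (ofSeq fun n => c⁻¹ * f.coeff (d + 2 * n)) = c⁻¹ • f := by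
      ext n
      rw [tpow_mul_coeff, HahnSeries.coeff_smul, smul_eq_mul]
      rcases Int.even_or_odd' (n - d) with ⟨k, h | h⟩
      · rw [h, substSq_coeff_two_mul]
        rcases lt_or_ge k 0 with hk | hk
        · rw [ofSeq_coeff_neg _ hk, hlt n (by lia), mul_zero]
        · obtain ⟨j, rfl⟩ := Int.eq_ofNat_of_zero_le hk
          rw [ofSeq_coeff_nat, show d + 2 * (j : ℤ) = n by lia]
      · rw [substSq_coeff_odd _ ⟨k, h⟩, show n = d + (n - d) by lia, hodd _ ⟨k, h⟩, mul_zero]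
    rw [show (-(m : ℂ)) = ((d : ℤ) : ℂ) by rw [hdm]; push_cast; rfl, isFrobSol_iff_halfDeriv, hfa,
      map_smul, map_smul, hφ, mul_smul_comm]

open UniversalEnvelopingAlgebra (ι)

/-! ### Modules over the enveloping algebra in terms of modes -/

section Coeff

/-- The coefficients of `f` vanish in degrees below `N`. -/
def VanishesBelow (N : ℤ) (f : Laurent) : Prop := ∀ n < N, f.coeff n = 0

theorem exists_vanishesBelow (f : Laurent) : ∃ N, VanishesBelow N f :=
  ⟨f.order, fun _ hn => HahnSeries.coeff_eq_zero_of_lt_order hn⟩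

theorem VanishesBelow.mono {M N : ℤ} {f : Laurent} (hf : VanishesBelow N f) (h : M ≤ N) :
    VanishesBelow M f := fun n hn => hf n (lt_of_lt_of_le hn h)

theorem VanishesBelow.mul {M N : ℤ} {f g : Laurent} (hf : VanishesBelow M f)
    (hg : VanishesBelow N g) : VanishesBelow (M + N) (f * g) := fun _ hn => coeff_mul_eq_zero hf hg hn

theorem VanishesBelow.sub {N : ℤ} {f g : Laurent} (hf : VanishesBelow N f)
    (hg : VanishesBelow N g) : VanishesBelow N (f - g) := fun n hn => by
  rw [HahnSeries.coeff_sub, hf n hn, hg n hn, sub_zero]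

theorem VanishesBelow.two_mul {N : ℤ} {f : Laurent} (hf : VanishesBelow N f) :
    VanishesBelow N (2 * f) := fun n hn => by
  rw [_root_.two_mul, HahnSeries.coeff_add, hf n hn, add_zero]

theorem VanishesBelow.ddt {N : ℤ} {f : Laurent} (hf : VanishesBelow N f) :
    VanishesBelow (N - 1) (ddt f) := fun n hn => by rw [ddt_coeff, hf _ (by lia), mul_zero]

theorem vanishesBelow_zero (N : ℤ) : VanishesBelow N 0 := fun _ _ => rfl

theorem tpow_coeff (d n : ℤ) : (tpow d).coeff n = if n = d then 1 else 0 := by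
  rw [tpow, HahnSeries.coeff_single]
  by_cases h : n = d
  · rw [if_pos h, if_pos h]
  · rw [if_neg h, if_neg h]

theorem vanishesBelow_tpow (d : ℤ) : VanishesBelow d (tpow d) := fun n hn => by
  rw [tpow_coeff, if_neg hn.ne]

theorem res_zero : res 0 = 0 := rfl

/-- The part of `f` in degrees `a ≤ n < N`. -/
def window (a N : ℤ) (f : Laurent) : Laurent := ∑ n ∈ Finset.Ico a N, f.coeff n • tpow n

theorem window_coeff (a N : ℤ) (f : Laurent) (k : ℤ) :
    (window a N f).coeff k = if a ≤ k ∧ k < N then f.coeff k else 0 := by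
  rw [window, HahnSeries.coeff_sum]
  simp only [HahnSeries.coeff_smul, tpow_coeff, smul_eq_mul, mul_ite, mul_one, mul_zero]
  rw [Finset.sum_ite_eq]
  simp only [Finset.mem_Ico]

theorem VanishesBelow.sub_window {a : ℤ} {f : Laurent} (hf : VanishesBelow a f) (N : ℤ) :
    VanishesBelow N (f - window a N f) := fun n hn => by
  rw [HahnSeries.coeff_sub, window_coeff]
  split_ifs with h
  · rw [sub_self]
  · rw [hf n (by lia), sub_zero]

end Coeff

section UMod

attribute [local instance] LieRing.ofAssociativeRing

theorem ι_lie_smul {M : Type*} [AddCommGroup M] [Module U M] (x y : AffineSl2) (w : M) :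
    ι ℂ x • ι ℂ y • w = ι ℂ y • ι ℂ x • w + ι ℂ ⁅x, y⁆ • w := by
  rw [LieHom.map_lie, Ring.lie_def, sub_smul, mul_smul, mul_smul]
  abel

theorem eMode_smul {M : Type*} [AddCommGroup M] [Module U M] (n : ℤ) (w : M) :
    eMode n • w = ι ℂ (⟨tpow n, 0, 0, 0⟩ : AffineSl2) • w := rfl

theorem hMode_smul {M : Type*} [AddCommGroup M] [Module U M] (n : ℤ) (w : M) :
    hMode n • w = ι ℂ (⟨0, tpow n, 0, 0⟩ : AffineSl2) • w := rfl

theorem fMode_smul {M : Type*} [AddCommGroup M] [Module U M] (n : ℤ) (w : M) :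
    fMode n • w = ι ℂ (⟨0, 0, tpow n, 0⟩ : AffineSl2) • w := rfl

theorem ι_smul_eq_zero {M : Type*} [AddCommGroup M] [Module U M] {x : AffineSl2} (hx : x = 0)
    (w : M) : ι ℂ x • w = 0 := by rw [hx, map_zero, zero_smul]

variable {M : Type*} [AddCommGroup M] [Module ℂ M] [Module U M] [IsScalarTower ℂ U M]

theorem algebraMap_smul' (r : ℂ) (w : M) : algebraMap ℂ U r • w = r • w := algebraMap_smul U r w

theorem smul_mem_of_ι_smul_mem {p : Submodule ℂ M} (hp : ∀ x : AffineSl2, ∀ w ∈ p, ι ℂ x • w ∈ p) (u : U)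
    {w : M} (hw : w ∈ p) : u • w ∈ p := by
  obtain ⟨t, rfl⟩ : ∃ t, UniversalEnvelopingAlgebra.mkAlgHom ℂ AffineSl2 t = u :=
    Quotient.exists_rep u
  induction t using TensorAlgebra.induction generalizing w with
  | algebraMap r =>
    rw [AlgHom.commutes, algebraMap_smul']
    exact p.smul_mem r hw
  | ι x => exact hp x w hw
  | mul a b iha ihb =>
    rw [map_mul, mul_smul]
    exact iha (ihb hw)
  | add a b iha ihb =>
    rw [map_add, add_smul]
    exact p.add_mem (iha hw) (ihb hw)

theorem eq_top_of_ι_smul_mem {v : M} (hgen : Submodule.span U {v} = ⊤) {p : Submodule ℂ M} (hv : v ∈ p)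
    (hp : ∀ x : AffineSl2, ∀ w ∈ p, ι ℂ x • w ∈ p) : p = ⊤ := by
  refine Submodule.eq_top_iff'.mpr fun w => ?_
  have hw : w ∈ Submodule.span U {v} := hgen ▸ Submodule.mem_top
  obtain ⟨u, rfl⟩ := Submodule.mem_span_singleton.mp hw
  exact smul_mem_of_ι_smul_mem hp u hv

/-- `v` generates `M` and the Borel subalgebra acts on it by the character with `λ(H ⊗ 1) = χ` and
`λ(K) = -2`. -/
structure IsHighestWeightVector (χ : ℂ) (v : M) : Prop where
  span_eq_top : Submodule.span U {v} = ⊤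
  smul_eq : ∀ x ∈ borel, ι ℂ x • v = (χ * x.h.coeff 0 + -2 * x.c) • v

variable {χ : ℂ} {v : M}

theorem IsHighestWeightVector.central_smul (hv : IsHighestWeightVector χ v) (c : ℂ) (w : M) :
    ι ℂ (⟨0, 0, 0, c⟩ : AffineSl2) • w = (-2 * c) • w := by
  let p : Submodule ℂ M :=
    { carrier := {w | ι ℂ (⟨0, 0, 0, c⟩ : AffineSl2) • w = (-2 * c) • w}
      zero_mem' := by simp
      add_mem' := fun {a b} ha hb => by
        simp only [Set.mem_ofPred_eq] at ha hb ⊢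
        rw [smul_add, smul_add, ha, hb]
      smul_mem' := fun r a ha => by
        simp only [Set.mem_ofPred_eq] at ha ⊢
        rw [smul_comm, ha, smul_comm] }
  have hp : p = ⊤ := by
    refine eq_top_of_ι_smul_mem hv.span_eq_top (p := p) ?_ fun x w hw => ?_
    · have := hv.smul_eq ⟨0, 0, 0, c⟩ ⟨fun _ _ => rfl, fun _ _ => rfl, fun _ _ => rfl⟩
      simpa [p] using this
    · have hw' : ι ℂ (⟨0, 0, 0, c⟩ : AffineSl2) • w = (-2 * c) • w := hw
      change ι ℂ (⟨0, 0, 0, c⟩ : AffineSl2) • ι ℂ x • w = (-2 * c) • ι ℂ x • w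
      have h0 : ⁅(⟨0, 0, 0, c⟩ : AffineSl2), x⁆ = 0 := by
        ext1
        · simp
        · simp
        · simp
        · simp only [AffineSl2.lie_c, AffineSl2.cocycle, map_zero, zero_mul, mul_zero, add_zero,
            res_zero, AffineSl2.zero_c]
      rw [ι_lie_smul, hw', ι_smul_eq_zero h0, add_zero, smul_comm]
  have : w ∈ p := hp ▸ Submodule.mem_top
  exact this

theorem cocycle_eq_zero {x y : AffineSl2} {a N : ℤ} (hN : 0 < N - 1 + a)
    (hx : VanishesBelow N x.e ∧ VanishesBelow N x.h ∧ VanishesBelow N x.f)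
    (hy : VanishesBelow a y.e ∧ VanishesBelow a y.h ∧ VanishesBelow a y.f) :
    AffineSl2.cocycle x y = 0 := by
  obtain ⟨x₁, x₂, x₃⟩ := hx
  obtain ⟨y₁, y₂, y₃⟩ := hy
  rw [AffineSl2.cocycle, res, HahnSeries.coeff_add, HahnSeries.coeff_add, x₁.ddt.mul y₃ _ (by lia),
    x₃.ddt.mul y₁ _ (by lia), (x₂.ddt.mul y₂).two_mul _ (by lia), add_zero, add_zero]

/-- Every vector is annihilated by `sl₂ ⊗ t^N ℂ[[t]]` for `N` large. -/
theorem IsHighestWeightVector.exists_annihilator (hv : IsHighestWeightVector χ v) (w : M) :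
    ∃ N : ℤ, ∀ x : AffineSl2, VanishesBelow N x.e → VanishesBelow N x.h → VanishesBelow N x.f →
      x.c = 0 → ι ℂ x • w = 0 := by
  let p : Submodule ℂ M :=
    { carrier := {w | ∃ N : ℤ, ∀ x : AffineSl2, VanishesBelow N x.e → VanishesBelow N x.h →
        VanishesBelow N x.f → x.c = 0 → ι ℂ x • w = 0}
      zero_mem' := ⟨0, fun x _ _ _ _ => smul_zero _⟩
      add_mem' := fun {a b} ⟨N₁, h₁⟩ ⟨N₂, h₂⟩ => ⟨max N₁ N₂, fun x he hh hf hc => by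
        rw [smul_add, h₁ x (he.mono (le_max_left _ _)) (hh.mono (le_max_left _ _))
          (hf.mono (le_max_left _ _)) hc, h₂ x (he.mono (le_max_right _ _))
          (hh.mono (le_max_right _ _)) (hf.mono (le_max_right _ _)) hc, add_zero]⟩
      smul_mem' := fun r a ⟨N, h⟩ => ⟨N, fun x he hh hf hc => by
        rw [smul_comm, h x he hh hf hc, smul_zero]⟩ }
  have hp : p = ⊤ := by
    refine eq_top_of_ι_smul_mem hv.span_eq_top (p := p) ⟨1, fun x he hh hf hc => ?_⟩ ?_
    · rw [hv.smul_eq x ⟨fun n hn => he n (by lia), fun n hn => hh n (by lia),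
        fun n hn => hf n (by lia)⟩, hh 0 (by lia), hc, mul_zero, mul_zero, add_zero, zero_smul]
    · rintro y w ⟨N, hN⟩
      obtain ⟨a₁, h₁⟩ := exists_vanishesBelow y.e
      obtain ⟨a₂, h₂⟩ := exists_vanishesBelow y.h
      obtain ⟨a₃, h₃⟩ := exists_vanishesBelow y.f
      have y₁ := h₁.mono (show min a₁ (min a₂ a₃) ≤ a₁ by lia)
      have y₂ := h₂.mono (show min a₁ (min a₂ a₃) ≤ a₂ by lia)
      have y₃ := h₃.mono (show min a₁ (min a₂ a₃) ≤ a₃ by lia)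
      generalize min a₁ (min a₂ a₃) = a at y₁ y₂ y₃
      -- The bound `N - a` puts the components of the bracket with `y` in `t^N ℂ[[t]]`, and `2 - a`
      -- makes the cocycle vanish.
      refine ⟨max N (max (N - a) (2 - a)), fun x he hh hf hc => ?_⟩
      rw [ι_lie_smul, hN x (he.mono (by lia)) (hh.mono (by lia)) (hf.mono (by lia)) hc, smul_zero,
        zero_add]
      refine hN _ ?_ ?_ ?_ (cocycle_eq_zero (a := a) (by lia) ⟨he, hh, hf⟩ ⟨y₁, y₂, y₃⟩)
      · exact (((hh.mul y₁).sub (he.mul y₂)).two_mul).mono (by lia)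
      · exact ((he.mul y₃).sub (hf.mul y₁)).mono (by lia)
      · exact (((hf.mul y₂).sub (hh.mul y₃)).two_mul).mono (by lia)
  have : w ∈ p := hp ▸ Submodule.mem_top
  exact this

theorem res_ddt_tpow_mul_tpow (a b : ℤ) :
    res (ddt (tpow a) * tpow b) = if a + b = 0 then (a : ℂ) else 0 := by
  rw [ddt_tpow, mul_assoc, ← tpow_add, res, C_mul_coeff, tpow_coeff]
  by_cases h : a + b = 0
  · rw [if_pos h, if_pos (by lia), mul_one]
  · rw [if_neg h, if_neg (by lia), mul_zero]

theorem IsHighestWeightVector.smul_split (hv : IsHighestWeightVector χ v) (x : AffineSl2) (w : M) :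
    ι ℂ x • w = ι ℂ (⟨x.e, x.h, x.f, 0⟩ : AffineSl2) • w + (-2 * x.c) • w := by
  rw [← hv.central_smul, ← add_smul, ← map_add]
  congr 2
  ext1 <;> simp

theorem ι_smul_e (r : ℂ) (a : Laurent) (w : M) : ι ℂ (⟨r • a, 0, 0, 0⟩ : AffineSl2) • w =
    r • ι ℂ (⟨a, 0, 0, 0⟩ : AffineSl2) • w := by
  rw [← smul_assoc, ← map_smul]
  congr 2
  ext1 <;> simp

theorem ι_smul_h (r : ℂ) (a : Laurent) (w : M) : ι ℂ (⟨0, r • a, 0, 0⟩ : AffineSl2) • w =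
    r • ι ℂ (⟨0, a, 0, 0⟩ : AffineSl2) • w := by
  rw [← smul_assoc, ← map_smul]
  congr 2
  ext1 <;> simp

theorem ι_smul_f (r : ℂ) (a : Laurent) (w : M) : ι ℂ (⟨0, 0, r • a, 0⟩ : AffineSl2) • w =
    r • ι ℂ (⟨0, 0, a, 0⟩ : AffineSl2) • w := by
  rw [← smul_assoc, ← map_smul]
  congr 2
  ext1 <;> simp

/-- The action of the modes on a highest weight module of level `-2`. -/
def IsHighestWeightVector.modeRep (hv : IsHighestWeightVector χ v) : ModeRep M where
  e n := Algebra.lsmul ℂ ℂ M (eMode n)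
  h n := Algebra.lsmul ℂ ℂ M (hMode n)
  f n := Algebra.lsmul ℂ ℂ M (fMode n)
  e_smooth w := (hv.exists_annihilator w).imp fun _ hN n hn =>
    hN ⟨tpow n, 0, 0, 0⟩ ((vanishesBelow_tpow n).mono hn) (vanishesBelow_zero _)
      (vanishesBelow_zero _) rfl
  h_smooth w := (hv.exists_annihilator w).imp fun _ hN n hn =>
    hN ⟨0, tpow n, 0, 0⟩ (vanishesBelow_zero _) ((vanishesBelow_tpow n).mono hn)
      (vanishesBelow_zero _) rfl
  f_smooth w := (hv.exists_annihilator w).imp fun _ hN n hn =>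
    hN ⟨0, 0, tpow n, 0⟩ (vanishesBelow_zero _) (vanishesBelow_zero _)
      ((vanishesBelow_tpow n).mono hn) rfl
  ee a b w := by
    simp only [Algebra.lsmul_coe, eMode_smul]
    rw [ι_lie_smul, ι_smul_eq_zero (x := ⁅_, _⁆), add_zero]
    ext1 <;> simp [AffineSl2.cocycle, res]
  ff a b w := by
    simp only [Algebra.lsmul_coe, fMode_smul]
    rw [ι_lie_smul, ι_smul_eq_zero (x := ⁅_, _⁆), add_zero]
    ext1 <;> simp [AffineSl2.cocycle, res]
  he a b w := by
    simp only [Algebra.lsmul_coe, eMode_smul, hMode_smul]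
    rw [ι_lie_smul, ← ι_smul_e]
    congr 3
    ext1
    · simp only [AffineSl2.lie_e, mul_zero, sub_zero, tpow_add, smul_eq_C_mul]
      rw [map_ofNat]
    all_goals simp [AffineSl2.cocycle, res]
  hf a b w := by
    simp only [Algebra.lsmul_coe, fMode_smul, hMode_smul]
    rw [ι_lie_smul, sub_eq_add_neg, ← neg_smul, ← ι_smul_f]
    congr 3
    ext1
    rotate_left 2
    · simp only [AffineSl2.lie_f, mul_zero, zero_sub, tpow_add, smul_eq_C_mul]
      rw [map_neg, map_ofNat]
      ring
    all_goals simp [AffineSl2.cocycle, res]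
  ef a b w := by
    simp only [Algebra.lsmul_coe, fMode_smul, hMode_smul, eMode_smul]
    rw [ι_lie_smul, hv.smul_split ⁅_, _⁆, add_assoc]
    congr 2
    · congr 2
      ext1 <;> simp [tpow_add]
    · simp only [AffineSl2.lie_c, AffineSl2.cocycle, map_zero, mul_zero, add_zero,
        res_ddt_tpow_mul_tpow, mul_ite]
  hh a b w := by
    simp only [Algebra.lsmul_coe, hMode_smul]
    have h0 : (⟨⁅(⟨0, tpow a, 0, 0⟩ : AffineSl2), (⟨0, tpow b, 0, 0⟩ : AffineSl2)⁆.e,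
        ⁅(⟨0, tpow a, 0, 0⟩ : AffineSl2), (⟨0, tpow b, 0, 0⟩ : AffineSl2)⁆.h,
        ⁅(⟨0, tpow a, 0, 0⟩ : AffineSl2), (⟨0, tpow b, 0, 0⟩ : AffineSl2)⁆.f, 0⟩ : AffineSl2) = 0 := by
      ext1 <;> simp
    rw [ι_lie_smul, hv.smul_split ⁅_, _⁆, ι_smul_eq_zero h0, zero_add]
    congr 2
    simp only [AffineSl2.lie_c, AffineSl2.cocycle, map_zero, zero_mul, zero_add, two_mul,
      AffineSl2.res_add, res_ddt_tpow_mul_tpow]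
    split_ifs <;> ring

/-- On a given vector only finitely many coefficients of a Laurent series act nontrivially, so
stability under the modes already gives stability under the whole affine algebra. -/
theorem IsHighestWeightVector.eq_top_of_modes (hv : IsHighestWeightVector χ v) {p : Submodule ℂ M}
    (hvp : v ∈ p) (he : ∀ n, ∀ w ∈ p, eMode n • w ∈ p) (hh : ∀ n, ∀ w ∈ p, hMode n • w ∈ p)
    (hf : ∀ n, ∀ w ∈ p, fMode n • w ∈ p) : p = ⊤ := by
  refine eq_top_of_ι_smul_mem hv.span_eq_top hvp fun x w hw => ?_
  obtain ⟨N, hN⟩ := hv.exists_annihilator w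
  obtain ⟨a, ha⟩ := exists_vanishesBelow x.e
  obtain ⟨b, hb⟩ := exists_vanishesBelow x.h
  obtain ⟨c, hc⟩ := exists_vanishesBelow x.f
  have hsum : ∀ (s : Finset ℤ) (g : ℤ → AffineSl2), (∀ n, ι ℂ (g n) • w ∈ p) →
      ι ℂ (∑ n ∈ s, g n) • w ∈ p := by
    intro s g hg
    rw [map_sum, Finset.sum_smul]
    exact p.sum_mem fun n _ => hg n
  let ie : Laurent →+ AffineSl2 := ⟨⟨fun f => ⟨f, 0, 0, 0⟩, rfl⟩, fun f g => by ext1 <;> simp⟩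
  let ih : Laurent →+ AffineSl2 := ⟨⟨fun f => ⟨0, f, 0, 0⟩, rfl⟩, fun f g => by ext1 <;> simp⟩
  let jf : Laurent →+ AffineSl2 := ⟨⟨fun f => ⟨0, 0, f, 0⟩, rfl⟩, fun f g => by ext1 <;> simp⟩
  have h₁ : ι ℂ (ie (window a N x.e)) • w ∈ p := by
    rw [window, map_sum]
    exact hsum _ _ fun n => (ι_smul_e _ (tpow n) w).symm ▸ p.smul_mem _ (he n w hw)
  have h₂ : ι ℂ (ih (window b N x.h)) • w ∈ p := by
    rw [window, map_sum]
    exact hsum _ _ fun n => (ι_smul_h _ (tpow n) w).symm ▸ p.smul_mem _ (hh n w hw)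
  have h₃ : ι ℂ (jf (window c N x.f)) • w ∈ p := by
    rw [window, map_sum]
    exact hsum _ _ fun n => (ι_smul_f _ (tpow n) w).symm ▸ p.smul_mem _ (hf n w hw)
  have h₄ := hN ⟨x.e - window a N x.e, x.h - window b N x.h, x.f - window c N x.f, 0⟩
    (ha.sub_window N) (hb.sub_window N) (hc.sub_window N) rfl
  have hx : (⟨x.e, x.h, x.f, 0⟩ : AffineSl2) = ⟨window a N x.e, 0, 0, 0⟩ +
      ⟨0, window b N x.h, 0, 0⟩ + ⟨0, 0, window c N x.f, 0⟩ +
        ⟨x.e - window a N x.e, x.h - window b N x.h, x.f - window c N x.f, 0⟩ := by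
    ext1 <;> simp
  rw [hv.smul_split, hx, map_add, map_add, map_add, add_smul, add_smul, add_smul, h₄, add_zero]
  exact p.add_mem (p.add_mem (p.add_mem h₁ h₂) h₃) (p.smul_mem _ hw)

theorem hasFinsum_sugawaraTerm (R : ModeRep M) (he : ∀ n w, R.e n w = eMode n • w)
    (hh : ∀ n w, R.h n w = hMode n • w) (hf : ∀ n w, R.f n w = fMode n • w) (n : ℤ) (w : M) :
    HasFinsum (fun j => sugawaraTerm n j • w) ((2 : ℂ) • R.sug n w) := by
  refine (R.hasFinsum_sugTerm n w).congr fun j => ?_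
  rcases lt_or_ge j 0 with hj | hj
  · simp only [ModeRep.sugTerm, sugawaraTerm, if_pos hj, LinearMap.add_apply, LinearMap.smul_apply,
      nord_of_neg _ _ hj, he, hh, hf, add_smul, mul_smul, smul_assoc]
  · simp only [ModeRep.sugTerm, sugawaraTerm, if_neg hj.not_gt, LinearMap.add_apply,
      LinearMap.smul_apply, nord_of_nonneg _ _ hj, he, hh, hf, add_smul, mul_smul, smul_assoc]

theorem sugawara_eq (R : ModeRep M) (he : ∀ n w, R.e n w = eMode n • w)
    (hh : ∀ n w, R.h n w = hMode n • w) (hf : ∀ n w, R.f n w = fMode n • w) (n : ℤ) (w : M) :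
    sugawara n w = R.sug n w := by
  rw [sugawara, (hasFinsum_sugawaraTerm R he hh hf n w).2, algebraMap_smul', smul_smul]
  norm_num

end UMod

/-- `∑ᶠ` over an infinite support is `0` by convention, so linear maps commute with it only when the
sum in the source is known to be finite. -/
theorem map_sugawara {M M' : Type*} [AddCommGroup M] [Module U M] [AddCommGroup M'] [Module U M'] (φ : M →ₗ[U] M') {n : ℤ} {w s : M}
    (h : HasFinsum (fun j => sugawaraTerm n j • w) s) : φ (sugawara n w) = sugawara n (φ w) := by
  rw [sugawara, sugawara, map_smul, ← LinearMap.toAddMonoidHom_coe, AddMonoidHom.map_finsum _ h.1]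
  simp only [LinearMap.toAddMonoidHom_coe, map_smul]

/-! ### The quotients of the Verma module -/

theorem isHighestWeightVector_weylVec (m : ℕ) : IsHighestWeightVector (m : ℂ) (weylVec m) where
  span_eq_top := by
    refine Submodule.eq_top_iff'.mpr fun w => Submodule.mem_span_singleton.mpr ?_
    obtain ⟨w, rfl⟩ := Submodule.Quotient.mk_surjective _ w
    obtain ⟨u, rfl⟩ := Submodule.Quotient.mk_surjective _ w
    refine ⟨u, ?_⟩
    exact congrArg (fun z => (Submodule.Quotient.mk (Submodule.Quotient.mk z : Verma (m : ℂ) (-2)) :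
      Weyl m)) (mul_one u)
  smul_eq x hx := by
    have h : ι ℂ x • vermaVec (m : ℂ) (-2) =
        algebraMap ℂ U ((m : ℂ) * x.h.coeff 0 + -2 * x.c) • vermaVec (m : ℂ) (-2) := by
      rw [vermaVec, ← Submodule.Quotient.mk_smul, ← Submodule.Quotient.mk_smul, smul_eq_mul,
        smul_eq_mul, mul_one, mul_one, Submodule.Quotient.eq]
      exact Submodule.subset_span ⟨x, hx, rfl⟩
    rw [weylVec, ← Submodule.Quotient.mk_smul, h, Submodule.Quotient.mk_smul, algebraMap_smul']

/-- The image of the highest weight vector in `V_m^{q(t)}`. -/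
def weylQuotientVec (m : ℕ) (q : Laurent) : WeylQuotient m q := Submodule.Quotient.mk (weylVec m)

theorem isHighestWeightVector_weylQuotientVec (m : ℕ) (q : Laurent) :
    IsHighestWeightVector (m : ℂ) (weylQuotientVec m q) where
  span_eq_top := by
    refine Submodule.eq_top_iff'.mpr fun w => Submodule.mem_span_singleton.mpr ?_
    obtain ⟨w, rfl⟩ := Submodule.Quotient.mk_surjective _ w
    have hw : w ∈ Submodule.span U {weylVec m} :=
      (isHighestWeightVector_weylVec m).span_eq_top ▸ Submodule.mem_top
    obtain ⟨u, rfl⟩ := Submodule.mem_span_singleton.mp hw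
    exact ⟨u, rfl⟩
  smul_eq x hx := by
    rw [weylQuotientVec, ← Submodule.Quotient.mk_smul, (isHighestWeightVector_weylVec m).smul_eq x hx,
      Submodule.Quotient.mk_smul]

theorem isWeylVector_weylQuotientVec (m : ℕ) (q : Laurent) :
    (isHighestWeightVector_weylQuotientVec m q).modeRep.IsWeylVector m (qCoeff q)
      (weylQuotientVec m q) := by
  have hv := isHighestWeightVector_weylQuotientVec m q
  refine ⟨fun n hn => ?_, fun n hn => ?_, fun n hn => ?_, ?_, ?_, fun n => ?_,
    fun p hp he hh hf => hv.eq_top_of_modes hp he hh hf⟩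
  · refine (hv.smul_eq ⟨tpow n, 0, 0, 0⟩ ⟨(vanishesBelow_tpow n).mono hn, fun _ _ => rfl,
      fun _ _ => rfl⟩).trans ?_
    simp
  · refine (hv.smul_eq ⟨0, tpow n, 0, 0⟩ ⟨fun _ _ => rfl, (vanishesBelow_tpow n).mono hn.le,
      fun _ _ => rfl⟩).trans ?_
    simp [vanishesBelow_tpow n 0 hn]
  · refine (hv.smul_eq ⟨0, 0, tpow n, 0⟩ ⟨fun _ _ => rfl, fun _ _ => rfl,
      fun k hk => vanishesBelow_tpow n k (by lia)⟩).trans ?_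
    simp
  · refine (hv.smul_eq ⟨0, tpow 0, 0, 0⟩ ⟨fun _ _ => rfl, vanishesBelow_tpow 0,
      fun _ _ => rfl⟩).trans ?_
    simp [tpow_coeff]
  · have hpow : ∀ k : ℕ, (hv.modeRep.f 0 ^ k) (weylQuotientVec m q) =
        fMode 0 ^ k • weylQuotientVec m q := by
      intro k
      change (Algebra.lsmul ℂ ℂ _ (fMode 0) ^ k) _ = _
      rw [← map_pow]
      rfl
    rw [hpow, weylQuotientVec, weylVec, ← Submodule.Quotient.mk_smul, ← Submodule.Quotient.mk_smul,
      (Submodule.Quotient.mk_eq_zero _).mpr (Submodule.mem_span_singleton_self _)]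
    rfl
  · rw [← sugawara_eq hv.modeRep (fun _ _ => rfl) (fun _ _ => rfl) (fun _ _ => rfl)]
    have h := map_sugawara (centralSubmodule m q).mkQ (hasFinsum_sugawaraTerm
      (isHighestWeightVector_weylVec m).modeRep (fun _ _ => rfl) (fun _ _ => rfl) (fun _ _ => rfl) n
      (weylVec m))
    refine h.symm.trans ?_
    have hmem : sugawara n (weylVec m) - algebraMap ℂ U (qCoeff q n) • weylVec m ∈
      centralSubmodule m q := Submodule.subset_span ⟨n, rfl⟩
    rw [Submodule.mkQ_apply, (Submodule.Quotient.eq _).mpr hmem, algebraMap_smul']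
    rfl

theorem obstruction_eq_zero_of_nontrivial {m : ℕ} {q : Laurent} (h : Nontrivial (WeylQuotient m q)) :
    obstruction m (qSeq q) = 0 := by
  have hv := isHighestWeightVector_weylQuotientVec m q
  have hne : weylQuotientVec m q ≠ 0 := by
    intro h0
    have := hv.span_eq_top
    rw [h0, Submodule.span_zero_singleton] at this
    exact bot_ne_top this
  have := (isWeylVector_weylQuotientVec m q).obstruction_eq_zero hne
  rw [← this]
  congr 1
  funext i
  rw [qSeq, qCoeff, neg_neg]

open UniversalEnvelopingAlgebra (ι)

/-! ### From modes to modules over the enveloping algebra -/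

section ModeSum

variable {V : Type*} [AddCommGroup V] [Module ℂ V] {A B C : ℤ → V →ₗ[ℂ] V}

theorem IsSmooth.hasFinsum_coeff_smul (hA : IsSmooth A) (g : Laurent) (w : V) :
    HasFinsum (fun j => g.coeff j • A j w) (∑ᶠ j, g.coeff j • A j w) := by
  obtain ⟨N, hN⟩ := hA w
  obtain ⟨a, ha⟩ := exists_vanishesBelow g
  exact .of_bound a N (fun j hj => by rw [ha j hj, zero_smul]) fun j hj => by rw [hN j hj, smul_zero]

/-- The action of `∑ gₙ A(n)` for a Laurent series `g = ∑ gₙ tⁿ`. -/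
def modeSum (hA : IsSmooth A) : Laurent →ₗ[ℂ] V →ₗ[ℂ] V :=
  LinearMap.mk₂ ℂ (fun g w => ∑ᶠ j, g.coeff j • A j w)
    (fun g₁ g₂ w => (hA.hasFinsum_coeff_smul _ w).unique
      (((hA.hasFinsum_coeff_smul g₁ w).add (hA.hasFinsum_coeff_smul g₂ w)).congr fun j => by
        rw [HahnSeries.coeff_add, add_smul]))
    (fun r g w => (hA.hasFinsum_coeff_smul _ w).unique
      (((hA.hasFinsum_coeff_smul g w).smul r).congr fun j => by
        rw [HahnSeries.coeff_smul, smul_assoc]))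
    (fun g w₁ w₂ => (hA.hasFinsum_coeff_smul _ _).unique
      (((hA.hasFinsum_coeff_smul g w₁).add (hA.hasFinsum_coeff_smul g w₂)).congr fun j => by
        rw [map_add, smul_add]))
    (fun r g w => (hA.hasFinsum_coeff_smul _ _).unique
      (((hA.hasFinsum_coeff_smul g w).smul r).congr fun j => by
        rw [map_smul, smul_comm]))

theorem hasFinsum_modeSum (hA : IsSmooth A) (g : Laurent) (w : V) :
    HasFinsum (fun j => g.coeff j • A j w) (modeSum hA g w) := hA.hasFinsum_coeff_smul g w

theorem modeSum_tpow (hA : IsSmooth A) (n : ℤ) (w : V) : modeSum hA (tpow n) w = A n w := by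
  refine (hasFinsum_modeSum hA (tpow n) w).unique ((HasFinsum.single_ite n (A n w)).congr fun j => ?_)
  rw [tpow_coeff]
  split_ifs with h
  · rw [h, one_smul]
  · rw [zero_smul]

theorem exists_modeSum_eq_zero (hA : IsSmooth A) (w : V) :
    ∃ N, ∀ g, VanishesBelow N g → modeSum hA g w = 0 := by
  obtain ⟨N, hN⟩ := hA w
  refine ⟨N, fun g hg => (hasFinsum_modeSum hA g w).unique (HasFinsum.zero.congr fun j => ?_)⟩
  rcases lt_or_ge j N with hj | hj
  · rw [hg j hj, zero_smul]
  · rw [hN j hj, smul_zero]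

/-- A linear map that is continuous and vanishes on monomials is zero. -/
theorem eq_zero_of_tpow {Φ : Laurent →ₗ[ℂ] V} {N : ℤ} (hN : ∀ g, VanishesBelow N g → Φ g = 0)
    (h : ∀ n, Φ (tpow n) = 0) (g : Laurent) : Φ g = 0 := by
  obtain ⟨a, ha⟩ := exists_vanishesBelow g
  have h₁ := hN _ (ha.sub_window N)
  rw [map_sub, sub_eq_zero] at h₁
  rw [h₁, window, map_sum]
  exact Finset.sum_eq_zero fun n _ => by rw [map_smul, h, smul_zero]

/-- The residue as a linear map. -/
def resₗ : Laurent →ₗ[ℂ] ℂ where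
  toFun := res
  map_add' := AffineSl2.res_add
  map_smul' := AffineSl2.res_smul

theorem res_eq_zero {g : Laurent} (hg : VanishesBelow 0 g) : res g = 0 := hg _ (by lia)

/-- Both sides are linear and vanish on series of high order in each argument, so the identity
extends from monomials to Laurent series, one argument at a time. -/
theorem modeSum_comm (hA : IsSmooth A) (hB : IsSmooth B) (hC : IsSmooth C) (r κ : ℂ)
    (h : ∀ i j w, A i (B j w) = B j (A i w) + r • C (i + j) w +
      (if i + j = 0 then κ * (i : ℂ) else 0) • w) (a b : Laurent) (w : V) :
    modeSum hA a (modeSum hB b w) = modeSum hB b (modeSum hA a w) + r • modeSum hC (a * b) w +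
      (κ * res (ddt a * b)) • w := by
  have mono : ∀ (a : Laurent) (j : ℤ), modeSum hA a (B j w) = B j (modeSum hA a w) +
      r • modeSum hC (a * tpow j) w + (κ * res (ddt a * tpow j)) • w := by
    intro a j
    obtain ⟨N₁, h₁⟩ := exists_modeSum_eq_zero hA (B j w)
    obtain ⟨N₂, h₂⟩ := exists_modeSum_eq_zero hA w
    obtain ⟨N₃, h₃⟩ := exists_modeSum_eq_zero hC w
    let Φ : Laurent →ₗ[ℂ] V := (modeSum hA).flip (B j w) - B j ∘ₗ (modeSum hA).flip w -
      r • ((modeSum hC).flip w ∘ₗ LinearMap.mulRight ℂ (tpow j)) -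
      κ • (resₗ ∘ₗ LinearMap.mulRight ℂ (tpow j) ∘ₗ ddt).smulRight w
    have hΦ : ∀ g, Φ g = modeSum hA g (B j w) - B j (modeSum hA g w) -
        r • modeSum hC (g * tpow j) w - κ • res (ddt g * tpow j) • w := fun g => rfl
    have := eq_zero_of_tpow (Φ := Φ) (N := max (max N₁ N₂) (max (N₃ - j) (1 - j))) (fun g hg => by
        rw [hΦ, h₁ g (hg.mono (by lia)), h₂ g (hg.mono (by lia)),
          h₃ _ ((hg.mul (vanishesBelow_tpow j)).mono (by lia)),
          res_eq_zero ((hg.ddt.mul (vanishesBelow_tpow j)).mono (by lia))]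
        simp) (fun n => by
        rw [hΦ, modeSum_tpow, modeSum_tpow, ← tpow_add, modeSum_tpow, res_ddt_tpow_mul_tpow, h]
        split_ifs <;> module) a
    rw [hΦ] at this
    rw [mul_smul, ← sub_eq_zero, ← this]
    module
  obtain ⟨N₁, h₁⟩ := exists_modeSum_eq_zero hB (modeSum hA a w)
  obtain ⟨N₂, h₂⟩ := exists_modeSum_eq_zero hB w
  obtain ⟨N₃, h₃⟩ := exists_modeSum_eq_zero hC w
  obtain ⟨d, hd⟩ := exists_vanishesBelow a
  let Φ : Laurent →ₗ[ℂ] V := modeSum hA a ∘ₗ (modeSum hB).flip w - (modeSum hB).flip (modeSum hA a w) -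
    r • ((modeSum hC).flip w ∘ₗ LinearMap.mulLeft ℂ a) -
    κ • (resₗ ∘ₗ LinearMap.mulLeft ℂ (ddt a)).smulRight w
  have hΦ : ∀ g, Φ g = modeSum hA a (modeSum hB g w) - modeSum hB g (modeSum hA a w) -
      r • modeSum hC (a * g) w - κ • res (ddt a * g) • w := fun g => rfl
  have := eq_zero_of_tpow (Φ := Φ) (N := max (max N₁ N₂) (max (N₃ - d) (1 - d))) (fun g hg => by
      rw [hΦ, h₁ g (hg.mono (by lia)), h₂ g (hg.mono (by lia)), h₃ _ ((hd.mul hg).mono (by lia)),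
        res_eq_zero ((hd.ddt.mul hg).mono (by lia))]
      simp) (fun n => by
      rw [hΦ, modeSum_tpow, modeSum_tpow, mono]
      module) b
  rw [hΦ] at this
  rw [mul_smul, ← sub_eq_zero, ← this]
  module

end ModeSum

namespace ModeRep

attribute [local instance] LieRing.ofAssociativeRing

variable {V : Type*} [AddCommGroup V] [Module ℂ V] (R : ModeRep V)

/-- The action of the affine Lie algebra. -/
def toEndₗ : AffineSl2 →ₗ[ℂ] Module.End ℂ V where
  toFun x := modeSum R.e_smooth x.e + modeSum R.h_smooth x.h + modeSum R.f_smooth x.f +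
    (-2 * x.c) • (1 : Module.End ℂ V)
  map_add' x y := by
    simp only [AffineSl2.add_e, AffineSl2.add_h, AffineSl2.add_f, AffineSl2.add_c, map_add]
    module
  map_smul' r x := by
    simp only [AffineSl2.smul_e, AffineSl2.smul_h, AffineSl2.smul_f, AffineSl2.smul_c, map_smul,
      RingHom.id_apply]
    module

theorem toEndₗ_apply (x : AffineSl2) (w : V) : R.toEndₗ x w = modeSum R.e_smooth x.e w +
    modeSum R.h_smooth x.h w + modeSum R.f_smooth x.f w + (-2 * x.c) • w := rfl

theorem toEndₗ_lie (x y : AffineSl2) (w : V) :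
    R.toEndₗ ⁅x, y⁆ w = R.toEndₗ x (R.toEndₗ y w) - R.toEndₗ y (R.toEndₗ x w) := by
  have ee := fun a b => modeSum_comm R.e_smooth R.e_smooth R.e_smooth 0 0
    (fun i j w => by rw [R.ee]; simp) a b w
  have ff := fun a b => modeSum_comm R.f_smooth R.f_smooth R.f_smooth 0 0
    (fun i j w => by rw [R.ff]; simp) a b w
  have hh := fun a b => modeSum_comm R.h_smooth R.h_smooth R.h_smooth 0 (-4)
    (fun i j w => by rw [R.hh i j, zero_smul, add_zero]) a b w
  have he := fun a b => modeSum_comm R.h_smooth R.e_smooth R.e_smooth 2 0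
    (fun i j w => by rw [R.he i j]; simp) a b w
  have hf := fun a b => modeSum_comm R.h_smooth R.f_smooth R.f_smooth (-2) 0
    (fun i j w => by rw [R.hf i j]; simp [sub_eq_add_neg]) a b w
  have ef := fun a b => modeSum_comm R.e_smooth R.f_smooth R.h_smooth 1 (-2)
    (fun i j w => by rw [R.ef i j, one_smul]) a b w
  -- Integration by parts: a derivative has residue zero.
  have c₁ : ∀ a b, res (ddt a * b) = -res (ddt b * a) := by
    intro a b
    have := res_ddt (a * b)
    rw [ddt_mul, AffineSl2.res_add] at this
    rw [mul_comm (ddt b) a]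
    linear_combination this
  have two : ∀ g : Laurent, 2 * g = (2 : ℂ) • g := fun g => by rw [smul_eq_C_mul, map_ofNat]
  simp only [toEndₗ_apply, AffineSl2.lie_e, AffineSl2.lie_h, AffineSl2.lie_f, AffineSl2.lie_c,
    AffineSl2.cocycle, two, map_smul, map_sub, map_add, LinearMap.smul_apply, LinearMap.sub_apply,
    AffineSl2.res_add, AffineSl2.res_smul]
  rw [ee x.e y.e, ff x.f y.f, hh x.h y.h, he x.h y.e, he y.h x.e, hf x.h y.f, hf y.h x.f, ef x.e y.f,
    ef y.e x.f, mul_comm y.h x.e, mul_comm y.h x.f, mul_comm y.e x.f, c₁ x.f y.e]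
  module

/-- The action of the affine Lie algebra as a homomorphism of Lie algebras. -/
def toEnd : AffineSl2 →ₗ⁅ℂ⁆ Module.End ℂ V :=
  { R.toEndₗ with
    map_lie' := fun {x y} => by
      ext w
      rw [Ring.lie_def]
      exact R.toEndₗ_lie x y w }

/-- The action of the enveloping algebra. -/
abbrev moduleU : Module U V :=
  Module.compHom V (UniversalEnvelopingAlgebra.lift ℂ R.toEnd : U →ₐ[ℂ] Module.End ℂ V).toRingHom

/-- Universal property: each hypothesis is one of the defining relations of the Verma module or of
its two successive quotients, so the map `1 ↦ v` descends to `WeylQuotient m q` and sends the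
generator to `v ≠ 0`. -/
theorem nontrivial_weylQuotient {m : ℕ} {q : Laurent} {v : V} (hv0 : v ≠ 0)
    (he : ∀ n ≥ 0, R.e n v = 0) (hh : ∀ n > 0, R.h n v = 0) (hf : ∀ n > 0, R.f n v = 0)
    (hh₀ : R.h 0 v = (m : ℂ) • v) (hpow : (R.f 0 ^ (m + 1)) v = 0)
    (hsug : ∀ n, R.sug n v = qCoeff q n • v) : Nontrivial (WeylQuotient m q) := by
  let : Module U V := R.moduleU
  have hsmul : ∀ (u : U) (w : V), u • w = UniversalEnvelopingAlgebra.lift ℂ R.toEnd u w :=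
    fun _ _ => rfl
  have : IsScalarTower ℂ U V := ⟨fun r u w => by rw [hsmul, map_smul, LinearMap.smul_apply, hsmul]⟩
  have hι : ∀ (x : AffineSl2) (w : V), ι ℂ x • w = R.toEndₗ x w := fun x w => by
    rw [hsmul, UniversalEnvelopingAlgebra.lift_ι_apply]
    rfl
  have hE : ∀ n w, R.e n w = eMode n • w := fun n w => by
    rw [eMode_smul, hι, toEndₗ_apply]
    simp [modeSum_tpow]
  have hH : ∀ n w, R.h n w = hMode n • w := fun n w => by
    rw [hMode_smul, hι, toEndₗ_apply]
    simp [modeSum_tpow]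
  have hF : ∀ n w, R.f n w = fMode n • w := fun n w => by
    rw [fMode_smul, hι, toEndₗ_apply]
    simp [modeSum_tpow]
  have hborel : ∀ x ∈ borel, ι ℂ x • v = ((m : ℂ) * x.h.coeff 0 + -2 * x.c) • v := by
    rintro x ⟨x₁, x₂, x₃⟩
    have e₁ : modeSum R.e_smooth x.e v = 0 :=
      (hasFinsum_modeSum _ _ _).unique (HasFinsum.zero.congr fun j => by
        rcases lt_or_ge j 0 with hj | hj
        · rw [x₁ j hj, zero_smul]
        · rw [he j hj, smul_zero])
    have e₂ : modeSum R.h_smooth x.h v = x.h.coeff 0 • R.h 0 v :=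
      (hasFinsum_modeSum _ _ _).unique (HasFinsum.single 0 fun j hj => by
        rcases lt_or_ge j 0 with hj' | hj'
        · rw [x₂ j hj', zero_smul]
        · rw [hh j (by lia), smul_zero])
    have e₃ : modeSum R.f_smooth x.f v = 0 :=
      (hasFinsum_modeSum _ _ _).unique (HasFinsum.zero.congr fun j => by
        rcases le_or_gt j 0 with hj | hj
        · rw [x₃ j hj, zero_smul]
        · rw [hf j hj, smul_zero])
    rw [hι, toEndₗ_apply, e₁, e₂, e₃, hh₀]
    module
  have hle₁ : vermaIdeal (m : ℂ) (-2) ≤ LinearMap.ker (LinearMap.toSpanSingleton U V v) := by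
    refine Submodule.span_le.mpr ?_
    rintro _ ⟨x, hx, rfl⟩
    rw [SetLike.mem_coe, LinearMap.mem_ker, LinearMap.toSpanSingleton_apply, sub_smul, hborel x hx,
      algebraMap_smul', sub_self]
  let φ₁ : Verma (m : ℂ) (-2) →ₗ[U] V := (vermaIdeal (m : ℂ) (-2)).liftQ _ hle₁
  have hφ₁ : φ₁ (vermaVec (m : ℂ) (-2)) = v := by
    refine (Submodule.liftQ_apply _ _ _).trans ?_
    rw [LinearMap.toSpanSingleton_apply, one_smul]
  have hle₂ : Submodule.span U {fMode 0 ^ (m + 1) • vermaVec (m : ℂ) (-2)} ≤ LinearMap.ker φ₁ := by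
    refine (Submodule.span_singleton_le_iff_mem _ _).mpr ?_
    rw [LinearMap.mem_ker, map_smul, hφ₁, ← hpow]
    have hF' : Algebra.lsmul ℂ ℂ V (fMode 0) = R.f 0 := LinearMap.ext fun w => (hF 0 w).symm
    rw [← hF', ← map_pow]
    rfl
  let φ₂ : Weyl m →ₗ[U] V := Submodule.liftQ _ φ₁ hle₂
  have hφ₂ : φ₂ (weylVec m) = v := (Submodule.liftQ_apply _ _ _).trans hφ₁
  have hle₃ : centralSubmodule m q ≤ LinearMap.ker φ₂ := by
    refine Submodule.span_le.mpr ?_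
    rintro _ ⟨n, rfl⟩
    have hfin := hasFinsum_sugawaraTerm (isHighestWeightVector_weylVec m).modeRep (fun _ _ => rfl)
      (fun _ _ => rfl) (fun _ _ => rfl) n (weylVec m)
    rw [SetLike.mem_coe, LinearMap.mem_ker, map_sub, map_sugawara φ₂ hfin, map_smul, hφ₂,
      sugawara_eq R hE hH hF, hsug, algebraMap_smul', sub_self]
  let φ₃ : WeylQuotient m q →ₗ[U] V := Submodule.liftQ _ φ₂ hle₃
  have hφ₃ : φ₃ (weylQuotientVec m q) = v := (Submodule.liftQ_apply _ _ _).trans hφ₂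
  refine ⟨weylQuotientVec m q, 0, fun h => hv0 ?_⟩
  rw [← hφ₃, h, map_zero]

end ModeRep

/-! ### The Wakimoto representation -/

section

variable {V : Type*} [AddCommGroup V] [Module ℂ V] {A B : ℤ → V →ₗ[ℂ] V}

theorem normalProd_comm (hA : IsSmooth A) (hB : IsSmooth B) {n : ℤ} {T : V →ₗ[ℂ] V} {w s : V}
    {d : ℤ → V} (hd : HasFinsum d s)
    (h : ∀ j, nord A B j (n - j) (T w) = T (nord A B j (n - j) w) + d j) :
    normalProd hA hB n (T w) = T (normalProd hA hB n w) + s :=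
  (hasFinsum_normalProd hA hB n (T w)).unique
    ((((hasFinsum_normalProd hA hB n w).map T).add hd).congr h)

theorem modeSum_comm_apply (hA : IsSmooth A) {a : Laurent} {T : V →ₗ[ℂ] V} {w s : V}
    {d : ℤ → V} (hd : HasFinsum d s)
    (h : ∀ j, a.coeff j • A j (T w) = T (a.coeff j • A j w) + d j) :
    modeSum hA a (T w) = T (modeSum hA a w) + s :=
  (hasFinsum_modeSum hA a (T w)).unique ((((hasFinsum_modeSum hA a w).map T).add hd).congr h)

/-- A normally ordered product with the two orders separated at `n` instead of `0`. -/
theorem hasFinsum_nord_shift (hA : IsSmooth A) (hB : IsSmooth B) {N : ℤ} {w x : V}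
    (h : ∀ i, A i (B (N - i) w) = B (N - i) (A i w) + x) (n : ℤ) :
    HasFinsum (fun j => if j < 0 then A (n + j) (B (N - n - j) w) else B (N - n - j) (A (n + j) w))
      (normalProd hA hB N w + (n : ℂ) • x) := by
  have h₁ := ((hasFinsum_normalProd hA hB N w).add (HasFinsum.between_smul (n - 1) x)).shift n
  have h₂ : (((n - 1 : ℤ) : ℂ) + 1) = n := by push_cast; ring
  rw [h₂] at h₁
  refine h₁.congr fun j => ?_
  have hj : N - n - j = N - (j + n) := by ring
  rw [hj, add_comm n j, between]
  rcases lt_or_ge j 0 with hj0 | hj0 <;> rcases lt_or_ge (j + n) 0 with hjn | hjn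
  · rw [if_pos hj0, nord_of_neg _ _ hjn, if_neg (by lia), if_neg (by lia), zero_smul, add_zero]
  · rw [if_pos hj0, nord_of_nonneg _ _ hjn, if_pos (by lia), one_smul, h]
  · rw [if_neg hj0.not_gt, nord_of_neg _ _ hjn, if_neg (by lia), if_pos (by lia), h]
    module
  · rw [if_neg hj0.not_gt, nord_of_nonneg _ _ hjn, if_neg (by lia), if_neg (by lia), zero_smul,
      add_zero]

end

/-- A Fock representation of the `βγ`-system. -/
structure BetaGamma (V : Type*) [AddCommGroup V] [Module ℂ V] where
  b : ℤ → V →ₗ[ℂ] V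
  g : ℤ → V →ₗ[ℂ] V
  b_smooth : IsSmooth b
  g_smooth : IsSmooth g
  bb : ∀ i j w, b i (b j w) = b j (b i w)
  gg : ∀ i j w, g i (g j w) = g j (g i w)
  bg : ∀ i j w, b i (g j w) = g j (b i w) + (if i + j = 0 then (1 : ℂ) else 0) • w
  vac : V
  b_vac : ∀ i ≥ 0, b i vac = 0
  g_vac : ∀ j > 0, g j vac = 0
  gen : ∀ p : Submodule ℂ V, vac ∈ p → (∀ i, ∀ w ∈ p, b i w ∈ p) → (∀ j, ∀ w ∈ p, g j w ∈ p) → p = ⊤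
  -- A vector annihilated by `β(i)`, `i ≥ 0`, and by the charge operator is a multiple of the
  -- vacuum. This substitutes for Schur's lemma below and avoids the double contractions of Wick's
  -- theorem.
  exists_eq_smul_vac : ∀ w, (∀ i ≥ 0, b i w = 0) → normalProd b_smooth g_smooth 0 w = 0 →
    ∃ c : ℂ, w = c • vac
  ct : V →ₗ[ℂ] ℂ
  ct_vac : ct vac = 1
  ct_b : ∀ i < 0, ∀ w, ct (b i w) = 0
  ct_g : ∀ j ≤ 0, ∀ w, ct (g j w) = 0

namespace BetaGamma

variable {V : Type*} [AddCommGroup V] [Module ℂ V] (F : BetaGamma V)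

/-- The modes of `:βγ:`. -/
def J (n : ℤ) : V →ₗ[ℂ] V := normalProd F.b_smooth F.g_smooth n

/-- The modes of `γ²`. -/
def G2 (n : ℤ) : V →ₗ[ℂ] V := normalProd F.g_smooth F.g_smooth n

theorem G2_smooth : IsSmooth F.G2 := normalProd_isSmooth F.g_smooth F.g_smooth

/-- The modes of `γ³`. -/
def G3 (n : ℤ) : V →ₗ[ℂ] V := normalProd F.g_smooth F.G2_smooth n

/-- The modes of `:βγ²:`. -/
def P (n : ℤ) : V →ₗ[ℂ] V := normalProd F.b_smooth F.G2_smooth n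

theorem gb (i j : ℤ) (w : V) :
    F.g j (F.b i w) = F.b i (F.g j w) - (if i + j = 0 then (1 : ℂ) else 0) • w := by
  rw [F.bg, add_sub_cancel_right]

theorem ite_smul_congr {i j n : ℤ} (h : i = n ↔ j = 0) (x y : V) (hxy : j = 0 → x = y) :
    (if j = 0 then (1 : ℂ) else 0) • x = if i = n then y else 0 := by
  by_cases hj : j = 0
  · rw [if_pos hj, if_pos (h.mpr hj), one_smul, hxy hj]
  · rw [if_neg hj, if_neg (h.not.mpr hj), zero_smul]

theorem hasFinsum_G2 (n : ℤ) (w : V) : HasFinsum (fun j => F.g j (F.g (n - j) w)) (F.G2 n w) := by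
  refine (hasFinsum_normalProd F.g_smooth F.g_smooth n w).congr fun j => ?_
  rcases lt_or_ge j 0 with hj | hj
  · rw [nord_of_neg _ _ hj]
  · rw [nord_of_nonneg _ _ hj, F.gg]

theorem J_b (n k : ℤ) (w : V) : F.J n (F.b k w) = F.b k (F.J n w) - F.b (n + k) w := by
  rw [sub_eq_add_neg]
  refine normalProd_comm _ _ (HasFinsum.single_ite (n + k) (F.b (n + k) w)).neg fun j => ?_
  have key : (if k + (n - j) = 0 then (1 : ℂ) else 0) • F.b j w =
      if j = n + k then F.b (n + k) w else 0 :=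
    ite_smul_congr (by lia) _ _ fun h => by rw [show n + k = j by lia]
  rcases lt_or_ge j 0 with hj | hj
  · rw [nord_of_neg _ _ hj, nord_of_neg _ _ hj, F.gb, map_sub, map_smul, key, F.bb, sub_eq_add_neg]
  · rw [nord_of_nonneg _ _ hj, nord_of_nonneg _ _ hj, F.bb, F.gb, key, sub_eq_add_neg]

theorem J_g (n k : ℤ) (w : V) : F.J n (F.g k w) = F.g k (F.J n w) + F.g (n + k) w := by
  refine normalProd_comm _ _ (HasFinsum.single_ite (-k) (F.g (n + k) w)) fun j => ?_
  have key : (if j + k = 0 then (1 : ℂ) else 0) • F.g (n - j) w =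
      if j = -k then F.g (n + k) w else 0 :=
    ite_smul_congr (by lia) _ _ fun h => by rw [show n - j = n + k by lia]
  rcases lt_or_ge j 0 with hj | hj
  · rw [nord_of_neg _ _ hj, nord_of_neg _ _ hj, F.gg, F.bg, key]
  · rw [nord_of_nonneg _ _ hj, nord_of_nonneg _ _ hj, F.bg, map_add, map_smul, key, F.gg]

theorem G2_g (n k : ℤ) (w : V) : F.G2 n (F.g k w) = F.g k (F.G2 n w) :=
  (F.hasFinsum_G2 n (F.g k w)).unique (((F.hasFinsum_G2 n w).map (F.g k)).congr fun j => by
    rw [F.gg (n - j), F.gg j])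

theorem hasFinsum_G3 (n : ℤ) (w : V) : HasFinsum (fun j => F.g j (F.G2 (n - j) w)) (F.G3 n w) := by
  refine (hasFinsum_normalProd F.g_smooth F.G2_smooth n w).congr fun j => ?_
  rcases lt_or_ge j 0 with hj | hj
  · rw [nord_of_neg _ _ hj]
  · rw [nord_of_nonneg _ _ hj, F.G2_g]

theorem b_G2 (k n : ℤ) (w : V) : F.b k (F.G2 n w) = F.G2 n (F.b k w) + (2 : ℂ) • F.g (n + k) w := by
  have h₁ := HasFinsum.single_ite (n + k) (F.g (n + k) w)
  have h₂ := HasFinsum.single_ite (-k) (F.g (n + k) w)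
  have h := ((F.hasFinsum_G2 n (F.b k w)).add h₁).add h₂
  rw [two_smul, ← add_assoc]
  refine ((F.hasFinsum_G2 n w).map (F.b k)).unique (h.congr fun j => ?_)
  have k₁ : (if k + (n - j) = 0 then (1 : ℂ) else 0) • F.g j w =
      if j = n + k then F.g (n + k) w else 0 :=
    ite_smul_congr (by lia) _ _ fun h => by rw [show n + k = j by lia]
  have k₂ : (if k + j = 0 then (1 : ℂ) else 0) • F.g (n - j) w =
      if j = -k then F.g (n + k) w else 0 :=
    ite_smul_congr (by lia) _ _ fun h => by rw [show n - j = n + k by lia]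
  rw [F.bg, F.bg, map_add, map_smul, k₁, k₂]

theorem J_G2 (n k : ℤ) (w : V) :
    F.J n (F.G2 k w) = F.G2 k (F.J n w) + (2 : ℂ) • F.G2 (n + k) w := by
  have h₁ := (F.hasFinsum_G2 (n + k) w).shift n
  have h := ((F.hasFinsum_G2 k (F.J n w)).add h₁).add (F.hasFinsum_G2 (n + k) w)
  rw [two_smul, ← add_assoc]
  refine ((F.hasFinsum_G2 k w).map (F.J n)).unique (h.congr fun j => ?_)
  rw [F.J_g, F.J_g, map_add, show n + k - (j + n) = k - j by ring, show n + (k - j) = n + k - j by ring,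
    add_comm j n]
  abel

theorem P_b (n k : ℤ) (w : V) : F.P n (F.b k w) = F.b k (F.P n w) - (2 : ℂ) • F.J (n + k) w := by
  rw [sub_eq_add_neg]
  refine normalProd_comm _ _
    ((hasFinsum_normalProd F.b_smooth F.g_smooth (n + k) w).smul 2).neg fun j => ?_
  have key : ∀ l, F.G2 l (F.b k w) = F.b k (F.G2 l w) - (2 : ℂ) • F.g (l + k) w := fun l => by
    rw [F.b_G2, add_sub_cancel_right]
  have hj' : n - j + k = n + k - j := by ring
  rcases lt_or_ge j 0 with hj | hj
  · rw [nord_of_neg _ _ hj, nord_of_neg _ _ hj, nord_of_neg _ _ hj, key, map_sub, map_smul, F.bb, hj',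
      sub_eq_add_neg]
  · rw [nord_of_nonneg _ _ hj, nord_of_nonneg _ _ hj, nord_of_nonneg _ _ hj, F.bb]
    have := F.b_G2 k (n - j) (F.b j w)
    rw [this, hj']
    abel

theorem P_g (n k : ℤ) (w : V) : F.P n (F.g k w) = F.g k (F.P n w) + F.G2 (n + k) w := by
  refine normalProd_comm _ _ (HasFinsum.single_ite (-k) (F.G2 (n + k) w)) fun j => ?_
  have key : (if j + k = 0 then (1 : ℂ) else 0) • F.G2 (n - j) w =
      if j = -k then F.G2 (n + k) w else 0 :=
    ite_smul_congr (by lia) _ _ fun h => by rw [show n - j = n + k by lia]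
  rcases lt_or_ge j 0 with hj | hj
  · rw [nord_of_neg _ _ hj, nord_of_neg _ _ hj, F.G2_g, F.bg, key]
  · rw [nord_of_nonneg _ _ hj, nord_of_nonneg _ _ hj, F.bg, map_add, map_smul, key, F.G2_g]

/-- Commuting with `J(n)` shifts the index of either factor, with opposite signs. The two resulting
sums cancel up to the displacement of the normal ordering point by `n`, which leaves `n`
contractions. -/
theorem J_J (n k : ℤ) (w : V) : F.J k (F.J n w) =
    F.J n (F.J k w) + (if n + k = 0 then (n : ℂ) else 0) • w := by
  have h₁ := hasFinsum_nord_shift F.b_smooth F.g_smooth (N := n + k) (w := w)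
    (x := (if n + k = 0 then (1 : ℂ) else 0) • w)
    (fun i => by rw [F.bg, add_sub_cancel]) n
  have h₂ := h₁.sub (hasFinsum_normalProd F.b_smooth F.g_smooth (n + k) w)
  rw [add_sub_cancel_left (normalProd F.b_smooth F.g_smooth (n + k) w), smul_smul, mul_ite, mul_one, mul_zero] at h₂
  refine normalProd_comm (A := F.b) (B := F.g) F.b_smooth F.g_smooth h₂ fun j => ?_
  rw [show n + k - n - j = k - j by ring, show n + k - j = n + (k - j) by ring]
  rcases lt_or_ge j 0 with hj | hj
  · rw [nord_of_neg _ _ hj, nord_of_neg _ _ hj, nord_of_neg _ _ hj, if_pos hj, F.J_b, F.J_g, map_add]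
    abel
  · rw [nord_of_nonneg _ _ hj, nord_of_nonneg _ _ hj, nord_of_nonneg _ _ hj, if_neg hj.not_gt, F.J_g,
      F.J_b, map_sub]
    abel

theorem J_P (n k : ℤ) (w : V) :
    F.J n (F.P k w) = F.P k (F.J n w) + F.P (n + k) w - (2 * (n : ℂ)) • F.g (n + k) w := by
  have h₁ := hasFinsum_nord_shift F.b_smooth F.G2_smooth (N := n + k) (w := w)
    (x := (2 : ℂ) • F.g (n + k) w) (fun i => by rw [F.b_G2, sub_add_cancel]) n
  have h₂ := h₁.sub ((hasFinsum_normalProd F.b_smooth F.G2_smooth (n + k) w).smul 2)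
  have := normalProd_comm (A := F.b) (B := F.G2) (n := k) (T := F.J n) (w := w) F.b_smooth F.G2_smooth
    h₂ fun j => by
      rw [show n + k - n - j = k - j by ring, show n + k - j = n + (k - j) by ring]
      rcases lt_or_ge j 0 with hj | hj
      · rw [nord_of_neg _ _ hj, nord_of_neg _ _ hj, nord_of_neg _ _ hj, if_pos hj, F.J_b, F.J_G2,
          map_add, map_smul]
        abel
      · rw [nord_of_nonneg _ _ hj, nord_of_nonneg _ _ hj, nord_of_nonneg _ _ hj, if_neg hj.not_gt,
          F.J_G2, F.J_b, map_sub]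
        abel
  change F.P k (F.J n w) = F.J n (F.P k w) + (F.P (n + k) w + (n : ℂ) • (2 : ℂ) • F.g (n + k) w -
    (2 : ℂ) • F.P (n + k) w) at this
  rw [this]
  module

variable (χ : Laurent)

/-- The modes of `χγ`. -/
def Cg (n : ℤ) : V →ₗ[ℂ] V := modeSum F.g_smooth (tpow (n + 1) * χ)

theorem Cg_b (n k : ℤ) (w : V) :
    F.Cg χ n (F.b k w) = F.b k (F.Cg χ n w) - χ.coeff (-(n + k) - 1) • w := by
  rw [sub_eq_add_neg]
  refine modeSum_comm_apply _ (HasFinsum.single_ite (-k) (χ.coeff (-(n + k) - 1) • w)).neg fun j => ?_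
  rw [F.gb, smul_sub, map_smul, sub_eq_add_neg, tpow_mul_coeff]
  congr 2
  by_cases h : k + j = 0
  · rw [if_pos h, if_pos (by lia), one_smul, show j - (n + 1) = -(n + k) - 1 by lia]
  · rw [if_neg h, if_neg (by lia), zero_smul, smul_zero]

theorem Cg_g (n k : ℤ) (w : V) : F.Cg χ n (F.g k w) = F.g k (F.Cg χ n w) := by
  rw [← add_zero (F.g k (F.Cg χ n w))]
  refine modeSum_comm_apply _ HasFinsum.zero fun j => ?_
  rw [F.gg, map_smul, add_zero]

theorem J_Cg (n k : ℤ) (w : V) : F.J n (F.Cg χ k w) = F.Cg χ k (F.J n w) + F.Cg χ (n + k) w := by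
  have h := ((hasFinsum_modeSum F.g_smooth (tpow (n + k + 1) * χ) w).shift n).neg
  have := modeSum_comm_apply (a := tpow (k + 1) * χ) (T := F.J n) (w := w) F.g_smooth h fun j => by
    rw [map_smul, F.J_g, tpow_mul_coeff, tpow_mul_coeff,
      show j + n - (n + k + 1) = j - (k + 1) by ring, add_comm j n]
    module
  change F.Cg χ k (F.J n w) = F.J n (F.Cg χ k w) + -F.Cg χ (n + k) w at this
  rw [this]
  abel

/-- The modes `h(n)`. -/
def h (n : ℤ) : V →ₗ[ℂ] V := (-2 : ℂ) • F.J n + χ.coeff (-n - 1) • LinearMap.id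

/-- The modes `f(n)`. -/
def f (n : ℤ) : V →ₗ[ℂ] V := -F.P n + (2 * (n : ℂ)) • F.g n + F.Cg χ n

theorem h_apply (n : ℤ) (w : V) : F.h χ n w = (-2 : ℂ) • F.J n w + χ.coeff (-n - 1) • w := rfl

theorem f_apply (n : ℤ) (w : V) :
    F.f χ n w = -F.P n w + (2 * (n : ℂ)) • F.g n w + F.Cg χ n w := rfl

theorem f_b (n k : ℤ) (w : V) : F.f χ n (F.b k w) = F.b k (F.f χ n w) - F.h χ (n + k) w -
    (if n + k = 0 then 2 * (n : ℂ) else 0) • w := by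
  rw [f_apply, f_apply, h_apply, F.P_b, F.gb, F.Cg_b]
  simp only [map_add, map_neg, map_smul, smul_sub, add_comm k n]
  split_ifs <;> module

theorem f_g (n k : ℤ) (w : V) : F.f χ n (F.g k w) = F.g k (F.f χ n w) - F.G2 (n + k) w := by
  rw [f_apply, f_apply, F.P_g, F.gg, F.Cg_g]
  simp only [map_add, map_neg, map_smul]
  module

theorem J_f (n k : ℤ) (w : V) : F.J n (F.f χ k w) = F.f χ k (F.J n w) + F.f χ (n + k) w := by
  rw [f_apply, f_apply, f_apply]
  simp only [map_add, map_neg, map_smul]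
  rw [F.J_P, F.J_g, F.J_Cg]
  push_cast
  module

theorem h_f (n k : ℤ) (w : V) :
    F.h χ n (F.f χ k w) = F.f χ k (F.h χ n w) - (2 : ℂ) • F.f χ (n + k) w := by
  rw [h_apply, h_apply, map_add, map_smul, map_smul, F.J_f]
  module

theorem f_G2 (n k : ℤ) (w : V) :
    F.f χ n (F.G2 k w) = F.G2 k (F.f χ n w) - (2 : ℂ) • F.G3 (n + k) w := by
  have h₁ := (F.hasFinsum_G3 (n + k) w).reflect k
  have h := ((F.hasFinsum_G2 k (F.f χ n w)).sub h₁).sub (F.hasFinsum_G3 (n + k) w)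
  rw [two_smul, ← sub_sub]
  refine ((F.hasFinsum_G2 k w).map (F.f χ n)).unique (h.congr fun j => ?_)
  rw [F.f_g, F.f_g, map_sub, F.G2_g, show n + k - (k - j) = n + j by ring,
    show n + (k - j) = n + k - j by ring]
  abel

theorem J_vac {n : ℤ} (hn : 0 ≤ n) : F.J n F.vac = 0 := by
  refine (hasFinsum_normalProd F.b_smooth F.g_smooth n F.vac).unique (HasFinsum.zero.congr fun j => ?_)
  rcases lt_or_ge j 0 with hj | hj
  · rw [nord_of_neg _ _ hj, F.g_vac _ (by lia), map_zero]
  · rw [nord_of_nonneg _ _ hj, F.b_vac _ hj, map_zero]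

theorem exists_eq_smul_vac' {w : V} (hb : ∀ i ≥ 0, F.b i w = 0) (hg : ∀ j > 0, F.g j w = 0) :
    ∃ c : ℂ, w = c • F.vac := by
  refine F.exists_eq_smul_vac w hb
    ((hasFinsum_normalProd F.b_smooth F.g_smooth 0 w).unique (HasFinsum.zero.congr fun j => ?_))
  rcases lt_or_ge j 0 with hj | hj
  · rw [nord_of_neg _ _ hj, hg _ (by lia), map_zero]
  · rw [nord_of_nonneg _ _ hj, hb _ hj, map_zero]

/-- The commutator `X` of the two operators commutes with all modes of `β` and `γ`, so `X vac` is a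
multiple of the vacuum. But `X` has charge `2` and the vacuum charge `0`, hence `X vac = 0`, and `X
= 0` because the vacuum generates. -/
theorem f_f (a c : ℤ) (w : V) : F.f χ a (F.f χ c w) = F.f χ c (F.f χ a w) := by
  let X : V →ₗ[ℂ] V := F.f χ a ∘ₗ F.f χ c - F.f χ c ∘ₗ F.f χ a
  have hX : ∀ w, X w = F.f χ a (F.f χ c w) - F.f χ c (F.f χ a w) := fun w => rfl
  have hXb : ∀ k w, X (F.b k w) = F.b k (X w) := by
    intro k w
    simp only [hX, F.f_b, map_sub, map_smul, F.h_f]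
    rw [show a + k + c = c + k + a by ring]
    module
  have hXg : ∀ k w, X (F.g k w) = F.g k (X w) := by
    intro k w
    simp only [hX, F.f_g, map_sub, F.f_G2]
    rw [show a + (c + k) = c + (a + k) by ring]
    module
  have hXJ : F.J 0 (X F.vac) = (2 : ℂ) • X F.vac := by
    simp only [hX, map_sub, F.J_f, F.J_vac le_rfl, map_zero, zero_add]
    module
  obtain ⟨r, hr⟩ := F.exists_eq_smul_vac' (w := X F.vac)
    (fun i hi => by rw [← hXb, F.b_vac i hi, map_zero])
    (fun j hj => by rw [← hXg, F.g_vac j hj, map_zero])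
  have h0 : X F.vac = 0 := by
    have h₁ : F.J 0 (X F.vac) = 0 := by rw [hr, map_smul, F.J_vac le_rfl, smul_zero]
    rw [hXJ] at h₁
    exact (smul_eq_zero.mp h₁).resolve_left two_ne_zero
  have htop := F.gen (LinearMap.ker X) h0
    (fun i w hw => by rw [LinearMap.mem_ker] at hw ⊢; rw [hXb, hw, map_zero])
    (fun i w hw => by rw [LinearMap.mem_ker] at hw ⊢; rw [hXg, hw, map_zero])
  have hw : w ∈ LinearMap.ker X := htop ▸ Submodule.mem_top
  rw [LinearMap.mem_ker, hX, sub_eq_zero] at hw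
  exact hw

variable {χ}

theorem f_smooth (hχ : VanishesBelow (-1) χ) : IsSmooth (F.f χ) := by
  intro w
  obtain ⟨N₁, h₁⟩ := normalProd_isSmooth F.b_smooth F.G2_smooth w
  obtain ⟨N₂, h₂⟩ := F.g_smooth w
  obtain ⟨N₃, h₃⟩ := exists_modeSum_eq_zero F.g_smooth w
  refine ⟨max N₁ (max N₂ N₃), fun n hn => ?_⟩
  rw [f_apply, show F.P n w = 0 from h₁ n (by lia), h₂ n (by lia),
    show F.Cg χ n w = 0 from h₃ _ (((vanishesBelow_tpow (n + 1)).mul hχ).mono (by lia)), smul_zero,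
    neg_zero, add_zero, add_zero]

theorem h_smooth (hχ : VanishesBelow (-1) χ) : IsSmooth (F.h χ) := by
  intro w
  obtain ⟨N, hN⟩ := normalProd_isSmooth F.b_smooth F.g_smooth w
  refine ⟨max N 1, fun n hn => ?_⟩
  rw [h_apply, show F.J n w = 0 from hN n (by lia), hχ _ (by lia), smul_zero, zero_smul, add_zero]

/-- The Wakimoto representation at the critical level attached to `χ(t) = χ₋₁ t⁻¹ + …`. -/
def wakimoto (hχ : VanishesBelow (-1) χ) : ModeRep V where
  e := F.b
  h := F.h χ
  f := F.f χ
  e_smooth := F.b_smooth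
  h_smooth := F.h_smooth hχ
  f_smooth := F.f_smooth hχ
  ee := F.bb
  ff := F.f_f χ
  he a b w := by
    rw [h_apply, h_apply, F.J_b, map_add, map_smul, map_smul]
    module
  hf := F.h_f χ
  ef a b w := by
    rw [F.f_b, add_comm b a]
    by_cases hab : a + b = 0
    · rw [if_pos hab, if_pos hab, show b = -a by lia]
      push_cast
      module
    · rw [if_neg hab, if_neg hab]
      module
  hh a b w := by
    simp only [h_apply, map_add, map_smul]
    rw [F.J_J b a, add_comm b a]
    by_cases hab : a + b = 0
    · rw [if_pos hab, if_pos hab, show b = -a by lia]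
      push_cast
      module
    · rw [if_neg hab, if_neg hab]
      module

theorem Cg_vac (hχ : VanishesBelow (-1) χ) {n : ℤ} (hn : 0 ≤ n) :
    F.Cg χ n F.vac = χ.coeff (-n - 1) • F.g 0 F.vac := by
  have h := HasFinsum.single (f := fun j => (tpow (n + 1) * χ).coeff j • F.g j F.vac) 0 fun j hj => by
    rcases lt_or_ge j 0 with hj' | hj'
    · rw [tpow_mul_coeff, hχ _ (by lia), zero_smul]
    · rw [F.g_vac j (by lia), smul_zero]
  have := (hasFinsum_modeSum F.g_smooth (tpow (n + 1) * χ) F.vac).unique h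
  rw [tpow_mul_coeff, show 0 - (n + 1) = -n - 1 by ring] at this
  exact this

theorem G2_vac {n : ℤ} (hn : 0 < n) : F.G2 n F.vac = 0 := by
  refine (F.hasFinsum_G2 n F.vac).unique (HasFinsum.zero.congr fun j => ?_)
  rcases lt_or_ge 0 j with hj | hj
  · rw [F.gg, F.g_vac j hj, map_zero]
  · rw [F.g_vac _ (by lia), map_zero]

theorem P_vac {n : ℤ} (hn : 0 ≤ n) : F.P n F.vac = 0 := by
  refine (hasFinsum_normalProd F.b_smooth F.G2_smooth n F.vac).unique
    (HasFinsum.zero.congr fun j => ?_)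
  rcases lt_or_ge j 0 with hj | hj
  · rw [nord_of_neg _ _ hj, F.G2_vac (by lia), map_zero]
  · rw [nord_of_nonneg _ _ hj, F.b_vac j hj, map_zero]

theorem h_vac (hχ : VanishesBelow (-1) χ) {n : ℤ} (hn : 0 < n) : F.h χ n F.vac = 0 := by
  rw [h_apply, F.J_vac hn.le, hχ _ (by lia), smul_zero, zero_smul, add_zero]

theorem h_zero_vac : F.h χ 0 F.vac = χ.coeff (-1) • F.vac := by
  rw [h_apply, F.J_vac le_rfl, smul_zero, zero_add]
  rfl

theorem f_vac (hχ : VanishesBelow (-1) χ) {n : ℤ} (hn : 0 < n) : F.f χ n F.vac = 0 := by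
  rw [f_apply, F.P_vac hn.le, F.g_vac n hn, F.Cg_vac hχ hn.le, hχ _ (by lia), zero_smul, smul_zero,
    neg_zero, add_zero, add_zero]

theorem G2_zero_g_pow_vac (k : ℕ) : F.G2 0 ((F.g 0 ^ k) F.vac) = F.g 0 (F.g 0 ((F.g 0 ^ k) F.vac)) := by
  induction k with
  | zero =>
    refine (F.hasFinsum_G2 0 F.vac).unique ((HasFinsum.single 0 fun j hj => ?_).congr fun j => rfl)
    rcases lt_or_ge 0 j with hj' | hj'
    · rw [F.gg, F.g_vac j hj', map_zero]
    · rw [F.g_vac _ (by lia), map_zero]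
  | succ k ih => rw [pow_succ', Module.End.mul_apply, F.G2_g, ih]

/-- On polynomials in `x = γ(0)` applied to the vacuum, `f(0)` acts as `-x²∂ₓ + χ₋₁x`. With `χ₋₁ =
m` this annihilates `x^m`. -/
theorem f_zero_g_pow_vac (hχ : VanishesBelow (-1) χ) (k : ℕ) : F.f χ 0 ((F.g 0 ^ k) F.vac) =
    (χ.coeff (-1) - k) • (F.g 0 ^ (k + 1)) F.vac := by
  induction k with
  | zero =>
    rw [pow_zero, Module.End.one_apply, zero_add, pow_one, f_apply, F.P_vac le_rfl,
      F.Cg_vac hχ le_rfl]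
    simp
  | succ k ih =>
    rw [pow_succ' _ k, Module.End.mul_apply, F.f_g, ih, map_smul, add_zero, F.G2_zero_g_pow_vac,
      pow_succ' _ (k + 1), pow_succ' _ k]
    simp only [Module.End.mul_apply]
    push_cast
    module

theorem f_zero_pow_vac {m : ℕ} (hχ : VanishesBelow (-1) χ) (hm : χ.coeff (-1) = m) :
    (F.f χ 0 ^ (m + 1)) F.vac = 0 := by
  have h : ∀ k : ℕ, ∃ c : ℂ, (F.f χ 0 ^ k) F.vac = c • (F.g 0 ^ k) F.vac := by
    intro k
    induction k with
    | zero => exact ⟨1, by simp⟩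
    | succ k ih =>
      obtain ⟨c, hc⟩ := ih
      refine ⟨c * (χ.coeff (-1) - k), ?_⟩
      rw [pow_succ', Module.End.mul_apply, hc, map_smul, F.f_zero_g_pow_vac hχ, smul_smul]
  obtain ⟨c, hc⟩ := h m
  rw [pow_succ', Module.End.mul_apply, hc, map_smul, F.f_zero_g_pow_vac hχ, hm, sub_self, zero_smul,
    smul_zero]

theorem ct_J {n : ℤ} (hn : n ≤ 0) (w : V) : F.ct (F.J n w) = 0 := by
  refine ((hasFinsum_normalProd F.b_smooth F.g_smooth n w).map F.ct).unique
    (HasFinsum.zero.congr fun j => ?_)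
  rcases lt_or_ge j 0 with hj | hj
  · rw [nord_of_neg _ _ hj, F.ct_b j hj]
  · rw [nord_of_nonneg _ _ hj, F.ct_g _ (by lia)]

theorem ct_h_vac (n : ℤ) : F.ct (F.h χ n F.vac) = χ.coeff (-n - 1) := by
  have : F.ct (F.J n F.vac) = 0 := by
    rcases le_or_gt n 0 with hn | hn
    · exact F.ct_J hn _
    · rw [F.J_vac hn.le, map_zero]
  rw [h_apply, map_add, map_smul, map_smul, this, F.ct_vac, smul_zero, zero_add, smul_eq_mul, mul_one]

theorem ct_nord_h_h_vac (hχ : VanishesBelow (-1) χ) (n j : ℤ) :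
    F.ct (nord (F.h χ) (F.h χ) j (n - j) F.vac) = χ.coeff (-j - 1) * χ.coeff (-(n - j) - 1) := by
  rcases lt_trichotomy j 0 with hj | rfl | hj
  · rw [nord_of_neg _ _ hj, h_apply, map_add, map_smul, map_smul, F.ct_J hj.le, F.ct_h_vac, smul_zero,
      zero_add, smul_eq_mul]
  · rw [nord_of_nonneg _ _ le_rfl, F.h_zero_vac, map_smul, map_smul, F.ct_h_vac, smul_eq_mul]
    rfl
  · rw [nord_of_nonneg _ _ hj.le, F.h_vac hχ hj, map_zero, map_zero, hχ (-j - 1) (by lia), zero_mul]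

theorem ct_normalProd_b_f_vac (hχ : VanishesBelow (-1) χ) (n : ℤ) :
    F.ct (normalProd F.b_smooth (F.f_smooth hχ) n F.vac) = 0 := by
  refine ((hasFinsum_normalProd F.b_smooth (F.f_smooth hχ) n F.vac).map F.ct).unique
    (HasFinsum.zero.congr fun j => ?_)
  rcases lt_or_ge j 0 with hj | hj
  · rw [nord_of_neg _ _ hj, F.ct_b j hj]
  · rw [nord_of_nonneg _ _ hj, F.b_vac j hj, map_zero, map_zero]

end BetaGamma

theorem hasFinsum_coeff_mul {f g : Laurent} (n : ℤ) :
    HasFinsum (fun j => f.coeff j * g.coeff (n - j)) ((f * g).coeff n) := by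
  obtain ⟨b, hb⟩ := exists_vanishesBelow g
  let Φ : Laurent →ₗ[ℂ] ℂ :=
    { toFun := fun f => (f * g).coeff n
      map_add' := fun x y => by rw [add_mul, HahnSeries.coeff_add]
      map_smul' := fun r x => by rw [smul_mul_assoc, HahnSeries.coeff_smul]; rfl }
  have hg' : IsSmooth (fun (i : ℤ) => g.coeff (n - i) • (LinearMap.id : ℂ →ₗ[ℂ] ℂ)) := fun w =>
    ⟨n - b + 1, fun k hk => by simp [hb (n - k) (by lia)]⟩
  let Ψ : Laurent →ₗ[ℂ] ℂ := Φ - (modeSum hg').flip 1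
  obtain ⟨N, hN⟩ := exists_modeSum_eq_zero hg' 1
  have hΨ : ∀ x, Ψ x = (x * g).coeff n - modeSum hg' x 1 := fun x => rfl
  have := eq_zero_of_tpow (Φ := Ψ) (N := max N (n - b + 1)) (fun x hx => by
    rw [hΨ, hN x (hx.mono (by lia)), (hx.mul hb) n (by lia), sub_zero]) (fun k => by
    rw [hΨ, modeSum_tpow, tpow_mul_coeff]
    simp) f
  rw [hΨ, sub_eq_zero] at this
  rw [this]
  exact (hasFinsum_modeSum hg' f 1).congr fun j => by simp

namespace BetaGamma

variable {V : Type*} [AddCommGroup V] [Module ℂ V] (F : BetaGamma V) {χ : Laurent}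

/-- The constant term sees only the scalar part of each mode: `:ef:` contributes nothing, `¼:hh:`
contributes `¼χ²`, and the linear term `½(n+1)h(n)` contributes `-½∂_tχ`. -/
theorem ct_sug_vac (hχ : VanishesBelow (-1) χ) (n : ℤ) : F.ct ((F.wakimoto hχ).sug n F.vac) =
    qCoeff ((1 / 4 : ℂ) • χ ^ 2 - (1 / 2 : ℂ) • ddt χ) n := by
  have hhh : F.ct (normalProd (F.h_smooth hχ) (F.h_smooth hχ) n F.vac) = (χ * χ).coeff (-n - 2) := by
    refine ((hasFinsum_normalProd (F.h_smooth hχ) (F.h_smooth hχ) n F.vac).map F.ct).unique ?_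
    refine ((hasFinsum_coeff_mul (f := χ) (g := χ) (-n - 2)).reflect (-1)).congr fun j => ?_
    rw [F.ct_nord_h_h_vac hχ, show -1 - j = -j - 1 by ring,
      show -n - 2 - (-j - 1) = -(n - j) - 1 by ring]
  have h := (F.wakimoto hχ).sug_apply n F.vac
  rw [h]
  change F.ct (normalProd F.b_smooth (F.f_smooth hχ) n F.vac +
    (1 / 4 : ℂ) • normalProd (F.h_smooth hχ) (F.h_smooth hχ) n F.vac +
      (((n : ℂ) + 1) / 2) • F.h χ n F.vac) = _
  rw [map_add, map_add, map_smul, map_smul, F.ct_normalProd_b_f_vac hχ, hhh, F.ct_h_vac, qCoeff,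
    HahnSeries.coeff_sub, HahnSeries.coeff_smul, HahnSeries.coeff_smul, ddt_coeff, sq,
    show -n - 2 + 1 = -n - 1 by ring]
  simp only [smul_eq_mul]
  push_cast
  ring

/-- By centrality `S_n vac` is annihilated by `β(i)`, `i ≥ 0`, and has the same `h(0)`-weight as the
vacuum. It is therefore a multiple of the vacuum, and the constant term determines the factor. -/
theorem sug_vac (hχ : VanishesBelow (-1) χ) (n : ℤ) : (F.wakimoto hχ).sug n F.vac =
    qCoeff ((1 / 4 : ℂ) • χ ^ 2 - (1 / 2 : ℂ) • ddt χ) n • F.vac := by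
  obtain ⟨c, hc⟩ := F.exists_eq_smul_vac ((F.wakimoto hχ).sug n F.vac)
    (fun i hi => by
      refine ((F.wakimoto hχ).sug_e n i F.vac).symm.trans ?_
      rw [show (F.wakimoto hχ).e i F.vac = 0 from F.b_vac i hi, map_zero])
    (by
      have h := (F.wakimoto hχ).sug_h n 0 F.vac
      change (F.wakimoto hχ).sug n (F.h χ 0 F.vac) = F.h χ 0 ((F.wakimoto hχ).sug n F.vac) at h
      rw [F.h_zero_vac, map_smul, h_apply, show -(0 : ℤ) - 1 = -1 by norm_num, right_eq_add] at h
      exact (smul_eq_zero.mp h).resolve_left (by norm_num))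
  rw [hc, ← F.ct_sug_vac hχ n, hc, map_smul, F.ct_vac, smul_eq_mul, mul_one]

theorem vac_ne_zero : F.vac ≠ 0 := by
  intro h
  have := F.ct_vac
  rw [h, map_zero] at this
  exact zero_ne_one this

theorem nontrivial_weylQuotient (F : BetaGamma V) {m : ℕ} (hχ : VanishesBelow (-1) χ) (hm : χ.coeff (-1) = m) :
    Nontrivial (WeylQuotient m ((1 / 4 : ℂ) • χ ^ 2 - (1 / 2 : ℂ) • ddt χ)) :=
  (F.wakimoto hχ).nontrivial_weylQuotient F.vac_ne_zero F.b_vac (fun _ hn => F.h_vac hχ hn)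
    (fun _ hn => F.f_vac hχ hn) (hm ▸ F.h_zero_vac) (F.f_zero_pow_vac hχ hm) (F.sug_vac hχ)

end BetaGamma

/-! ### The Fock space -/

/-- Polynomials in the creation operators `β(-i-1)` and `γ(-i)`, `i ≥ 0`. -/
abbrev Fock : Type := MvPolynomial (ℕ ⊕ ℕ) ℂ

namespace Fock

open MvPolynomial

/-- The modes of `β`. -/
def b (j : ℤ) : Fock →ₗ[ℂ] Fock :=
  if j < 0 then LinearMap.mulLeft ℂ (X (Sum.inl (-j - 1).toNat))
  else (pderiv (Sum.inr j.toNat)).toLinearMap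

/-- The modes of `γ`. -/
def g (j : ℤ) : Fock →ₗ[ℂ] Fock :=
  if j ≤ 0 then LinearMap.mulLeft ℂ (X (Sum.inr (-j).toNat))
  else -(pderiv (Sum.inl (j - 1).toNat)).toLinearMap

theorem b_of_neg {j : ℤ} (hj : j < 0) (w : Fock) : b j w = X (Sum.inl (-j - 1).toNat) * w := by
  rw [b, if_pos hj]; rfl

theorem b_of_nonneg {j : ℤ} (hj : 0 ≤ j) (w : Fock) : b j w = pderiv (Sum.inr j.toNat) w := by
  rw [b, if_neg hj.not_gt]; rfl

theorem g_of_nonpos {j : ℤ} (hj : j ≤ 0) (w : Fock) : g j w = X (Sum.inr (-j).toNat) * w := by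
  rw [g, if_pos hj]; rfl

theorem g_of_pos {j : ℤ} (hj : 0 < j) (w : Fock) : g j w = -pderiv (Sum.inl (j - 1).toNat) w := by
  rw [g, if_neg hj.not_ge]; rfl

theorem pderiv_comm (i j : ℕ ⊕ ℕ) (w : Fock) : pderiv i (pderiv j w) = pderiv j (pderiv i w) := by
  induction w using MvPolynomial.induction_on with
  | C a => simp
  | add p q hp hq => simp only [map_add, hp, hq]
  | mul_X p n h =>
    simp only [Derivation.leibniz, map_add, smul_eq_mul, h, pderiv_X]
    classical
    by_cases h₁ : i = n <;> by_cases h₂ : j = n <;> simp [h₁, h₂, eq_comm, add_comm]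

theorem exists_pderiv_eq_zero (ι : ℕ → ℕ ⊕ ℕ) (hι : Function.Injective ι) (w : Fock) :
    ∃ N, ∀ n ≥ N, pderiv (ι n) w = 0 := by
  have hfin : {n | ι n ∈ w.vars}.Finite := w.vars.finite_toSet.preimage hι.injOn
  obtain ⟨N, hN⟩ := hfin.bddAbove
  refine ⟨N + 1, fun n hn => pderiv_eq_zero_of_notMem_vars fun h => ?_⟩
  have := hN h
  lia

theorem b_smooth : IsSmooth b := by
  intro w
  obtain ⟨N, hN⟩ := exists_pderiv_eq_zero Sum.inr Sum.inr_injective w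
  exact ⟨N, fun n hn => by rw [b_of_nonneg (by lia), hN _ (by lia)]⟩

theorem g_smooth : IsSmooth g := by
  intro w
  obtain ⟨N, hN⟩ := exists_pderiv_eq_zero Sum.inl Sum.inl_injective w
  exact ⟨N + 1, fun n hn => by rw [g_of_pos (by lia), hN _ (by lia), neg_zero]⟩

theorem coeff_X_mul_pderiv (i : ℕ ⊕ ℕ) (w : Fock) (μ : (ℕ ⊕ ℕ) →₀ ℕ) :
    coeff μ (X i * pderiv i w) = μ i * coeff μ w := by
  induction w using MvPolynomial.induction_on' with
  | monomial ν c =>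
    rw [X_mul_pderiv_monomial, coeff_smul, coeff_monomial]
    split_ifs with h
    · rw [h, nsmul_eq_mul]
    · simp
  | add p q hp hq => rw [map_add, mul_add, coeff_add, coeff_add, hp, hq, mul_add]

theorem pderiv_X_mul (i j : ℕ ⊕ ℕ) (w : Fock) :
    pderiv i (X j * w) = X j * pderiv i w + (if i = j then (1 : ℂ) else 0) • w := by
  classical
  rw [Derivation.leibniz, pderiv_X, smul_eq_mul, smul_eq_mul, Pi.single_apply]
  by_cases h : i = j
  · simp [h]
  · simp [h, Ne.symm h]

theorem bb (i j : ℤ) (w : Fock) : b i (b j w) = b j (b i w) := by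
  rcases lt_or_ge i 0 with hi | hi <;> rcases lt_or_ge j 0 with hj | hj
  · simp only [b_of_neg hi, b_of_neg hj, mul_left_comm]
  · simp only [b_of_neg hi, b_of_nonneg hj, pderiv_X_mul]
    simp
  · simp only [b_of_neg hj, b_of_nonneg hi, pderiv_X_mul]
    simp
  · simp only [b_of_nonneg hi, b_of_nonneg hj, pderiv_comm (Sum.inr i.toNat)]

theorem gg (i j : ℤ) (w : Fock) : g i (g j w) = g j (g i w) := by
  rcases le_or_gt i 0 with hi | hi <;> rcases le_or_gt j 0 with hj | hj
  · simp only [g_of_nonpos hi, g_of_nonpos hj, mul_left_comm]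
  · simp only [g_of_nonpos hi, g_of_pos hj, pderiv_X_mul]
    simp
  · simp only [g_of_nonpos hj, g_of_pos hi, pderiv_X_mul]
    simp
  · simp only [g_of_pos hi, g_of_pos hj, map_neg, pderiv_comm (Sum.inl (i - 1).toNat)]

theorem bg (i j : ℤ) (w : Fock) :
    b i (g j w) = g j (b i w) + (if i + j = 0 then (1 : ℂ) else 0) • w := by
  rcases lt_or_ge i 0 with hi | hi <;> rcases le_or_gt j 0 with hj | hj
  · rw [b_of_neg hi, b_of_neg hi, g_of_nonpos hj, g_of_nonpos hj, mul_left_comm, if_neg (by lia),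
      zero_smul, add_zero]
  · rw [b_of_neg hi, b_of_neg hi, g_of_pos hj, g_of_pos hj, pderiv_X_mul]
    by_cases h : i + j = 0
    · rw [if_pos h, if_pos (congrArg Sum.inl (by lia))]
      simp
    · rw [if_neg h, if_neg (fun h' => h (by have := Sum.inl_injective h'; lia))]
      simp
  · rw [b_of_nonneg hi, b_of_nonneg hi, g_of_nonpos hj, g_of_nonpos hj, pderiv_X_mul]
    by_cases h : i + j = 0
    · rw [if_pos h, if_pos (congrArg Sum.inr (by lia))]
    · rw [if_neg h, if_neg (fun h' => h (by have := Sum.inr_injective h'; lia))]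
  · rw [b_of_nonneg hi, b_of_nonneg hi, g_of_pos hj, g_of_pos hj, map_neg, pderiv_comm,
      if_neg (by lia), zero_smul, add_zero]

theorem eq_zero_of_hasFinsum_natCast {F : ℤ → ℕ} (h : HasFinsum (fun j => (F j : ℂ)) 0) (j : ℤ) :
    F j = 0 := by
  have hfin : (Function.support F).Finite := h.1.subset fun j hj => by
    rw [Function.mem_support] at hj ⊢
    exact_mod_cast hj
  have h₁ : ((∑ᶠ j, F j : ℕ) : ℂ) = 0 := by
    rw [← h.2]
    exact (Nat.castAddMonoidHom ℂ).map_finsum hfin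
  rw [Nat.cast_eq_zero, finsum_eq_sum F hfin, Finset.sum_eq_zero_iff] at h₁
  by_contra hj
  exact hj (h₁ j (hfin.mem_toFinset.mpr hj))

/-- The conditions on `b i` remove all `γ`-variables. On what remains the charge operator multiplies
the coefficient of `μ` by minus its total degree in the `β`-variables; a sum of natural numbers that
vanishes has only zero terms, so `μ = 0`. -/
theorem exists_eq_smul_one (w : Fock) (hb : ∀ i ≥ 0, b i w = 0)
    (hJ : normalProd b_smooth g_smooth 0 w = 0) : ∃ c : ℂ, w = c • 1 := by
  have hzero : ∀ μ : (ℕ ⊕ ℕ) →₀ ℕ, μ ≠ 0 → coeff μ w = 0 := by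
    intro μ hμ
    by_contra hc
    refine hμ (Finsupp.ext fun x => ?_)
    rcases x with k | k
    · have h := ((hasFinsum_normalProd b_smooth g_smooth 0 w).map
        (lcoeff ℂ μ)).smul (-(coeff μ w)⁻¹)
      rw [hJ, map_zero, smul_zero] at h
      have h' := eq_zero_of_hasFinsum_natCast
        (F := fun j => if j < 0 then μ (Sum.inl (-j - 1).toNat) else 0) (h.congr fun j => by
          rcases lt_or_ge j 0 with hj | hj
          · rw [nord_of_neg _ _ hj, g_of_pos (by lia), b_of_neg hj, if_pos hj,
              show 0 - j - 1 = -j - 1 by ring, mul_neg, map_neg, lcoeff_apply, coeff_X_mul_pderiv,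
              smul_eq_mul]
            field_simp
          · rw [nord_of_nonneg _ _ hj, hb j hj, map_zero, map_zero, smul_zero, if_neg hj.not_gt,
              Nat.cast_zero]) (-(k : ℤ) - 1)
      rw [if_pos (by lia)] at h'
      rw [Finsupp.zero_apply, ← h']
      congr 2
      lia
    · have h := hb k (by lia)
      rw [b_of_nonneg (by lia), Int.toNat_natCast] at h
      have h' := coeff_X_mul_pderiv (Sum.inr k) w μ
      rw [h, mul_zero, coeff_zero] at h'
      exact_mod_cast (mul_eq_zero.mp h'.symm).resolve_right hc
  refine ⟨coeff 0 w, MvPolynomial.ext _ _ fun μ => ?_⟩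
  rw [coeff_smul, coeff_one]
  by_cases hμ : μ = 0
  · rw [hμ, if_pos rfl, smul_eq_mul, mul_one]
  · rw [hzero μ hμ, if_neg (Ne.symm hμ), smul_zero]

/-- The Fock representation of the `βγ`-system. -/
def betaGamma : BetaGamma Fock where
  b := b
  g := g
  b_smooth := b_smooth
  g_smooth := g_smooth
  bb := bb
  gg := gg
  bg := bg
  vac := 1
  b_vac i hi := by rw [b_of_nonneg hi, pderiv_one]
  g_vac j hj := by rw [g_of_pos hj, pderiv_one, neg_zero]
  gen p h1 hb hg := by
    refine Submodule.eq_top_iff'.mpr fun w => ?_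
    induction w using MvPolynomial.induction_on with
    | C a =>
      rw [C_eq_smul_one]
      exact p.smul_mem a h1
    | add x y hx hy => exact p.add_mem hx hy
    | mul_X x n hx =>
      rw [mul_comm]
      rcases n with k | k
      · have := hb (-(k : ℤ) - 1) x hx
        rwa [b_of_neg (by lia), show (-(-(k : ℤ) - 1) - 1).toNat = k by lia] at this
      · have := hg (-(k : ℤ)) x hx
        rwa [g_of_nonpos (by lia), neg_neg, Int.toNat_natCast] at this
  exists_eq_smul_vac := exists_eq_smul_one
  ct := (aeval fun _ => (0 : ℂ)).toLinearMap
  ct_vac := by simp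
  ct_b i hi w := by simp [b_of_neg hi]
  ct_g j hj w := by simp [g_of_nonpos hj]

end Fock

end CriticalSl2

end

/-! ### The equivalences assembled. -/

open CriticalSl2 in
theorem mainTheorem1 (m : ℕ) (q : LaurentSeries ℂ)
    (hq : ∀ n < (-2 : ℤ), q.coeff n = 0)
    (hq₂ : q.coeff (-2) = (m : ℂ) * ((m : ℂ) + 2) / 4) :
    (Nontrivial (WeylQuotient m q) ↔ HasMonodromyPlusMinusOne q) ∧
    (HasMonodromyPlusMinusOne q ↔
      ∃ χ : LaurentSeries ℂ,
        (∀ n < (-1 : ℤ), χ.coeff n = 0) ∧ χ.coeff (-1) = (m : ℂ) ∧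
        q = (1 / 4 : ℂ) • χ ^ 2 - (1 / 2 : ℂ) • LaurentSeries.derivative ℂ χ) := by
  have hbc : HasMonodromyPlusMinusOne q ↔ ∃ χ : LaurentSeries ℂ,
      (∀ n < (-1 : ℤ), χ.coeff n = 0) ∧ χ.coeff (-1) = (m : ℂ) ∧
      q = (1 / 4 : ℂ) • χ ^ 2 - (1 / 2 : ℂ) • LaurentSeries.derivative ℂ χ :=
    Iff.trans ⟨exists_frobSol_of_hasMonodromy hq hq₂,
      fun ⟨_, ha₀, ha⟩ => hasMonodromy_of_frobSol hq hq₂ ha₀ ha⟩ exists_miura_iff.symm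
  refine ⟨⟨fun h => ?_, fun h => ?_⟩, hbc⟩
  -- A nonzero module has vanishing obstruction, which provides the second logarithm-free solution;
  -- the converse passes through the Miura solution and its Wakimoto representation.
  · obtain ⟨a, ha₀, ha⟩ := (exists_frobSol_iff hq hq₂).mpr (obstruction_eq_zero_of_nontrivial h)
    exact hasMonodromy_of_frobSol hq hq₂ ha₀ ha
  · obtain ⟨χ, hχ, hχ₁, rfl⟩ := hbc.mp h
    exact Fock.betaGamma.nontrivial_weylQuotient hχ hχ₁
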